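/- **Setting.** Let $U\subset\mathbb{R}^m$ be nonempty and compact, $\mathcal S\subseteq\mathbb{R}^d$ closed and nonempty, $f:\mathbb{R}^d\times U\to\mathbb{R}^d$, $r:\mathbb{R}^d\times U\to\mathbb{R}$, $g:\mathbb{R}^d\to\mathbb{R}$. For $x\in\mathbb{R}^d$ and a measurable control $u:[0,\infty)\to U$ let $y^{x,u}$ be the Carathéodory solution of $y'=f(y,u)$, $y(0)=x$, let $\tau^{x,u}=\min\{t\ge 0: y^{x,u}(t)\in\mathcal S\}$ ($+\infty$ if there is no such $t$), let $\mathcal R$ be the set of $x$ for which $\tau^{x,u}<\infty$ for some $u$, and $$V(x)=\inf_u\Big(\int_0^{\tau^{x,u}} r(y^{x,u},u)\,ds+g(y^{x,u}(\tau^{x,u}))\Big),\qquad x\in\mathcal R,$$ the infimum being over the controls with $\tau^{x,u}<\infty$. A control with $\tau^{x,u}<\infty$ that attains $V(x)$ is called optimal for $x$. For a set $Q$ and a point $x\in Q$, $N^P_Q(x)$ is the set of $v$ such that for some $\sigma\ge0$, $v\cdot(y-x)\le\sigma|y-x|^2$ for all $y\in Q$; $v$ is realized by a ball of radius $\rho$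 if this holds with $\sigma=|v|/(2\rho)$. Let $\mathrm{hypo}(V)=\{(x,\beta): x\in\mathcal R\setminus\mathcal S,\ \beta\le V(x)\}\subset\mathbb{R}^{d+1}$, and for $x\in\mathcal R\setminus\mathcal S$ let $\partial^PV(x)=\{v:(-v,1)\in N^P_{\mathrm{hypo}(V)}(x,V(x))\}$ and $\partial^\infty V(x)=\{v:(-v,0)\in N^P_{\mathrm{hypo}(V)}(x,V(x))\}$. Let $D^+g(x)$ be the set of $p$ with $\limsup_{y\to x}\frac{g(y)-g(x)-p\cdot(y-x)}{|y-x|}\le0$, and $H(x,p)=\max_{\omega\in U}\{-p\cdot f(x,\omega)-r(x,\omega)\}$. For $z\in\partial\mathcal S$ let $N_0(z)$ (resp. $N_1(z)$) be the set of $\xi\in N^P_{\overline{\mathcal S^c}}(z)$ with $\xi\ne0$ and $\max_{\omega\in U}\xi\cdot f(z,\omega)=0$ (resp. $\max_{\omega\in U}\xi\cdot f(z,\omega)>0$). For $x\in\mathcal R\setminus\mathcal S$: - $N_0^\dagger(x)$ is the set of $p(0)$, where, for some control $u$ optimal for $x$, with $y=y^{x,u}$, $\tau=\tau^{x,u}$,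 and some $\xi\in N_0(y(\tau))$, $p$ solves $p'=-D_xf(y,u)^Tp$ on $[0,\tau]$, $p(\tau)=-\xi$; - $N_1^\dagger(x)$ is the set of $p(0)$, where, for some control $u$ optimal for $x$, with $y,\tau$ as above, some $\xi\in N_1(y(\tau))$ and some $q\in D^+g(y(\tau))$ with $H(y(\tau),q-\xi)=0$, $p$ solves $p'=-D_xf(y,u)^Tp-D_xr(y,u)$ on $[0,\tau]$, $p(\tau)=q-\xi$. **Assumptions.** - (H0) For every $x$, $\{(v,\lambda):\exists\,\omega\in U,\ v=f(x,\omega),\ \lambda\ge r(x,\omega)\}$ is convex. - (H1) $f$ is continuous, $|f|<N$, $D_xf$ exists everywhere and is continuous in $(x,\omega)$, and $f$ and $D_xf$ are Lipschitz in $x$ uniformly in $\omega\in U$. - (H2) $r$ is continuous, $D_xr$ exists everywhere and is continuous in $(x,\omega)$, $r$ and $D_xr$ are Lipschitz in $x$ uniformly in $\omega\in U$, and $r\ge r_0$ for a constant $r_0>0$. - (H3) There are an open neighborhood $\mathcal N$ of $\partial\mathcal S$ and a constant $0\le G<r_0/N$ with $|g(y)-g(x)|\le G|y-x|$ for all $x,y\in\mathcal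 N$. - (H4) There is $\rho_0>0$ such that every $x\in\partial\mathcal S$ has a unit vector $\xi\in N^P_{\overline{\mathcal S^c}}(x)$ realized by a ball of radius $\rho_0$. - $g$ is locally semiconcave: every point of $\mathbb{R}^d$ has a ball $B$ around it and a $c>0$ with $(1-\lambda)g(x_0)+\lambda g(x_1)-g((1-\lambda)x_0+\lambda x_1)\le c\lambda(1-\lambda)|x_0-x_1|^2$ for all $x_0,x_1\in B$, $\lambda\in[0,1]$. - $V$ is continuous on $\mathcal R\setminus\mathcal S$. **Theorem.** Under these assumptions: 1. $\mathrm{hypo}(V)$ satisfies an exterior sphere condition: there is a continuous $\rho:\mathcal R\setminus\mathcal S\to(0,\infty)$ such that for every $x\in\mathcal R\setminus\mathcal S$ some nonzero $v\in N^P_{\mathrm{hypo}(V)}(x,V(x))$ is realized by a ball of radius $\rho(x)$. Moreover $\rho$ can be chosen locally uniformly: for every $M$ it is bounded below by a positive constant on $\{x\in\mathcal R\setminus\mathcal S:|x|\le M,\ V(x)\le M\}$. 2. $N_1^\dagger(x)\cup N_0^\dagger(x)\ne\varnothing$ for every $x\in\mathcal R\setminus\mathcal S$. 3. For every $x\in\mathcal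 R\setminus\mathcal S$, $\ \partial^PV(x)\supseteq\partial^\infty V(x)+\mathrm{co}\,N_1^\dagger(x)$ and $\partial^\infty V(x)\supseteq\mathrm{co}\big(N_0^\dagger(x)\cup\{0\}\big)$. -/

import Mathlib

open Set Filter Topology
open scoped Pointwise

noncomputable section

namespace ExitTime

/-- `ℝ^d` with its Euclidean norm. -/
abbrev E (d : ℕ) : Type := EuclideanSpace ℝ (Fin d)

/-! ### Nonsmooth analysis -/

section Nonsmooth

variable {F : Type*} [NormedAddCommGroup F] [InnerProductSpace ℝ F]

/-- The cone of proximal normals `N^P_Q(x)`: all `v` such that, for some `σ ≥ 0`,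
`v · (y - x) ≤ σ |y - x|²` for all `y ∈ Q`. -/
def proximalNormals (Q : Set F) (x : F) : Set F :=
  {v | ∃ σ : ℝ, 0 ≤ σ ∧ ∀ y ∈ Q, inner ℝ v (y - x) ≤ σ * ‖y - x‖ ^ 2}

/-- The normal `v` to `Q` at `x` is realized by a ball of radius `ρ`. -/
def RealizedByBall (Q : Set F) (x v : F) (ρ : ℝ) : Prop :=
  ∀ y ∈ Q, inner ℝ v (y - x) ≤ ‖v‖ / (2 * ρ) * ‖y - x‖ ^ 2

/-- The point `(x, β)` of `ℝ^d × ℝ = ℝ^{d+1}`, with the Euclidean structure. -/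
def pt {d : ℕ} (x : E d) (β : ℝ) : WithLp 2 (E d × ℝ) := WithLp.toLp 2 (x, β)

/-- The hypograph of `φ : Ω → ℝ`. -/
def hypo {d : ℕ} (Ω : Set (E d)) (φ : E d → ℝ) : Set (WithLp 2 (E d × ℝ)) :=
  {q | ∃ x ∈ Ω, ∃ β : ℝ, β ≤ φ x ∧ q = pt x β}

/-- The proximal supergradients `∂^P φ(x)` of `φ : Ω → ℝ`. -/
def proximalSuperdiff {d : ℕ} (Ω : Set (E d)) (φ : E d → ℝ) (x : E d) : Set (E d) :=
  {v | pt (-v) 1 ∈ proximalNormals (hypo Ω φ) (pt x (φ x))}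

/-- The proximal horizontal supergradients `∂^∞ φ(x)` of `φ : Ω → ℝ`. -/
def horizontalSuperdiff {d : ℕ} (Ω : Set (E d)) (φ : E d → ℝ) (x : E d) : Set (E d) :=
  {v | pt (-v) 0 ∈ proximalNormals (hypo Ω φ) (pt x (φ x))}

/-- The hypograph of `φ : Ω → ℝ` satisfies the `ρ(·)`-exterior sphere condition
(`ρ : Ω → (0, ∞)` continuous). -/
def HypoExteriorSphere {d : ℕ} (Ω : Set (E d)) (φ : E d → ℝ) (ρ : E d → ℝ) : Prop :=
  ContinuousOn ρ Ω ∧ (∀ x ∈ Ω, 0 < ρ x) ∧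
    ∀ x ∈ Ω, ∃ v ∈ proximalNormals (hypo Ω φ) (pt x (φ x)),
      v ≠ 0 ∧ RealizedByBall (hypo Ω φ) (pt x (φ x)) v (ρ x)

/-- Local semiconcavity on `ℝ^d`. -/
def LocallySemiconcave {d : ℕ} (g : E d → ℝ) : Prop :=
  ∀ x : E d, ∃ δ > (0 : ℝ), ∃ c > (0 : ℝ),
    ∀ x₀ ∈ Metric.ball x δ, ∀ x₁ ∈ Metric.ball x δ, ∀ l ∈ Icc (0 : ℝ) 1,
      (1 - l) * g x₀ + l * g x₁ - g ((1 - l) • x₀ + l • x₁)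
        ≤ c * (l * (1 - l)) * ‖x₀ - x₁‖ ^ 2

/-- The superdifferential `D⁺g(x)`: all `p` with
`limsup_{y → x} (g(y) - g(x) - p · (y - x)) / |y - x| ≤ 0`. -/
def superdiff {d : ℕ} (g : E d → ℝ) (x : E d) : Set (E d) :=
  {p | ∀ ε > (0 : ℝ), ∀ᶠ y in 𝓝 x, g y - g x - inner ℝ p (y - x) ≤ ε * ‖y - x‖}

end Nonsmooth

/-! ### The optimal exit time problem -/

/-- The data of an optimal exit time problem: control set, dynamics, running cost,
target and terminal cost. Only the values `f x ω`, `r x ω` with `ω ∈ U` are used. -/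
structure Problem (d m : ℕ) where
  U : Set (E m)
  f : E d → E m → E d
  r : E d → E m → ℝ
  S : Set (E d)
  g : E d → ℝ

namespace Problem

variable {d m : ℕ} (P : Problem d m)

/-- The differential `D_x f(x, ω)`. -/
def Dxf (x : E d) (ω : E m) : E d →L[ℝ] E d := fderiv ℝ (fun z => P.f z ω) x

/-- The gradient `D_x r(x, ω)`, as a vector. -/
def Dxr (x : E d) (ω : E m) : E d := gradient (fun z => P.r z ω) x

def H0 : Prop :=
  ∀ x : E d, Convex ℝ {q : E d × ℝ | ∃ ω ∈ P.U, q.1 = P.f x ω ∧ P.r x ω ≤ q.2}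

def H1 (N : ℝ) : Prop :=
  ContinuousOn (fun q : E d × E m => P.f q.1 q.2) (univ ×ˢ P.U) ∧
  (∀ x, ∀ ω ∈ P.U, ‖P.f x ω‖ < N) ∧
  (∀ x, ∀ ω ∈ P.U, DifferentiableAt ℝ (fun z => P.f z ω) x) ∧
  ContinuousOn (fun q : E d × E m => P.Dxf q.1 q.2) (univ ×ˢ P.U) ∧
  (∃ L : ℝ, ∀ x y, ∀ ω ∈ P.U, ‖P.f y ω - P.f x ω‖ ≤ L * ‖y - x‖) ∧
  (∃ L : ℝ, ∀ x y, ∀ ω ∈ P.U, ‖P.Dxf y ω - P.Dxf x ω‖ ≤ L * ‖y - x‖)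

def H2 (r₀ : ℝ) : Prop :=
  ContinuousOn (fun q : E d × E m => P.r q.1 q.2) (univ ×ˢ P.U) ∧
  (∀ x, ∀ ω ∈ P.U, DifferentiableAt ℝ (fun z => P.r z ω) x) ∧
  ContinuousOn (fun q : E d × E m => P.Dxr q.1 q.2) (univ ×ˢ P.U) ∧
  (∃ L : ℝ, ∀ x y, ∀ ω ∈ P.U,
    |P.r y ω - P.r x ω| + ‖P.Dxr y ω - P.Dxr x ω‖ ≤ L * ‖y - x‖) ∧
  0 < r₀ ∧ ∀ x, ∀ ω ∈ P.U, r₀ ≤ P.r x ω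

def H3 (N r₀ : ℝ) : Prop :=
  ∃ 𝒩 : Set (E d), IsOpen 𝒩 ∧ frontier P.S ⊆ 𝒩 ∧ ∃ G : ℝ, 0 ≤ G ∧ G < r₀ / N ∧
    ∀ x ∈ 𝒩, ∀ y ∈ 𝒩, |P.g y - P.g x| ≤ G * ‖y - x‖

/-- The target has the inner ball property of radius `ρ₀`. -/
def H4 (ρ₀ : ℝ) : Prop :=
  0 < ρ₀ ∧ ∀ x ∈ frontier P.S, ∃ ξ ∈ proximalNormals (closure P.Sᶜ) x,
    ‖ξ‖ = 1 ∧ ∀ y ∈ closure P.Sᶜ, inner ℝ ξ (y - x) ≤ 1 / (2 * ρ₀) * ‖y - x‖ ^ 2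

/-- Admissible controls, measurable maps `[0, ∞) → U` (values at negative times are irrelevant). -/
def Admissible (u : ℝ → E m) : Prop := Measurable u ∧ ∀ t, 0 ≤ t → u t ∈ P.U

/-- `y` is the Carathéodory solution on `[0, ∞)` of `y' = f(y, u)`, `y(0) = x`, in integral form. -/
def IsTrajectory (x : E d) (u : ℝ → E m) (y : ℝ → E d) : Prop :=
  ContinuousOn y (Ici 0) ∧ ∀ t, 0 ≤ t → y t = x + ∫ s in (0 : ℝ)..t, P.f (y s) (u s)

/-- The admissible control `u` steers `x` to the target along the trajectory `y`, with finite exit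
time `τ`, the first time at which `y` is in `S`. -/
def Steers (x : E d) (u : ℝ → E m) (y : ℝ → E d) (τ : ℝ) : Prop :=
  P.Admissible u ∧ P.IsTrajectory x u y ∧ IsLeast {t : ℝ | 0 ≤ t ∧ y t ∈ P.S} τ

/-- The controllable set `𝓡`. -/
def R : Set (E d) := {x | ∃ u y τ, P.Steers x u y τ}

/-- The cost of the control `u` with trajectory `y` and exit time `τ`. -/
def cost (u : ℝ → E m) (y : ℝ → E d) (τ : ℝ) : ℝ :=
  (∫ s in (0 : ℝ)..τ, P.r (y s) (u s)) + P.g (y τ)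

/-- The value function on `𝓡`. Controls that never reach the target have cost `+∞` and do not
contribute to the infimum. Off `𝓡`, where the value function is `+∞`, this is a dummy value
that is never used. -/
def V (x : E d) : ℝ := sInf {c | ∃ u y τ, P.Steers x u y τ ∧ c = P.cost u y τ}

/-- `u` is an optimal control for `x`, with trajectory `y` and exit time `τ`. -/
def IsOptimal (x : E d) (u : ℝ → E m) (y : ℝ → E d) (τ : ℝ) : Prop :=
  P.Steers x u y τ ∧ P.cost u y τ = P.V x

/-- The Hamiltonian `H(x, p) = max_{ω ∈ U} (- p · f(x, ω) - r(x, ω))`. -/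
def hamiltonian (x p : E d) : ℝ :=
  sSup ((fun ω => -(inner ℝ p (P.f x ω)) - P.r x ω) '' P.U)

/-- `N₀(z)`: nonzero proximal normals `ξ` to the closure of `Sᶜ` with `max_ω ξ · f(z, ω) = 0`. -/
def N0 (z : E d) : Set (E d) :=
  {ξ | ξ ≠ 0 ∧ ξ ∈ proximalNormals (closure P.Sᶜ) z ∧
    sSup ((fun ω => inner ℝ ξ (P.f z ω)) '' P.U) = 0}

/-- `N₁(z)`: proximal normals `ξ` to the closure of `Sᶜ` with `max_ω ξ · f(z, ω) > 0`. -/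
def N1 (z : E d) : Set (E d) :=
  {ξ | ξ ∈ proximalNormals (closure P.Sᶜ) z ∧
    0 < sSup ((fun ω => inner ℝ ξ (P.f z ω)) '' P.U)}

/-- `p` is the solution on `[0, τ]` of `p' = - A(t) p - b(t)`, `p(τ) = pT`, in integral form. -/
def IsBackwardSolution (A : ℝ → E d →L[ℝ] E d) (b : ℝ → E d) (τ : ℝ) (pT : E d)
    (p : ℝ → E d) : Prop :=
  ContinuousOn p (Icc 0 τ) ∧
    ∀ t ∈ Icc (0 : ℝ) τ, p t = pT + ∫ s in t..τ, (A s (p s) + b s)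

/-- Transported horizontal proximal normals `N₀†(x)`. -/
def N0dag (x : E d) : Set (E d) :=
  {p₀ | ∃ u y τ, P.IsOptimal x u y τ ∧ ∃ ξ ∈ P.N0 (y τ), ∃ p : ℝ → E d,
    IsBackwardSolution (fun t => ContinuousLinearMap.adjoint (P.Dxf (y t) (u t)))
      (fun _ => 0) τ (-ξ) p ∧ p 0 = p₀}

/-- Transported proximal normals `N₁†(x)`. -/
def N1dag (x : E d) : Set (E d) :=
  {p₀ | ∃ u y τ, P.IsOptimal x u y τ ∧ ∃ ξ ∈ P.N1 (y τ), ∃ q ∈ superdiff P.g (y τ),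
    P.hamiltonian (y τ) (q - ξ) = 0 ∧ ∃ p : ℝ → E d,
    IsBackwardSolution (fun t => ContinuousLinearMap.adjoint (P.Dxf (y t) (u t)))
      (fun t => P.Dxr (y t) (u t)) τ (q - ξ) p ∧ p 0 = p₀}

end Problem

end ExitTime

end

/-! Fix an optimal `(u, y, τ)` for `x` and put `z = y τ`. A multiplier at `z` consists of a proximal
normal `ξ` to the closure of `Sᶜ`, a supergradient `q` of `g` at `z` and a number `lam ≥ 0` such
that `(ξ - lam q)·f(z, ω) - lam r(z, ω)` has maximum `0` over `ω ∈ U`. The case `lam = 1` covers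
`N1dag`, the case `lam = 0` covers `N0dag`, and all `lam` are treated together. Let `p` be the
adjoint arc with source `lam D_x r` and `p(τ) = lam q - ξ`. Everything rests on one estimate,
`exists_supergradient_bound`: for every `x'` and every `β ≤ V x'`, `-p(0)·(x' - x) + lam (β - V x) ≤
C (|x' - x|² + (β - V x)²)`. It says that `(-p(0), lam)` is a proximal normal to the hypograph, with
`C` depending only on bounds for the multiplier, `τ` and `z`.

To prove it, start at `x'`, use `u` until `τ` and afterwards a constant `ω` attaining the maximum;
call the trajectory `y'` and set `W = |x' - x| + |β - V x|`. Up to time `τ`, duality with `p` leaves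
only Taylor remainders (`abs_adjoint_expansion_le`). If `y'` exits at `θ` with `|θ - τ| = O(W)`,
then the maximum condition between `τ` and `θ`, the supergradient inequality for `g` and the normal
inequality at `y' θ` cancel all first order terms (`supergradient_le_of_exit`). An exit before `τ`
is always this close, since each unit of time saved is worth at least `r₀ - G N > 0` and `β` is at
most the cost. If there is no exit up to `τ`, then `ξ·(y' τ - z) ≤ O(W²)`. Since `ξ·f(z, ω) ≥ lam
(r₀ - G N)`, the control `ω` then forces an exit within time `O(W)`, unless `lam = O(W)` or `ξ·(y' τ
- z)` is below a negative multiple of `lam W`; in both exceptions the estimate follows without any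
exit.

Multipliers exist for each unit normal `ξ`: `lam` is the maximum of `ξ·f / (r + q·f)`, nonnegative
because `y` arrives from outside the target (`exists_multiplier`). Dividing by `lam > 0` gives an
element of `N1dag`; `lam = 0` gives one of `N0dag`. Grönwall bounds `1 = |ξ|` by a multiple of
`|(-p(0), lam)|`, so `C` becomes a radius that is uniform on bounded parts of the hypograph, and a
partition of unity makes the radius continuous. Optimal controls come from convexity of the velocity
sets, limits along an ultrafilter and measurable selection (`exists_isOptimal`). -/

noncomputable section

namespace ExitTime

open MeasureTheory intervalIntegral

/-! ### Integral inequalities and Carathéodory equations -/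

/-- Grönwall's inequality in integral form. -/
theorem le_mul_exp_of_le_add_integral {φ : ℝ → ℝ} {a L T : ℝ} (hL : 0 ≤ L)
    (hφ : ContinuousOn φ (Icc 0 T))
    (h : ∀ t ∈ Icc 0 T, φ t ≤ a + L * ∫ s in (0 : ℝ)..t, φ s) :
    ∀ t ∈ Icc 0 T, φ t ≤ a * Real.exp (L * t) := by
  intro t ht
  have hT : 0 ≤ T := ht.1.trans ht.2
  set I : ℝ → ℝ := fun t => ∫ s in (0 : ℝ)..t, φ s with hI
  have hint : IntervalIntegrable φ volume 0 T := by
    apply ContinuousOn.intervalIntegrable; rwa [uIcc_of_le hT]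
  have hIc : ContinuousOn I (Icc 0 T) := by
    have := continuousOn_primitive_interval (μ := volume) (f := φ) (a := 0) (b := T)
      (by rw [uIcc_of_le hT]; exact hφ.integrableOn_Icc)
    rwa [uIcc_of_le hT] at this
  have hderiv : ∀ s ∈ Ioo (0 : ℝ) T, HasDerivAt I (φ s) s := by
    intro s hs
    refine integral_hasDerivAt_right ?_ ?_ ?_
    · exact hint.mono_set (by rw [uIcc_of_le hT, uIcc_of_le hs.1.le]; exact Icc_subset_Icc_right hs.2.le)
    · exact (hφ.mono Ioo_subset_Icc_self).stronglyMeasurableAtFilter isOpen_Ioo s hs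
    · exact hφ.continuousAt (Icc_mem_nhds hs.1 hs.2)
  -- Integrating factor: the derivative is `exp(-Ls) L (φ s - a - L I s)`, which the hypothesis
  -- makes nonpositive.
  have hanti : AntitoneOn (fun s => Real.exp (-(L * s)) * (a + L * I s)) (Icc 0 T) := by
    refine antitoneOn_of_hasDerivWithinAt_nonpos (f' := fun s =>
      Real.exp (-(L * s)) * (-(L * 1)) * (a + L * I s) + Real.exp (-(L * s)) * (L * φ s))
      (convex_Icc 0 T) ?_ ?_ ?_
    · exact (Continuous.continuousOn (by fun_prop)).mul
        (continuousOn_const.add (continuousOn_const.mul hIc))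
    · intro s hs
      rw [interior_Icc] at hs
      have h1 : HasDerivAt (fun s => Real.exp (-(L * s))) (Real.exp (-(L * s)) * (-(L * 1))) s :=
        (((hasDerivAt_id s).const_mul L).neg).exp
      exact (h1.mul (((hderiv s hs).const_mul L).const_add a)).hasDerivWithinAt
    · intro s hs
      rw [interior_Icc] at hs
      have := h s ⟨hs.1.le, hs.2.le⟩
      have he := Real.exp_pos (-(L * s))
      have : Real.exp (-(L * s)) * (L * (φ s - (a + L * I s))) ≤ 0 :=
        mul_nonpos_of_nonneg_of_nonpos he.le
          (mul_nonpos_of_nonneg_of_nonpos hL (by simp only [hI]; linarith))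
      nlinarith
  have h0 := hanti (left_mem_Icc.2 hT) ht ht.1
  simp only [hI, mul_zero, neg_zero, Real.exp_zero, one_mul, integral_same, add_zero] at h0
  have h1 := h t ht
  rw [Real.exp_neg, inv_mul_le_iff₀ (Real.exp_pos _)] at h0
  linarith [mul_comm a (Real.exp (L * t))]

variable {X : Type*} [NormedAddCommGroup X] [NormedSpace ℝ X]

/-- Stability, uniqueness and the bounds for adjoint arcs all come from this affine form of
Grönwall; the constant part `B` of the growth adds at most `B * T` to the initial size. -/
theorem norm_le_mul_exp_of_integral_eq [CompleteSpace X] {φ h : ℝ → X} {a : X} {B L T : ℝ} (hL : 0 ≤ L)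
    (hB : 0 ≤ B) (hφ : ContinuousOn φ (Icc 0 T))
    (hh : ∀ t ∈ Icc 0 T, ‖h t‖ ≤ B + L * ‖φ t‖)
    (heq : ∀ t ∈ Icc 0 T, φ t = a + ∫ s in (0 : ℝ)..t, h s) :
    ∀ t ∈ Icc 0 T, ‖φ t‖ ≤ (‖a‖ + B * T) * Real.exp (L * t) := by
  refine le_mul_exp_of_le_add_integral hL hφ.norm fun t ht => ?_
  have hφt : IntervalIntegrable (fun s => ‖φ s‖) volume 0 t := by
    apply ContinuousOn.intervalIntegrable
    rw [uIcc_of_le ht.1]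
    exact (hφ.norm).mono (Icc_subset_Icc_right ht.2)
  have h1 : ‖∫ s in (0 : ℝ)..t, h s‖ ≤ ∫ s in (0 : ℝ)..t, (B + L * ‖φ s‖) := by
    refine norm_integral_le_of_norm_le ht.1 ?_ (intervalIntegrable_const.add (hφt.const_mul L))
    exact ae_of_all _ fun s hs => hh s ⟨hs.1.le, hs.2.trans ht.2⟩
  rw [integral_add intervalIntegrable_const (hφt.const_mul L), intervalIntegral.integral_const,
    intervalIntegral.integral_const_mul, smul_eq_mul, sub_zero] at h1
  rw [heq t ht]
  refine (norm_add_le _ _).trans ?_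
  nlinarith [ht.2]

/-- Carathéodory existence for a globally Lipschitz right-hand side. -/
theorem exists_integral_solution [CompleteSpace X] {F : ℝ → X → X} {B L : ℝ} (hL : 0 ≤ L)
    (hF : ∀ z : ℝ → X, Continuous z → ∀ t, 0 ≤ t →
      IntervalIntegrable (fun s => F s (z s)) volume 0 t)
    (x : X) (hB : ∀ s, 0 ≤ s → ‖F s x‖ ≤ B)
    (hLip : ∀ s, 0 ≤ s → ∀ z z', ‖F s z - F s z'‖ ≤ L * ‖z - z'‖) :
    ∃ y : ℝ → X, Continuous y ∧ ∀ t, 0 ≤ t → y t = x + ∫ s in (0 : ℝ)..t, F s (y s) := by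
  have hB0 : 0 ≤ B := (norm_nonneg _).trans (hB 0 le_rfl)
  -- The unknown is the weighted function `z = exp(-Kt) (y - x)`, bounded on the whole half-line.
  -- Since `K > 2L`, the Picard map is a `1/2`-contraction for the sup norm of `z`, so no gluing of
  -- local solutions is needed. Writing `max s 0` freezes the weight at negative times, so that `z`
  -- can live on `ℝ`.
  set K : ℝ := 2 * L + 1 with hK
  have hKpos : 0 < K := by positivity
  set Y : (ℝ → X) → ℝ → X := fun z s => x + Real.exp (K * max s 0) • z s with hY
  have hYc : ∀ z, Continuous z → Continuous (Y z) := fun z hz => by fun_prop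
  set J : (ℝ → X) → ℝ → X := fun z t => ∫ s in (0 : ℝ)..(max t 0), F s (Y z s) with hJ
  have hii : ∀ z, Continuous z → ∀ t, 0 ≤ t → IntervalIntegrable (fun s => F s (Y z s)) volume 0 t :=
    fun z hz t ht => hF _ (hYc z hz) t ht
  have hexpint : ∀ t c : ℝ, 0 ≤ t → ∫ s in (0 : ℝ)..t, c * Real.exp (K * s)
      = c * ((Real.exp (K * t) - 1) / K) := by
    intro t c ht
    have hd : ∀ s ∈ uIcc 0 t, HasDerivAt (fun s => c * (Real.exp (K * s) / K)) (c * Real.exp (K * s)) s := by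
      intro s _
      have := ((((hasDerivAt_id s).const_mul K).exp).div_const K).const_mul c
      refine this.congr_deriv ?_
      simp only [id]
      field_simp
    rw [integral_eq_sub_of_hasDerivAt hd (Continuous.intervalIntegrable (by fun_prop) _ _)]
    simp; ring
  have hmaj : ∀ (A : ℝ) (h : ℝ → X) (t : ℝ), 0 ≤ A → 0 ≤ t →
      (∀ s ∈ Ioc 0 t, ‖h s‖ ≤ L * A * Real.exp (K * s)) →
      ‖∫ s in (0 : ℝ)..t, h s‖ ≤ 1 / 2 * A * Real.exp (K * t) := by
    intro A h t hA ht hh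
    have := norm_integral_le_of_norm_le ht (ae_of_all _ hh)
      (Continuous.intervalIntegrable (by fun_prop) (μ := volume) _ _)
    rw [hexpint t _ ht] at this
    refine this.trans ?_
    have he := Real.exp_pos (K * t)
    rw [← mul_div_assoc, div_le_iff₀ hKpos]
    have : L * A * Real.exp (K * t) ≤ 1 / 2 * A * Real.exp (K * t) * K := by
      have : 0 ≤ A * Real.exp (K * t) := by positivity
      rw [hK]; nlinarith
    have : 0 ≤ L * A := by positivity
    nlinarith
  have hJc : ∀ z, Continuous z → Continuous (J z) := by
    intro z hz
    rw [continuous_iff_continuousAt]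
    intro t
    set T := max t 0 + 1
    have hT : 0 ≤ T := by positivity
    have h1 : ContinuousOn (fun v => ∫ s in (0 : ℝ)..v, F s (Y z s)) (Icc 0 T) := by
      have := continuousOn_primitive_interval (μ := volume) (f := fun s => F s (Y z s)) (a := 0) (b := T)
        (by rw [uIcc_of_le hT]; exact (intervalIntegrable_iff_integrableOn_Icc_of_le hT).1 (hii z hz T hT))
      rwa [uIcc_of_le hT] at this
    have h2 : ContinuousOn (J z) (Iio T) := by
      refine h1.comp (t := Icc 0 T) (by fun_prop) fun v hv => ⟨le_max_right _ _, max_le (le_of_lt hv) hT⟩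
    exact h2.continuousAt (Iio_mem_nhds (lt_of_le_of_lt (le_max_left t 0) (lt_add_one _)))
  have hexp1 : ∀ t, Real.exp (-(K * max t 0)) * Real.exp (K * max t 0) = 1 := fun t => by
    rw [← Real.exp_add]; simp
  set Ψ : (ℝ → X) → ℝ → X := fun z t => Real.exp (-(K * max t 0)) • J z t with hΨ
  have hΨc : ∀ z, Continuous z → Continuous (Ψ z) := fun z hz => by
    have := hJc z hz; fun_prop
  have hdiff : ∀ (z z' : BoundedContinuousFunction ℝ X) t, ‖Ψ z t - Ψ z' t‖ ≤ 1 / 2 * dist z z' := by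
    intro z z' t
    have h1 : J z t - J z' t = ∫ s in (0 : ℝ)..(max t 0), (F s (Y z s) - F s (Y z' s)) :=
      (integral_sub (hii z z.continuous _ (le_max_right _ _))
        (hii z' z'.continuous _ (le_max_right _ _))).symm
    have h2 := hmaj (dist z z') (fun s => F s (Y z s) - F s (Y z' s)) (max t 0) dist_nonneg
      (le_max_right _ _) (fun s hs => by
        refine (hLip s hs.1.le _ _).trans ?_
        have : Y z s - Y z' s = Real.exp (K * s) • (z s - z' s) := by
          simp only [hY, max_eq_left hs.1.le, smul_sub]; abel
        rw [this, norm_smul, Real.norm_of_nonneg (Real.exp_pos _).le, mul_assoc, mul_comm (dist z z')]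
        gcongr
        rw [← dist_eq_norm]
        exact BoundedContinuousFunction.dist_coe_le_dist s)
    simp only [hΨ]
    rw [← smul_sub, norm_smul, Real.norm_of_nonneg (Real.exp_pos _).le, h1]
    calc _ ≤ Real.exp (-(K * max t 0)) * (1 / 2 * dist z z' * Real.exp (K * max t 0)) := by gcongr
      _ = _ := by rw [mul_comm _ (Real.exp (K * max t 0)), ← mul_assoc, hexp1, one_mul]
  have hzero : ∀ t, ‖Ψ 0 t‖ ≤ B / K := by
    intro t
    have h1 : ‖J 0 t‖ ≤ B * max t 0 := by
      have := norm_integral_le_of_norm_le_const (a := 0) (b := max t 0) (C := B)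
        (f := fun s => F s (Y 0 s)) (fun s hs => by
          rw [uIoc_of_le (le_max_right _ _)] at hs
          simpa [hY] using hB s hs.1.le)
      rwa [sub_zero, abs_of_nonneg (le_max_right t 0)] at this
    simp only [hΨ]
    rw [norm_smul, Real.norm_of_nonneg (Real.exp_pos _).le, Real.exp_neg,
      inv_mul_le_iff₀ (Real.exp_pos _)]
    have h2 := Real.add_one_le_exp (K * max t 0)
    rw [mul_div_assoc', le_div_iff₀ hKpos]
    have h3 : 0 ≤ max t 0 := le_max_right _ _
    nlinarith
  have hbound : ∀ (z : BoundedContinuousFunction ℝ X) t, ‖Ψ z t‖ ≤ B / K + 1 / 2 * dist z 0 := by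
    intro z t
    have h1 := hdiff z 0 t
    have h2 := hzero t
    have h3 : ‖Ψ z t‖ ≤ ‖Ψ z t - Ψ 0 t‖ + ‖Ψ 0 t‖ := by
      simpa using norm_add_le (Ψ z t - Ψ 0 t) (Ψ 0 t)
    have h4 : Ψ ((0 : BoundedContinuousFunction ℝ X) : ℝ → X) t = Ψ 0 t := rfl
    rw [h4] at h1
    linarith
  let Φ : BoundedContinuousFunction ℝ X → BoundedContinuousFunction ℝ X := fun z =>
    BoundedContinuousFunction.ofNormedAddCommGroup (Ψ z) (hΨc z z.continuous) _ (hbound z)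
  have hcontr : ContractingWith (1 / 2) Φ := by
    refine ⟨by norm_num, LipschitzWith.of_dist_le_mul fun z z' => ?_⟩
    refine (BoundedContinuousFunction.dist_le (by positivity)).2 fun t => ?_
    rw [dist_eq_norm]
    exact hdiff z z' t
  obtain ⟨z, hz⟩ : ∃ z, Φ z = z := ⟨_, hcontr.fixedPoint_isFixedPt⟩
  refine ⟨Y z, hYc z z.continuous, fun t ht => ?_⟩
  have h1 : z t = Ψ z t := by
    conv_lhs => rw [← hz]
    rfl
  have h2 : Real.exp (K * max t 0) • z t = J z t := by
    rw [h1]; simp only [hΨ]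
    rw [smul_smul, mul_comm, hexp1, one_smul]
  change x + Real.exp (K * max t 0) • z t = _
  rw [h2]
  simp only [hJ, max_eq_left ht]

theorem norm_integral_sub_le {h : ℝ → X} {B T s t : ℝ}
    (hh : ∀ v ∈ Icc 0 T, ‖h v‖ ≤ B) (hi : IntervalIntegrable h volume 0 T)
    (hs : s ∈ Icc 0 T) (ht : t ∈ Icc 0 T) :
    ‖(∫ v in (0 : ℝ)..t, h v) - ∫ v in (0 : ℝ)..s, h v‖ ≤ B * |t - s| := by
  have hT : 0 ≤ T := hs.1.trans hs.2
  have hsub : ∀ v ∈ Icc 0 T, IntervalIntegrable h volume 0 v := fun v hv =>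
    hi.mono_set (by rw [uIcc_of_le hT, uIcc_of_le hv.1]; exact Icc_subset_Icc_right hv.2)
  rw [integral_interval_sub_left (hsub t ht) (hsub s hs)]
  refine norm_integral_le_of_norm_le_const fun v hv => hh v ?_
  have := uIoc_subset_uIcc hv
  exact uIcc_subset_Icc hs ht this

/-- Integration by parts for the inner product of two primitives of bounded functions. -/
theorem inner_sub_inner_eq_integral {H : Type*} [NormedAddCommGroup H] [InnerProductSpace ℝ H]
    [CompleteSpace H] {p p' e e' : ℝ → H} {B T : ℝ} (hT : 0 ≤ T)
    (hp' : IntervalIntegrable p' volume 0 T) (he' : IntervalIntegrable e' volume 0 T)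
    (hpb : ∀ t ∈ Icc 0 T, ‖p' t‖ ≤ B) (heb : ∀ t ∈ Icc 0 T, ‖e' t‖ ≤ B)
    (hp : ∀ t ∈ Icc 0 T, p t = p 0 + ∫ s in (0 : ℝ)..t, p' s)
    (he : ∀ t ∈ Icc 0 T, e t = e 0 + ∫ s in (0 : ℝ)..t, e' s) :
    inner ℝ (p T) (e T) - inner ℝ (p 0) (e 0)
      = ∫ s in (0 : ℝ)..T, (inner ℝ (p' s) (e s) + inner ℝ (p s) (e' s)) := by
  have hB : 0 ≤ B := (norm_nonneg _).trans (hpb 0 ⟨le_rfl, hT⟩)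
  have hplip : ∀ s ∈ Icc 0 T, ∀ t ∈ Icc 0 T, ‖p t - p s‖ ≤ B * |t - s| := fun s hs t ht => by
    rw [hp t ht, hp s hs, add_sub_add_left_eq_sub]; exact norm_integral_sub_le hpb hp' hs ht
  have helip : ∀ s ∈ Icc 0 T, ∀ t ∈ Icc 0 T, ‖e t - e s‖ ≤ B * |t - s| := fun s hs t ht => by
    rw [he t ht, he s hs, add_sub_add_left_eq_sub]; exact norm_integral_sub_le heb he' hs ht
  have h0 : (0 : ℝ) ∈ Icc 0 T := ⟨le_rfl, hT⟩
  have hpc : ContinuousOn p (Icc 0 T) := by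
    refine (LipschitzOnWith.of_dist_le_mul (K := ⟨B, hB⟩) fun t ht s hs => ?_).continuousOn
    rw [dist_eq_norm, Real.dist_eq]; exact hplip s hs t ht
  have hec : ContinuousOn e (Icc 0 T) := by
    refine (LipschitzOnWith.of_dist_le_mul (K := ⟨B, hB⟩) fun t ht s hs => ?_).continuousOn
    rw [dist_eq_norm, Real.dist_eq]; exact helip s hs t ht
  obtain ⟨Mp, hMp⟩ := isCompact_Icc.exists_bound_of_continuousOn hpc
  obtain ⟨Me, hMe⟩ := isCompact_Icc.exists_bound_of_continuousOn hec
  have hMp0 : 0 ≤ Mp := (norm_nonneg _).trans (hMp 0 h0)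
  have hMe0 : 0 ≤ Me := (norm_nonneg _).trans (hMe 0 h0)
  set k : ℝ → ℝ := fun s => inner ℝ (p' s) (e s) + inner ℝ (p s) (e' s) with hk
  have hkb : ∀ t ∈ Icc 0 T, ‖k t‖ ≤ B * Me + Mp * B := fun t ht => by
    refine (norm_add_le _ _).trans (add_le_add ?_ ?_)
    · exact (norm_inner_le_norm _ _).trans (mul_le_mul (hpb t ht) (hMe t ht) (norm_nonneg _) hB)
    · exact (norm_inner_le_norm _ _).trans (mul_le_mul (hMp t ht) (heb t ht) (norm_nonneg _) hMp0)
  have hki : IntervalIntegrable k volume 0 T := by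
    have hio := (intervalIntegrable_iff_integrableOn_Icc_of_le hT).1 hp'
    have hio' := (intervalIntegrable_iff_integrableOn_Icc_of_le hT).1 he'
    rw [intervalIntegrable_iff_integrableOn_Icc_of_le hT]
    refine Integrable.of_bound (C := B * Me + Mp * B) ?_ ?_
    · exact (hio.aestronglyMeasurable.inner         (𝕜 := ℝ) (hec.aestronglyMeasurable measurableSet_Icc)).add
        ((hpc.aestronglyMeasurable measurableSet_Icc).inner (𝕜 := ℝ) hio'.aestronglyMeasurable)
    · exact (ae_restrict_mem measurableSet_Icc).mono fun t ht => hkb t ht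
  -- The difference of the two sides, as a function of the upper endpoint, is Lipschitz with
  -- derivative zero almost everywhere, hence constant.
  have hac : AbsolutelyContinuousOnInterval
      (fun t => inner ℝ (p t) (e t) - ∫ s in (0 : ℝ)..t, k s) 0 T := by
    refine LipschitzOnWith.absolutelyContinuousOnInterval
      (K := ⟨(B * Me + Mp * B) + (B * Me + Mp * B), by positivity⟩) ?_
    rw [uIcc_of_le hT]
    refine LipschitzOnWith.of_dist_le_mul fun t ht s hs => ?_
    rw [Real.dist_eq, Real.dist_eq]
    have h1 : inner ℝ (p t) (e t) - inner ℝ (p s) (e s)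
        = inner ℝ (p t - p s) (e t) + inner ℝ (p s) (e t - e s) := by
      rw [inner_sub_left, inner_sub_right]; ring
    have h2 : |inner ℝ (p t) (e t) - inner ℝ (p s) (e s)| ≤ (B * Me + Mp * B) * |t - s| := by
      rw [h1]
      refine (abs_add_le _ _).trans ?_
      have h3 := (abs_real_inner_le_norm (p t - p s) (e t)).trans
        (mul_le_mul (hplip s hs t ht) (hMe t ht) (norm_nonneg _) (by positivity))
      have h4 := (abs_real_inner_le_norm (p s) (e t - e s)).trans
        (mul_le_mul (hMp s hs) (helip s hs t ht) (norm_nonneg _) hMp0)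
      linarith
    have h3 := norm_integral_sub_le hkb hki hs ht
    rw [Real.norm_eq_abs] at h3
    have h4 : (inner ℝ (p t) (e t) - ∫ s in (0 : ℝ)..t, k s)
        - (inner ℝ (p s) (e s) - ∫ v in (0 : ℝ)..s, k v)
        = (inner ℝ (p t) (e t) - inner ℝ (p s) (e s))
          - ((∫ s in (0 : ℝ)..t, k s) - ∫ v in (0 : ℝ)..s, k v) := by ring
    rw [h4]
    refine (abs_sub _ _).trans ?_
    change _ ≤ ((B * Me + Mp * B) + (B * Me + Mp * B)) * |t - s|
    linarith
  have hne : ∀ c : ℝ, ∀ᵐ t : ℝ, t ≠ c := fun c => by simp [ae_iff, measure_singleton]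
  obtain ⟨C, hC⟩ := hac.const_of_ae_hasDerivAt_zero (by
    filter_upwards [hp'.ae_hasDerivAt_integral, he'.ae_hasDerivAt_integral,
      hki.ae_hasDerivAt_integral, hne 0, hne T] with t h1 h2 h3 ht0 htT ht
    have hz : (0 : ℝ) ∈ uIcc 0 T := left_mem_uIcc
    have ht' := ht
    rw [uIcc_of_le hT] at ht'
    have hnhd : Icc 0 T ∈ 𝓝 t :=
      Icc_mem_nhds (lt_of_le_of_ne ht'.1 (Ne.symm ht0)) (lt_of_le_of_ne ht'.2 htT)
    have hpd : HasDerivAt p (p' t) t :=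
      ((h1 ht 0 hz).const_add (p 0)).congr_of_eventuallyEq
        (Filter.eventually_of_mem hnhd fun s hs => hp s hs)
    have hed : HasDerivAt e (e' t) t :=
      ((h2 ht 0 hz).const_add (e 0)).congr_of_eventuallyEq
        (Filter.eventually_of_mem hnhd fun s hs => he s hs)
    have h4 := (hpd.inner ℝ hed).sub (h3 ht 0 hz)
    have h5 : inner ℝ (p t) (e' t) + inner ℝ (p' t) (e t) - k t = 0 := by simp only [hk]; ring
    rw [h5] at h4
    exact h4)
  rw [uIcc_of_le hT] at hC
  have hCT := hC T ⟨hT, le_rfl⟩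
  have hC0 := hC 0 h0
  simp only [integral_same, sub_zero] at hC0
  rw [hC0]
  linarith

/-- The fundamental theorem of calculus for Lipschitz functions. -/
theorem integral_deriv_eq_sub_of_lipschitz [FiniteDimensional ℝ X] [MeasurableSpace X] [BorelSpace X]
    {y : ℝ → X} {K : NNReal} (hy : LipschitzWith K y) (a b : ℝ) :
    ∫ t in a..b, deriv y t = y b - y a := by
  have := FiniteDimensional.complete ℝ X
  have := FiniteDimensional.proper_real X
  have hbd : ∀ t, ‖deriv y t‖ ≤ K := fun t => norm_deriv_le_of_lipschitz hy
  have hli : LocallyIntegrable (deriv y) volume := by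
    have hm : AEStronglyMeasurable (deriv y) volume := (measurable_deriv y).aestronglyMeasurable
    have h1 : LocallyIntegrable (fun _ : ℝ => (K : ℝ)) volume := locallyIntegrable_const _
    exact h1.mono hm (ae_of_all _ fun t => by simpa using hbd t)
  have hii : ∀ a b, IntervalIntegrable (deriv y) volume a b := fun a b =>
    (hli.integrableOn_isCompact isCompact_uIcc).intervalIntegrable
  have hac : AbsolutelyContinuousOnInterval (fun t => y t - ∫ s in a..t, deriv y s) a b := by
    refine LipschitzOnWith.absolutelyContinuousOnInterval (K := K + K) ?_
    refine LipschitzOnWith.of_dist_le_mul fun t _ s _ => ?_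
    have h1 := hy.dist_le_mul t s
    have h2 : ‖(∫ v in a..t, deriv y v) - ∫ v in a..s, deriv y v‖ ≤ K * dist t s := by
      rw [integral_interval_sub_left (hii _ _) (hii _ _), Real.dist_eq]
      exact norm_integral_le_of_norm_le_const fun v _ => hbd v
    rw [dist_eq_norm] at h1 ⊢
    have h3 : y t - (∫ v in a..t, deriv y v) - (y s - ∫ v in a..s, deriv y v)
      = (y t - y s) - ((∫ v in a..t, deriv y v) - ∫ v in a..s, deriv y v) := by abel
    rw [h3, NNReal.coe_add, add_mul]
    exact (norm_sub_le _ _).trans (add_le_add h1 h2)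
  obtain ⟨C, hC⟩ := hac.const_of_ae_hasDerivAt_zero (by
    filter_upwards [LocallyIntegrable.ae_hasDerivAt_integral hli, hy.ae_differentiableAt] with t h1 h2 _
    have h3 := h2.hasDerivAt.sub (h1 a)
    rw [sub_self] at h3
    exact h3)
  have h1 := hC a left_mem_uIcc
  have h2 := hC b right_mem_uIcc
  simp only [integral_same, sub_zero] at h1
  rw [h1, ← h2]; abel

end ExitTime

end

noncomputable section

namespace ExitTime

open MeasureTheory intervalIntegral

variable {d m : ℕ}

/-! ### Trajectories and adjoint arcs -/

/-- `G` is known to be continuous only over `U`. Measurability comes from extending it by zero,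
boundedness from compactness of the image of `z` times `U`. -/
theorem intervalIntegrable_comp_control {Z Y : Type*} [TopologicalSpace Z] [MeasurableSpace Z]
    [BorelSpace Z] [SecondCountableTopology Z] [TopologicalSpace.PseudoMetrizableSpace Z]
    [T2Space Z] [NormedAddCommGroup Y]
    [MeasurableSpace Y] [BorelSpace Y] [SecondCountableTopology Y] {U : Set (E m)}
    (hU : IsCompact U) {G : Z → E m → Y}
    (hG : ContinuousOn (fun q : Z × E m => G q.1 q.2) (univ ×ˢ U))
    {z : ℝ → Z} {u : ℝ → E m} {a b : ℝ} (hab : a ≤ b) (hz : ContinuousOn z (Icc a b))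
    (hu : Measurable u) (huU : ∀ t ∈ Icc a b, u t ∈ U) :
    IntervalIntegrable (fun s => G (z s) (u s)) volume a b := by
  classical
  rw [intervalIntegrable_iff_integrableOn_Icc_of_le hab]
  have hcpt : IsCompact ((z '' Icc a b) ×ˢ U) := (isCompact_Icc.image_of_continuousOn hz).prod hU
  obtain ⟨C, hC⟩ := hcpt.exists_bound_of_continuousOn
    (hG.mono (prod_mono (subset_univ _) le_rfl))
  have hms : MeasurableSet ((univ : Set Z) ×ˢ U) := MeasurableSet.univ.prod hU.isClosed.measurableSet
  have hm : Measurable (((univ : Set Z) ×ˢ U).piecewise (fun q : Z × E m => G q.1 q.2) 0) :=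
    hG.measurable_piecewise continuousOn_const hms
  have hzm : AEMeasurable z (volume.restrict (Icc a b)) := hz.aemeasurable measurableSet_Icc
  have hcomp : AEMeasurable (fun s => ((univ : Set Z) ×ˢ U).piecewise
      (fun q : Z × E m => G q.1 q.2) 0 (z s, u s)) (volume.restrict (Icc a b)) :=
    hm.comp_aemeasurable (hzm.prodMk hu.aemeasurable)
  have hG' : AEMeasurable (fun s => G (z s) (u s)) (volume.restrict (Icc a b)) := by
    refine hcomp.congr ((ae_restrict_mem measurableSet_Icc).mono fun s hs => ?_)
    exact piecewise_eq_of_mem _ _ _ (mk_mem_prod (mem_univ _) (huU s hs))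
  refine Integrable.of_bound hG'.aestronglyMeasurable C
    ((ae_restrict_mem measurableSet_Icc).mono fun s hs => ?_)
  exact hC (z s, u s) (mk_mem_prod (mem_image_of_mem _ hs) (huU s hs))

namespace Problem

variable (P : Problem d m)

/-- The regularity of the data used by the estimates, with one Lipschitz constant `L`. -/
structure Regular (N r₀ L : ℝ) : Prop where
  isCompact : IsCompact P.U
  nonempty : P.U.Nonempty
  continuousOn_f : ContinuousOn (fun q : E d × E m => P.f q.1 q.2) (univ ×ˢ P.U)
  continuousOn_Dxf : ContinuousOn (fun q : E d × E m => P.Dxf q.1 q.2) (univ ×ˢ P.U)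
  continuousOn_r : ContinuousOn (fun q : E d × E m => P.r q.1 q.2) (univ ×ˢ P.U)
  continuousOn_Dxr : ContinuousOn (fun q : E d × E m => P.Dxr q.1 q.2) (univ ×ˢ P.U)
  N_pos : 0 < N
  L_nonneg : 0 ≤ L
  r₀_pos : 0 < r₀
  norm_f_le : ∀ x, ∀ ω ∈ P.U, ‖P.f x ω‖ ≤ N
  r₀_le : ∀ x, ∀ ω ∈ P.U, r₀ ≤ P.r x ω
  lipschitz_f : ∀ x y, ∀ ω ∈ P.U, ‖P.f y ω - P.f x ω‖ ≤ L * ‖y - x‖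
  lipschitz_r : ∀ x y, ∀ ω ∈ P.U, |P.r y ω - P.r x ω| ≤ L * ‖y - x‖
  norm_Dxf_le : ∀ x, ∀ ω ∈ P.U, ‖P.Dxf x ω‖ ≤ L
  norm_Dxr_le : ∀ x, ∀ ω ∈ P.U, ‖P.Dxr x ω‖ ≤ L
  taylor_f : ∀ x y, ∀ ω ∈ P.U, ‖P.f y ω - P.f x ω - P.Dxf x ω (y - x)‖ ≤ L * ‖y - x‖ ^ 2
  taylor_r : ∀ x y, ∀ ω ∈ P.U,
    |P.r y ω - P.r x ω - inner ℝ (P.Dxr x ω) (y - x)| ≤ L * ‖y - x‖ ^ 2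

theorem taylor_of_lipschitz_fderiv {F G : Type*} [NormedAddCommGroup F] [NormedSpace ℝ F]
    [NormedAddCommGroup G] [NormedSpace ℝ G] {h : F → G} {L : ℝ} (hL : 0 ≤ L)
    (hd : ∀ x, DifferentiableAt ℝ h x)
    (hlip : ∀ x y, ‖fderiv ℝ h y - fderiv ℝ h x‖ ≤ L * ‖y - x‖) (x y : F) :
    ‖h y - h x - fderiv ℝ h x (y - x)‖ ≤ L * ‖y - x‖ ^ 2 := by
  have := (convex_closedBall x ‖y - x‖).norm_image_sub_le_of_norm_hasFDerivWithin_le'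
    (f := h) (f' := fun z => fderiv ℝ h z) (φ := fderiv ℝ h x) (C := L * ‖y - x‖) (x := x) (y := y)
    (fun z _ => (hd z).hasFDerivAt.hasFDerivWithinAt)
    (fun z hz => (hlip x z).trans (by
      rw [mem_closedBall_iff_norm] at hz; gcongr))
    (Metric.mem_closedBall_self (norm_nonneg _)) (by rw [mem_closedBall_iff_norm])
  rw [pow_two, ← mul_assoc]; exact this

theorem norm_fderiv_le_of_norm_sub_le {F G : Type*} [NormedAddCommGroup F] [NormedSpace ℝ F]
    [NormedAddCommGroup G] [NormedSpace ℝ G] {h : F → G} {L : ℝ} (hL : 0 ≤ L)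
    (hlip : ∀ x y, ‖h y - h x‖ ≤ L * ‖y - x‖) (x : F) : ‖fderiv ℝ h x‖ ≤ L := by
  have : LipschitzWith ⟨L, hL⟩ h := LipschitzWith.of_dist_le_mul fun a b => by
    rw [dist_eq_norm, dist_eq_norm]; exact hlip b a
  exact norm_fderiv_le_of_lipschitz ℝ this

variable {P}

theorem exists_regular (hU : IsCompact P.U) (hU_ne : P.U.Nonempty) {N r₀ : ℝ}
    (h1 : P.H1 N) (h2 : P.H2 r₀) : ∃ L, P.Regular N r₀ L := by
  obtain ⟨hfc, hfN, hfd, hDf, ⟨L1, hL1⟩, ⟨L2, hL2⟩⟩ := h1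
  obtain ⟨hrc, hrd, hDr, ⟨L3, hL3⟩, hr0, hr⟩ := h2
  obtain ⟨ω₀, hω₀⟩ := hU_ne
  set L : ℝ := |L1| + |L2| + |L3| with hLdef
  have hL : 0 ≤ L := by positivity
  have e1 : L1 ≤ L := by have := le_abs_self L1; have := abs_nonneg L2; have := abs_nonneg L3; linarith
  have e2 : L2 ≤ L := by have := le_abs_self L2; have := abs_nonneg L1; have := abs_nonneg L3; linarith
  have e3 : L3 ≤ L := by have := le_abs_self L3; have := abs_nonneg L1; have := abs_nonneg L2; linarith
  have l1 : ∀ x y, ∀ ω ∈ P.U, ‖P.f y ω - P.f x ω‖ ≤ L * ‖y - x‖ := fun x y ω hω =>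
    (hL1 x y ω hω).trans (by gcongr)
  have l2 : ∀ x y, ∀ ω ∈ P.U, ‖P.Dxf y ω - P.Dxf x ω‖ ≤ L * ‖y - x‖ := fun x y ω hω =>
    (hL2 x y ω hω).trans (by gcongr)
  have l3 : ∀ x y, ∀ ω ∈ P.U, |P.r y ω - P.r x ω| ≤ L * ‖y - x‖ := fun x y ω hω => by
    have := hL3 x y ω hω
    have h' : L3 * ‖y - x‖ ≤ L * ‖y - x‖ := by gcongr
    have := norm_nonneg (P.Dxr y ω - P.Dxr x ω)
    linarith
  have l4 : ∀ x y, ∀ ω ∈ P.U, ‖P.Dxr y ω - P.Dxr x ω‖ ≤ L * ‖y - x‖ := fun x y ω hω => by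
    have := hL3 x y ω hω
    have h' : L3 * ‖y - x‖ ≤ L * ‖y - x‖ := by gcongr
    have := abs_nonneg (P.r y ω - P.r x ω)
    linarith
  have hgrad : ∀ x, ∀ ω, fderiv ℝ (fun z => P.r z ω) x
      = InnerProductSpace.toDual ℝ (E d) (P.Dxr x ω) := fun x ω => by
    simp [Dxr, gradient]
  refine ⟨L, ⟨hU, ⟨ω₀, hω₀⟩, hfc, hDf, hrc, hDr,
    (norm_nonneg _).trans_lt (hfN 0 ω₀ hω₀), hL, hr0, fun x ω hω => (hfN x ω hω).le, hr, l1, l3,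
    fun x ω hω => ?_, fun x ω hω => ?_, fun x y ω hω => ?_, fun x y ω hω => ?_⟩⟩
  · exact norm_fderiv_le_of_norm_sub_le hL (fun x y => l1 x y ω hω) x
  · have := norm_fderiv_le_of_norm_sub_le (h := fun z => P.r z ω) hL (fun x y => l3 x y ω hω) x
    rwa [hgrad, LinearIsometryEquiv.norm_map] at this
  · exact taylor_of_lipschitz_fderiv hL (fun x => hfd x ω hω) (fun x y => l2 x y ω hω) x y
  · have := taylor_of_lipschitz_fderiv (h := fun z => P.r z ω) hL (fun x => hrd x ω hω)
      (fun x y => by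
        rw [hgrad, hgrad, ← map_sub, LinearIsometryEquiv.norm_map]; exact l4 x y ω hω) x y
    rwa [hgrad, InnerProductSpace.toDual_apply_apply, Real.norm_eq_abs] at this

theorem Regular.exists_trajectory {N r₀ L : ℝ} (hP : P.Regular N r₀ L) (x : E d) {u : ℝ → E m} (hu : P.Admissible u) :
    ∃ y, P.IsTrajectory x u y := by
  obtain ⟨y, hyc, hy⟩ := exists_integral_solution (F := fun s z => P.f z (u s)) (B := N)
    hP.L_nonneg (fun z hz t ht => intervalIntegrable_comp_control hP.isCompact hP.continuousOn_f ht
      hz.continuousOn hu.1 fun s hs => hu.2 s hs.1) x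
    (fun s hs => hP.norm_f_le x _ (hu.2 s hs))
    (fun s hs z z' => hP.lipschitz_f z' z _ (hu.2 s hs))
  exact ⟨y, hyc.continuousOn, hy⟩

section

variable {x x' : E d} {u u' : ℝ → E m} {y y' : ℝ → E d} {N r₀ L T s t : ℝ}

theorem IsTrajectory.apply_zero (hy : P.IsTrajectory x u y) : y 0 = x := by
  simpa using hy.2 0 le_rfl

theorem Regular.intervalIntegrable_f (hP : P.Regular N r₀ L) (hu : P.Admissible u)
    (hy : ContinuousOn y (Ici 0)) (hs : 0 ≤ s) (ht : 0 ≤ t) :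
    IntervalIntegrable (fun s => P.f (y s) (u s)) volume s t := by
  have : ∀ t, 0 ≤ t → IntervalIntegrable (fun s => P.f (y s) (u s)) volume 0 t := fun t ht =>
    intervalIntegrable_comp_control hP.isCompact hP.continuousOn_f ht
      (hy.mono Icc_subset_Ici_self) hu.1 fun v hv => hu.2 v hv.1
  exact (this s hs).symm.trans (this t ht)

theorem Regular.intervalIntegrable_r (hP : P.Regular N r₀ L) (hu : P.Admissible u)
    (hy : ContinuousOn y (Ici 0)) (hs : 0 ≤ s) (ht : 0 ≤ t) :
    IntervalIntegrable (fun s => P.r (y s) (u s)) volume s t := by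
  have : ∀ t, 0 ≤ t → IntervalIntegrable (fun s => P.r (y s) (u s)) volume 0 t := fun t ht =>
    intervalIntegrable_comp_control hP.isCompact hP.continuousOn_r ht
      (hy.mono Icc_subset_Ici_self) hu.1 fun v hv => hu.2 v hv.1
  exact (this s hs).symm.trans (this t ht)

theorem Regular.trajectory_sub (hP : P.Regular N r₀ L) (hu : P.Admissible u)
    (hy : P.IsTrajectory x u y) (hs : 0 ≤ s) (ht : 0 ≤ t) :
    y t - y s = ∫ v in s..t, P.f (y v) (u v) := by
  rw [hy.2 t ht, hy.2 s hs, add_sub_add_left_eq_sub, integral_interval_sub_left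
    (hP.intervalIntegrable_f hu hy.1 le_rfl ht) (hP.intervalIntegrable_f hu hy.1 le_rfl hs)]

theorem Regular.norm_trajectory_sub_le (hP : P.Regular N r₀ L) (hu : P.Admissible u)
    (hy : P.IsTrajectory x u y) (hs : 0 ≤ s) (ht : 0 ≤ t) :
    ‖y t - y s‖ ≤ N * |t - s| := by
  rw [hP.trajectory_sub hu hy hs ht]
  refine norm_integral_le_of_norm_le_const fun v hv => hP.norm_f_le _ _ (hu.2 v ?_)
  exact (le_min hs ht).trans (le_of_lt hv.1)

theorem Regular.trajectory_sub_eq (hP : P.Regular N r₀ L) (hu : P.Admissible u)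
    (hy : P.IsTrajectory x u y) (hy' : P.IsTrajectory x' u' y')
    (huu : ∀ t ∈ Icc 0 T, u' t = u t) (ht : t ∈ Icc 0 T) :
    y' t - y t = (x' - x) + ∫ s in (0 : ℝ)..t, (P.f (y' s) (u s) - P.f (y s) (u s)) := by
  have h1 : ∫ s in (0 : ℝ)..t, P.f (y' s) (u' s) = ∫ s in (0 : ℝ)..t, P.f (y' s) (u s) := by
    refine integral_congr fun s hs => ?_
    rw [uIcc_of_le ht.1] at hs
    simp only [huu s ⟨hs.1, hs.2.trans ht.2⟩]
  rw [hy.2 t ht.1, hy'.2 t ht.1, h1, integral_sub (hP.intervalIntegrable_f hu hy'.1 le_rfl ht.1)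
    (hP.intervalIntegrable_f hu hy.1 le_rfl ht.1)]
  abel

theorem Regular.norm_trajectory_sub_trajectory_le (hP : P.Regular N r₀ L) (hu : P.Admissible u)
    (hy : P.IsTrajectory x u y) (hy' : P.IsTrajectory x' u' y')
    (huu : ∀ t ∈ Icc 0 T, u' t = u t) (ht : t ∈ Icc 0 T) :
    ‖y' t - y t‖ ≤ ‖x' - x‖ * Real.exp (L * T) := by
  have h := norm_le_mul_exp_of_integral_eq (φ := fun t => y' t - y t) (a := x' - x) (B := 0)
    (h := fun s => P.f (y' s) (u s) - P.f (y s) (u s)) hP.L_nonneg le_rfl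
    ((hy'.1.sub hy.1).mono Icc_subset_Ici_self)
    (fun s hs => by rw [zero_add]; exact hP.lipschitz_f _ _ _ (hu.2 s hs.1))
    (fun s hs => hP.trajectory_sub_eq hu hy hy' huu hs) t ht
  rw [zero_mul, add_zero] at h
  refine h.trans ?_
  have := hP.L_nonneg
  gcongr
  exact ht.2

end

/-- The adjoint arc with multiplier `lam` along `(y, u)` on `[0, T]`. -/
abbrev IsAdjointArc (P : Problem d m) (u : ℝ → E m) (y : ℝ → E d) (lam T : ℝ) (pT : E d)
    (p : ℝ → E d) : Prop :=
  IsBackwardSolution (fun t => ContinuousLinearMap.adjoint (P.Dxf (y t) (u t)))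
    (fun t => lam • P.Dxr (y t) (u t)) T pT p

section

variable {x x' : E d} {u u' : ℝ → E m} {y y' : ℝ → E d} {N r₀ L T s t lam : ℝ} {pT : E d}
  {p : ℝ → E d}

theorem Regular.continuousOn_adjoint_rhs (hP : P.Regular N r₀ L) (lam : ℝ) :
    ContinuousOn (fun q : (E d × E d) × E m =>
      ContinuousLinearMap.adjoint (P.Dxf q.1.1 q.2) q.1.2 + lam • P.Dxr q.1.1 q.2)
      (univ ×ˢ P.U) := by
  have hmap : MapsTo (fun q : (E d × E d) × E m => (q.1.1, q.2)) (univ ×ˢ P.U) (univ ×ˢ P.U) :=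
    fun q hq => ⟨mem_univ _, hq.2⟩
  have hc : Continuous (fun q : (E d × E d) × E m => (q.1.1, q.2)) := by fun_prop
  have h1 := hP.continuousOn_Dxf.comp hc.continuousOn hmap
  have h2 := hP.continuousOn_Dxr.comp hc.continuousOn hmap
  have h3 : ContinuousOn (fun q : (E d × E d) × E m =>
      ContinuousLinearMap.adjoint (P.Dxf q.1.1 q.2)) (univ ×ˢ P.U) :=
    (ContinuousLinearMap.adjoint (𝕜 := ℝ) (E := E d) (F := E d)).continuous.comp_continuousOn h1
  exact (h3.clm_apply (by fun_prop)).add (h2.const_smul lam)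

theorem Regular.norm_adjoint_rhs_le (hP : P.Regular N r₀ L) {ω : E m} (hω : ω ∈ P.U)
    (hlam : 0 ≤ lam) (y p : E d) :
    ‖ContinuousLinearMap.adjoint (P.Dxf y ω) p + lam • P.Dxr y ω‖ ≤ lam * L + L * ‖p‖ := by
  refine (norm_add_le _ _).trans ?_
  have h1 : ‖ContinuousLinearMap.adjoint (P.Dxf y ω) p‖ ≤ L * ‖p‖ := by
    refine (ContinuousLinearMap.le_opNorm _ _).trans ?_
    rw [LinearIsometryEquiv.norm_map]
    gcongr
    exact hP.norm_Dxf_le y ω hω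
  have h2 : ‖lam • P.Dxr y ω‖ ≤ lam * L := by
    rw [norm_smul, Real.norm_of_nonneg hlam]
    gcongr
    exact hP.norm_Dxr_le y ω hω
  linarith

theorem Regular.intervalIntegrable_adjoint_rhs (hP : P.Regular N r₀ L) (hu : P.Admissible u)
    (hy : ContinuousOn y (Ici 0)) (hp : ContinuousOn p (Icc 0 T)) (hs : s ∈ Icc 0 T)
    (ht : t ∈ Icc 0 T) (lam : ℝ) :
    IntervalIntegrable (fun s => ContinuousLinearMap.adjoint (P.Dxf (y s) (u s)) (p s)
      + lam • P.Dxr (y s) (u s)) volume s t := by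
  have hT : 0 ≤ T := hs.1.trans hs.2
  have : IntervalIntegrable (fun s => ContinuousLinearMap.adjoint (P.Dxf (y s) (u s)) (p s)
      + lam • P.Dxr (y s) (u s)) volume 0 T :=
    intervalIntegrable_comp_control (Z := E d × E d) (z := fun s => (y s, p s))
      (G := fun q ω => ContinuousLinearMap.adjoint (P.Dxf q.1 ω) q.2 + lam • P.Dxr q.1 ω)
      hP.isCompact (hP.continuousOn_adjoint_rhs lam) hT
      ((hy.mono Icc_subset_Ici_self).prodMk hp) hu.1 fun v hv => hu.2 v hv.1
  refine this.mono_set ?_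
  rw [uIcc_of_le hT]
  exact uIcc_subset_Icc hs ht

theorem Regular.exists_adjointArc (hP : P.Regular N r₀ L) (hu : P.Admissible u)
    (hy : ContinuousOn y (Ici 0)) (T : ℝ) (hlam : 0 ≤ lam) (pT : E d) :
    ∃ p, P.IsAdjointArc u y lam T pT p := by
  -- Time reversal turns the terminal condition into an initial one. The absolute value keeps the
  -- reversed time nonnegative when `s > T`, so that the control stays in `U`.
  set v : ℝ → E m := fun s => u |T - s| with hv
  have hvm : Measurable v := hu.1.comp (by fun_prop)
  have hvU : ∀ s, v s ∈ P.U := fun s => hu.2 _ (abs_nonneg _)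
  have hyc : Continuous fun s => y |T - s| :=
    hy.comp_continuous (by fun_prop) fun s => abs_nonneg (T - s)
  obtain ⟨q, hqc, hq⟩ := exists_integral_solution (F := fun s z =>
      ContinuousLinearMap.adjoint (P.Dxf (y |T - s|) (v s)) z + lam • P.Dxr (y |T - s|) (v s))
    (B := lam * L + L * ‖pT‖) hP.L_nonneg
    (fun z hz t ht => intervalIntegrable_comp_control (Z := E d × E d)
      (z := fun s => (y |T - s|, z s))
      (G := fun q ω => ContinuousLinearMap.adjoint (P.Dxf q.1 ω) q.2 + lam • P.Dxr q.1 ω)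
      hP.isCompact (hP.continuousOn_adjoint_rhs lam) ht
      (hyc.prodMk hz).continuousOn hvm fun s _ => hvU s) pT
    (fun s _ => hP.norm_adjoint_rhs_le (hvU s) hlam _ _)
    (fun s _ z z' => by
      rw [add_sub_add_right_eq_sub, ← map_sub]
      refine (ContinuousLinearMap.le_opNorm _ _).trans ?_
      rw [LinearIsometryEquiv.norm_map]
      gcongr
      exact hP.norm_Dxf_le _ _ (hvU s))
  refine ⟨fun t => q (T - t), (by fun_prop), fun t ht => ?_⟩
  beta_reduce
  rw [hq (T - t) (by linarith [ht.2])]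
  congr 1
  have := integral_comp_sub_left (a := 0) (b := T - t)
    (fun s => ContinuousLinearMap.adjoint (P.Dxf (y s) (u s)) (q (T - s))
      + lam • P.Dxr (y s) (u s)) T
  simp only [sub_sub_cancel, sub_zero] at this
  rw [← this]
  refine integral_congr fun s hs => ?_
  rw [uIcc_of_le (by linarith [ht.2])] at hs
  have h0 : |T - s| = T - s := abs_of_nonneg (by linarith [hs.2, ht.1])
  simp only [hv, h0]

theorem Regular.adjointArc_eq_forward (hP : P.Regular N r₀ L) (hu : P.Admissible u)
    (hy : ContinuousOn y (Ici 0)) (hp : P.IsAdjointArc u y lam T pT p) (ht : t ∈ Icc 0 T) :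
    p t = p 0 + ∫ s in (0 : ℝ)..t, -(ContinuousLinearMap.adjoint (P.Dxf (y s) (u s)) (p s)
      + lam • P.Dxr (y s) (u s)) := by
  have hT : 0 ≤ T := ht.1.trans ht.2
  have h0 : (0 : ℝ) ∈ Icc 0 T := ⟨le_rfl, hT⟩
  have h1 := hp.2 t ht
  have h2 := hp.2 0 h0
  rw [← integral_add_adjacent_intervals
    (hP.intervalIntegrable_adjoint_rhs hu hy hp.1 h0 ht lam)
    (hP.intervalIntegrable_adjoint_rhs hu hy hp.1 ht ⟨hT, le_rfl⟩ lam)] at h2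
  rw [h1, h2, intervalIntegral.integral_neg]
  abel

theorem IsAdjointArc.apply_end (hp : P.IsAdjointArc u y lam T pT p) (hT : 0 ≤ T) : p T = pT := by
  simpa using hp.2 T ⟨hT, le_rfl⟩

/-- Nondegeneracy: the terminal value is controlled by the initial value and `lam`, so a nontrivial
multiplier is not transported to a vanishing normal. -/
theorem Regular.norm_adjointArc_end_le (hP : P.Regular N r₀ L) (hu : P.Admissible u)
    (hy : ContinuousOn y (Ici 0)) (hlam : 0 ≤ lam) (hT : 0 ≤ T)
    (hp : P.IsAdjointArc u y lam T pT p) :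
    ‖pT‖ ≤ (‖p 0‖ + lam * L * T) * Real.exp (L * T) := by
  have := norm_le_mul_exp_of_integral_eq (φ := p) (a := p 0) (B := lam * L) hP.L_nonneg
    (mul_nonneg hlam hP.L_nonneg) hp.1
    (fun s hs => by rw [norm_neg]; exact hP.norm_adjoint_rhs_le (hu.2 s hs.1) hlam _ _)
    (fun s hs => hP.adjointArc_eq_forward hu hy hp hs) T ⟨hT, le_rfl⟩
  rwa [IsAdjointArc.apply_end hp hT] at this

theorem Regular.norm_adjointArc_le (hP : P.Regular N r₀ L) (hu : P.Admissible u)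
    (hlam : 0 ≤ lam) (hp : P.IsAdjointArc u y lam T pT p) (ht : t ∈ Icc 0 T) :
    ‖p t‖ ≤ (‖pT‖ + lam * L * T) * Real.exp (L * T) := by
  have hmem : ∀ s ∈ Icc 0 T, T - s ∈ Icc 0 T := fun s hs => ⟨by linarith [hs.2], by linarith [hs.1]⟩
  have h := norm_le_mul_exp_of_integral_eq (φ := fun s => p (T - s)) (a := pT) (B := lam * L)
    (T := T)
    (h := fun s => ContinuousLinearMap.adjoint (P.Dxf (y (T - s)) (u (T - s))) (p (T - s))
      + lam • P.Dxr (y (T - s)) (u (T - s))) hP.L_nonneg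
    (mul_nonneg hlam hP.L_nonneg) (hp.1.comp (by fun_prop) hmem)
    (fun s hs => hP.norm_adjoint_rhs_le (hu.2 _ (hmem s hs).1) hlam _ _)
    (fun s hs => by
      have h1 := integral_comp_sub_left (a := 0) (b := s)
        (fun s => ContinuousLinearMap.adjoint (P.Dxf (y s) (u s)) (p s)
          + lam • P.Dxr (y s) (u s)) T
      rw [sub_zero] at h1
      rw [hp.2 _ (hmem s hs), h1]) (T - t) (hmem t ht)
  simp only [sub_sub_cancel] at h
  refine h.trans ?_
  have := hP.L_nonneg
  have hT : 0 ≤ T := ht.1.trans ht.2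
  gcongr
  linarith [ht.1]

/-- First order expansion of the running cost along the adjoint arc. -/
theorem Regular.abs_adjoint_expansion_le (hP : P.Regular N r₀ L) (hu : P.Admissible u)
    (hy : P.IsTrajectory x u y) (hy' : P.IsTrajectory x' u' y')
    (huu : ∀ t ∈ Icc 0 T, u' t = u t) (hlam : 0 ≤ lam) (hT : 0 ≤ T)
    (hp : P.IsAdjointArc u y lam T pT p) {K B : ℝ} (hB : ∀ t ∈ Icc 0 T, ‖p t‖ ≤ B)
    (hK : ∀ t ∈ Icc 0 T, ‖y' t - y t‖ ≤ K) :
    |inner ℝ pT (y' T - y T) + lam * (∫ s in (0 : ℝ)..T, (P.r (y' s) (u s) - P.r (y s) (u s)))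
      - inner ℝ (p 0) (x' - x)| ≤ (B + lam) * L * K ^ 2 * T := by
  have h0 : (0 : ℝ) ∈ Icc 0 T := ⟨le_rfl, hT⟩
  have hB0 : 0 ≤ B := (norm_nonneg _).trans (hB 0 h0)
  have hK0 : 0 ≤ K := (norm_nonneg _).trans (hK 0 h0)
  have hL := hP.L_nonneg
  have he0 : y' 0 - y 0 = x' - x := by rw [hy.apply_zero, hy'.apply_zero]
  have hii1 := (hP.intervalIntegrable_adjoint_rhs hu hy.1 hp.1 h0 ⟨hT, le_rfl⟩ lam).neg
  have hii2 := (hP.intervalIntegrable_f hu hy'.1 le_rfl hT).sub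
    (hP.intervalIntegrable_f hu hy.1 le_rfl hT)
  have hii3 := (hP.intervalIntegrable_r hu hy'.1 le_rfl hT).sub
    (hP.intervalIntegrable_r hu hy.1 le_rfl hT)
  have hparts := inner_sub_inner_eq_integral (p := p) (e := fun t => y' t - y t)
    (B := max (lam * L + L * B) (L * K)) hT hii1 hii2
    (fun t ht => by
      refine le_trans ?_ (le_max_left _ _)
      rw [Pi.neg_apply, norm_neg]
      refine (hP.norm_adjoint_rhs_le (hu.2 t ht.1) hlam _ _).trans ?_
      gcongr
      exact hB t ht)
    (fun t ht => by
      refine le_trans ?_ (le_max_right _ _)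
      refine (hP.lipschitz_f _ _ _ (hu.2 t ht.1)).trans ?_
      gcongr
      exact hK t ht)
    (fun t ht => hP.adjointArc_eq_forward hu hy.1 hp ht)
    (fun t ht => by
      simp only [he0]
      exact hP.trajectory_sub_eq hu hy hy' huu ht)
  simp only [IsAdjointArc.apply_end hp hT, he0] at hparts
  have hec : ContinuousOn (fun t => y' t - y t) (Icc 0 T) :=
    (hy'.1.sub hy.1).mono Icc_subset_Ici_self
  -- In the derivative of `p·(y' - y)`, the adjoint term removes the linear part of `f(y') - f(y)`,
  -- and the source removes the linear part of `lam (r(y') - r(y))`. Only Taylor remainders survive.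
  have key : inner ℝ pT (y' T - y T)
      + lam * (∫ s in (0 : ℝ)..T, (P.r (y' s) (u s) - P.r (y s) (u s)))
      - inner ℝ (p 0) (x' - x)
      = ∫ s in (0 : ℝ)..T, (inner ℝ (p s)
          (P.f (y' s) (u s) - P.f (y s) (u s) - P.Dxf (y s) (u s) (y' s - y s))
        + lam * (P.r (y' s) (u s) - P.r (y s) (u s)
          - inner ℝ (P.Dxr (y s) (u s)) (y' s - y s))) := by
    rw [← intervalIntegral.integral_const_mul]
    have h2 := hii3.const_mul lam
    rw [add_sub_right_comm, hparts, ← integral_add ?_ h2]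
    · refine integral_congr fun s _ => ?_
      simp only [Pi.neg_apply, inner_neg_left, inner_add_left, ContinuousLinearMap.adjoint_inner_left,
        inner_sub_right, inner_smul_left, RCLike.conj_to_real, map_sub]
      ring
    · have c1 : ContinuousOn (fun q : (E d × E d × E d) × E m =>
          inner ℝ (-(ContinuousLinearMap.adjoint (P.Dxf q.1.1 q.2) q.1.2.1
            + lam • P.Dxr q.1.1 q.2)) (q.1.2.2 - q.1.1)
          + inner ℝ q.1.2.1 (P.f q.1.2.2 q.2 - P.f q.1.1 q.2)) (univ ×ˢ P.U) := by
        have g1 : Continuous (fun q : (E d × E d × E d) × E m => ((q.1.1, q.1.2.1), q.2)) := by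
          fun_prop
        have g2 : Continuous (fun q : (E d × E d × E d) × E m => (q.1.1, q.2)) := by fun_prop
        have g3 : Continuous (fun q : (E d × E d × E d) × E m => (q.1.2.2, q.2)) := by fun_prop
        have k1 := (hP.continuousOn_adjoint_rhs lam).comp (s := univ ×ˢ P.U) g1.continuousOn
          fun q hq => ⟨mem_univ _, hq.2⟩
        have k2 := hP.continuousOn_f.comp (s := univ ×ˢ P.U) g2.continuousOn
          fun q hq => ⟨mem_univ _, hq.2⟩
        have k3 := hP.continuousOn_f.comp (s := univ ×ˢ P.U) g3.continuousOn
          fun q hq => ⟨mem_univ _, hq.2⟩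
        have g4 : Continuous (fun q : (E d × E d × E d) × E m => q.1.2.2 - q.1.1) := by fun_prop
        have g5 : Continuous (fun q : (E d × E d × E d) × E m => q.1.2.1) := by fun_prop
        exact (k1.neg.inner (𝕜 := ℝ) g4.continuousOn).add
          (g5.continuousOn.inner (𝕜 := ℝ) (k3.sub k2))
      exact intervalIntegrable_comp_control (Z := E d × E d × E d)
        (z := fun s => (y s, p s, y' s))
        (G := fun q ω => inner ℝ (-(ContinuousLinearMap.adjoint (P.Dxf q.1 ω) q.2.1
            + lam • P.Dxr q.1 ω)) (q.2.2 - q.1)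
          + inner ℝ q.2.1 (P.f q.2.2 ω - P.f q.1 ω)) hP.isCompact c1 hT
        ((hy.1.mono Icc_subset_Ici_self).prodMk
          (hp.1.prodMk (hy'.1.mono Icc_subset_Ici_self))) hu.1 fun s hs => hu.2 s hs.1
  rw [key]
  have := norm_integral_le_of_norm_le_const (a := 0) (b := T) (C := (B + lam) * L * K ^ 2)
    (f := fun s => (inner ℝ (p s)
          (P.f (y' s) (u s) - P.f (y s) (u s) - P.Dxf (y s) (u s) (y' s - y s))
        + lam * (P.r (y' s) (u s) - P.r (y s) (u s)
          - inner ℝ (P.Dxr (y s) (u s)) (y' s - y s)))) (fun s hs => by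
      rw [uIoc_of_le hT] at hs
      have hs' : s ∈ Icc 0 T := ⟨hs.1.le, hs.2⟩
      have huU := hu.2 s hs'.1
      have hk2 : L * ‖y' s - y s‖ ^ 2 ≤ L * K ^ 2 := by gcongr; exact hK s hs'
      have e1 : |inner ℝ (p s)
          (P.f (y' s) (u s) - P.f (y s) (u s) - P.Dxf (y s) (u s) (y' s - y s))| ≤ B * (L * K ^ 2) :=
        (abs_real_inner_le_norm _ _).trans (mul_le_mul (hB s hs')
          ((hP.taylor_f _ _ _ huU).trans hk2) (norm_nonneg _) hB0)
      have e2 : |lam * (P.r (y' s) (u s) - P.r (y s) (u s)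
          - inner ℝ (P.Dxr (y s) (u s)) (y' s - y s))| ≤ lam * (L * K ^ 2) := by
        rw [abs_mul, abs_of_nonneg hlam]
        gcongr
        exact (hP.taylor_r _ _ _ huU).trans hk2
      rw [Real.norm_eq_abs]
      refine (abs_add_le _ _).trans ?_
      linarith)
  rwa [sub_zero, abs_of_nonneg hT] at this

end

end Problem

end ExitTime

end

noncomputable section

namespace ExitTime

open MeasureTheory intervalIntegral

/-! ### Measurable selection -/

/-- The minimum over a compact set is attained, so a point with `φ t a ≤ 0` exists exactly when the
infimum over a countable dense subset is at most zero. -/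
theorem measurableSet_exists_mem_le_zero {Ω X : Type*} [MeasurableSpace Ω] [MetricSpace X]
    {K : Set X} (hK : IsCompact K) {φ : Ω → X → ℝ} (hc : ∀ t, ContinuousOn (φ t) K)
    (hm : ∀ a ∈ K, Measurable fun t => φ t a) : MeasurableSet {t | ∃ a ∈ K, φ t a ≤ 0} := by
  rcases K.eq_empty_or_nonempty with rfl | hne
  · simp
  have : CompactSpace K := isCompact_iff_compactSpace.1 hK
  have : Nonempty K := hne.to_subtype
  set D : ℕ → K := TopologicalSpace.denseSeq K
  have : {t | ∃ a ∈ K, φ t a ≤ 0} = ⋂ n : ℕ, ⋃ i : ℕ, {t | φ t (D i) < 1 / ((n : ℝ) + 1)} := by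
    ext t
    simp only [mem_ofPred_eq, mem_iInter, mem_iUnion]
    constructor
    · rintro ⟨a, ha, hle⟩ n
      have hop : IsOpen {b : K | φ t b < 1 / ((n : ℝ) + 1)} :=
        isOpen_lt (continuousOn_iff_continuous_domRestrict.1 (hc t)) continuous_const
      obtain ⟨i, hi⟩ := (TopologicalSpace.denseRange_denseSeq K).exists_mem_open hop
        ⟨⟨a, ha⟩, lt_of_le_of_lt hle (by positivity)⟩
      exact ⟨i, hi⟩
    · intro h
      obtain ⟨a, ha, hmin⟩ := hK.exists_isMinOn hne (hc t)
      refine ⟨a, ha, le_of_forall_pos_lt_add fun ε hε => ?_⟩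
      obtain ⟨n, hn⟩ := exists_nat_one_div_lt hε
      obtain ⟨i, hi⟩ := h n
      have := hmin (D i).2
      simp only [mem_ofPred_eq] at this
      linarith
  rw [this]
  exact MeasurableSet.iInter fun n => MeasurableSet.iUnion fun i =>
    measurableSet_lt (hm _ (D i).2) measurable_const

/-- Measurable selection of a zero of a Carathéodory function on a compact subset of `ℝ^m`. -/
theorem exists_measurable_selection {Ω : Type*} [MeasurableSpace Ω] {m : ℕ} {U : Set (E m)}
    (hU : IsCompact U) {φ : Ω → E m → ℝ} (hc : ∀ t, ContinuousOn (φ t) U)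
    (hm : ∀ a ∈ U, Measurable fun t => φ t a) (hz : ∀ t, ∃ a ∈ U, φ t a ≤ 0) :
    ∃ u : Ω → E m, Measurable u ∧ ∀ t, u t ∈ U ∧ φ t (u t) ≤ 0 := by
  -- Lexicographic minimisation: `ψ` is modified one coordinate at a time, so that `{ψ t ≤ 0}`
  -- shrinks to the points where that coordinate is least. After all coordinates this set is a
  -- single point.
  have step : ∀ s : Finset (Fin m), ∃ ψ : Ω → E m → ℝ, (∀ t, ContinuousOn (ψ t) U) ∧
      (∀ a ∈ U, Measurable fun t => ψ t a) ∧ (∀ t, ∃ a ∈ U, ψ t a ≤ 0) ∧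
      (∀ t a, φ t a ≤ ψ t a) ∧
      ∀ t, ∀ a ∈ U, ∀ b ∈ U, ψ t a ≤ 0 → ψ t b ≤ 0 → ∀ i ∈ s, a i = b i := by
    intro s
    induction s using Finset.induction_on with
    | empty => exact ⟨φ, hc, hm, hz, fun _ _ => le_rfl, by simp⟩
    | insert j s _ ih =>
      obtain ⟨ψ, hψc, hψm, hψz, hψφ, hψs⟩ := ih
      have hcoord : Continuous fun a : E m => a j := by fun_prop
      set Z : Ω → Set (E m) := fun t => {a ∈ U | ψ t a ≤ 0} with hZ
      have hZc : ∀ t, IsCompact (Z t) := fun t => by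
        have : IsClosed (U ∩ ψ t ⁻¹' Iic 0) := (hψc t).preimage_isClosed_of_isClosed hU.isClosed isClosed_Iic
        exact hU.of_isClosed_subset this fun a ha => ha.1
      have hZne : ∀ t, (Z t).Nonempty := fun t => by
        obtain ⟨a, ha, hle⟩ := hψz t; exact ⟨a, ha, hle⟩
      choose α hαmem hαmin using fun t => (hZc t).exists_isMinOn (hZne t) hcoord.continuousOn
      -- Only the minimal value of the coordinate is shown to be measurable; the chosen minimiser
      -- `α` itself need not be.
      have hvm : Measurable fun t => α t j := by
        refine measurable_of_Iic fun c => ?_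
        have hEq : (fun t => α t j) ⁻¹' Iic c = {t | ∃ a ∈ U ∩ {a | a j ≤ c}, ψ t a ≤ 0} := by
          ext t
          simp only [mem_preimage, mem_Iic, mem_ofPred_eq]
          constructor
          · exact fun h => ⟨α t, ⟨(hαmem t).1, h⟩, (hαmem t).2⟩
          · rintro ⟨a, ⟨haU, hac⟩, ha⟩
            exact le_trans (hαmin t (⟨haU, ha⟩ : a ∈ Z t)) hac
        rw [hEq]
        refine measurableSet_exists_mem_le_zero
          (hU.inter_right (isClosed_le hcoord continuous_const))
          (fun t => (hψc t).mono inter_subset_left) fun a ha => hψm a ha.1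
      refine ⟨fun t a => max (ψ t a) (a j - α t j), fun t => ?_, fun a ha => ?_, fun t => ?_,
        fun t a => (hψφ t a).trans (le_max_left _ _), fun t a ha b hb h1 h2 i hi => ?_⟩
      · exact (hψc t).sup (hcoord.sub continuous_const).continuousOn
      · exact (hψm a ha).max (measurable_const.sub hvm)
      · exact ⟨α t, (hαmem t).1, max_le (hαmem t).2 (by simp)⟩
      · have ha0 := (le_max_left _ _).trans h1
        have hb0 := (le_max_left _ _).trans h2
        have ha1 := (le_max_right _ _).trans h1
        have hb1 := (le_max_right _ _).trans h2
        rcases Finset.mem_insert.1 hi with rfl | his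
        · have h3 : α t i ≤ a i := hαmin t (⟨ha, ha0⟩ : a ∈ Z t)
          have h4 : α t i ≤ b i := hαmin t (⟨hb, hb0⟩ : b ∈ Z t)
          linarith
        · exact hψs t a ha b hb ha0 hb0 i his
  obtain ⟨ψ, hψc, hψm, hψz, hψφ, hψs⟩ := step Finset.univ
  choose u huU hu0 using hψz
  refine ⟨u, measurable_of_isClosed fun F hF => ?_, fun t => ⟨huU t, (hψφ t _).trans (hu0 t)⟩⟩
  -- By uniqueness of the selected point, `u t ∈ F` is equivalent to the existence of some
  -- admissible point in `U ∩ F`.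
  have hEq : u ⁻¹' F = {t | ∃ a ∈ U ∩ F, ψ t a ≤ 0} := by
    ext t
    simp only [mem_preimage, mem_ofPred_eq]
    constructor
    · exact fun h => ⟨u t, ⟨huU t, h⟩, hu0 t⟩
    · rintro ⟨a, ⟨haU, haF⟩, ha⟩
      have : a = u t := by
        ext i; exact hψs t a haU (u t) (huU t) ha (hu0 t) i (Finset.mem_univ i)
      rwa [← this]
  rw [hEq]
  exact measurableSet_exists_mem_le_zero (hU.inter_right hF)
    (fun t => (hψc t).mono inter_subset_left) fun a ha => hψm a ha.1

end ExitTime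

end

noncomputable section

namespace ExitTime

open MeasureTheory intervalIntegral

variable {d m : ℕ}

/-! ### Existence of optimal controls -/

/-- An ultrafilter provides limits at all times at once, so no diagonal extraction is needed, and
the common Lipschitz bound passes to the limit. -/
theorem exists_ultrafilter_limit {X : Type*} [NormedAddCommGroup X] [ProperSpace X]
    (𝓤 : Ultrafilter ℕ) {Y : ℕ → ℝ → X} {C K : ℝ} (hb : ∀ n t, ‖Y n t‖ ≤ C)
    (hl : ∀ n s t, ‖Y n t - Y n s‖ ≤ K * |t - s|) :
    ∃ y : ℝ → X, (∀ t, Tendsto (fun n => Y n t) 𝓤 (𝓝 (y t))) ∧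
      ∀ s t, ‖y t - y s‖ ≤ K * |t - s| := by
  have : ∀ t, ∃ a, Tendsto (fun n => Y n t) 𝓤 (𝓝 a) := fun t => by
    obtain ⟨a, -, ha⟩ := (isCompact_closedBall (0 : X) C).ultrafilter_le_nhds'
      (𝓤.map fun n => Y n t) (Ultrafilter.mem_map.2 (Filter.univ_mem' fun n => by simpa using hb n t))
    exact ⟨a, ha⟩
  choose y hy using this
  exact ⟨y, hy, fun s t => le_of_tendsto ((hy t).sub (hy s)).norm
    (Filter.univ_mem' fun n => hl n s t)⟩

namespace Problem

variable {P : Problem d m} {N r₀ L : ℝ}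

/-- The dynamics augmented with the running cost. -/
def aug (P : Problem d m) (x : E d) (ω : E m) : E d × ℝ := (P.f x ω, P.r x ω)

/-- The set of augmented velocities at `x`, with the running cost relaxed upwards. -/
def velocities (P : Problem d m) (x : E d) : Set (E d × ℝ) :=
  {q | ∃ ω ∈ P.U, q.1 = P.f x ω ∧ P.r x ω ≤ q.2}

theorem Regular.continuousOn_aug (hP : P.Regular N r₀ L) :
    ContinuousOn (fun q : E d × E m => P.aug q.1 q.2) (univ ×ˢ P.U) :=
  hP.continuousOn_f.prodMk hP.continuousOn_r

theorem Regular.norm_aug_sub_le (hP : P.Regular N r₀ L) {ω : E m} (hω : ω ∈ P.U) (x y : E d) :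
    ‖P.aug y ω - P.aug x ω‖ ≤ L * ‖y - x‖ := by
  rw [aug, aug, Prod.mk_sub_mk, Prod.norm_mk]
  exact max_le (hP.lipschitz_f x y ω hω) (hP.lipschitz_r x y ω hω)

theorem Regular.isClosed_velocities (hP : P.Regular N r₀ L) (x : E d) :
    IsClosed (P.velocities x) := by
  have hc : ContinuousOn (P.aug x) P.U :=
    hP.continuousOn_aug.comp (f := fun ω => (x, ω)) (by fun_prop) fun ω hω => ⟨mem_univ _, hω⟩
  have hEq : P.velocities x = P.aug x '' P.U + ({0} ×ˢ Ici (0 : ℝ) : Set (E d × ℝ)) := by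
    ext q
    constructor
    · rintro ⟨ω, hω, h1, h2⟩
      refine ⟨P.aug x ω, mem_image_of_mem _ hω, (0, q.2 - P.r x ω), ⟨rfl, sub_nonneg.2 h2⟩, ?_⟩
      ext1 <;> simp [aug, h1]
    · rintro ⟨_, ⟨ω, hω, rfl⟩, ⟨a, s⟩, ⟨ha, hs⟩, rfl⟩
      simp only [mem_singleton_iff] at ha
      subst ha
      exact ⟨ω, hω, by simp [aug], by simpa [aug] using hs⟩
  rw [hEq]
  exact (isClosed_singleton.prod isClosed_Ici).add_left_of_isCompact
    (hP.isCompact.image_of_continuousOn hc)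

theorem Regular.exists_r_bound (hP : P.Regular N r₀ L) (x : E d) (T : ℝ) : ∃ B, 0 ≤ B ∧
    ∀ u y, P.Admissible u → P.IsTrajectory x u y → ∀ t ∈ Icc 0 T, |P.r (y t) (u t)| ≤ B := by
  have hc : ContinuousOn (P.r x) P.U :=
    hP.continuousOn_r.comp (f := fun ω => (x, ω)) (by fun_prop) fun ω hω => ⟨mem_univ _, hω⟩
  obtain ⟨B, hB⟩ := hP.isCompact.exists_bound_of_continuousOn hc
  obtain ⟨ω₀, hω₀⟩ := hP.nonempty
  have hB0 : 0 ≤ B := (norm_nonneg _).trans (hB ω₀ hω₀)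
  have hL := hP.L_nonneg
  have hN := hP.N_pos
  refine ⟨B + L * (N * |T|), by positivity, fun u y hu hy t ht => ?_⟩
  have h1 := hP.lipschitz_r x (y t) (u t) (hu.2 t ht.1)
  have h2 := hP.norm_trajectory_sub_le hu hy le_rfl ht.1
  rw [hy.apply_zero, sub_zero] at h2
  have h3 := hB (u t) (hu.2 t ht.1)
  have h4 : |t| ≤ |T| := by rw [abs_of_nonneg ht.1]; exact ht.2.trans (le_abs_self T)
  have h5 : L * ‖y t - x‖ ≤ L * (N * |T|) := by
    refine mul_le_mul_of_nonneg_left (h2.trans ?_) hL; gcongr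
  rw [Real.norm_eq_abs] at h3
  have := abs_add_le (P.r (y t) (u t) - P.r x (u t)) (P.r x (u t))
  rw [sub_add_cancel] at this
  linarith

theorem Regular.intervalIntegrable_aug (hP : P.Regular N r₀ L) {u : ℝ → E m} {y : ℝ → E d}
    (hu : P.Admissible u) (hy : ContinuousOn y (Ici 0)) {s t : ℝ} (hs : 0 ≤ s) (ht : 0 ≤ t) :
    IntervalIntegrable (fun s => P.aug (y s) (u s)) volume s t := by
  have : ∀ t, 0 ≤ t → IntervalIntegrable (fun s => P.aug (y s) (u s)) volume 0 t := fun t ht =>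
    intervalIntegrable_comp_control hP.isCompact hP.continuousOn_aug ht
      (hy.mono Icc_subset_Ici_self) hu.1 fun v hv => hu.2 v hv.1
  exact (this s hs).symm.trans (this t ht)

/-- The velocity of a limit of trajectories lies in the convex set of velocities. -/
theorem Regular.hasDerivAt_mem_velocities (hP : P.Regular N r₀ L) (h0 : P.H0) (𝓤 : Ultrafilter ℕ)
    {x : E d} {u : ℕ → ℝ → E m} {y : ℕ → ℝ → E d} (hu : ∀ n, P.Admissible (u n))
    (hy : ∀ n, P.IsTrajectory x (u n) (y n)) {Y : ℝ → E d × ℝ} {T t : ℝ} {v : E d × ℝ}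
    (hY1 : Tendsto (fun n => y n t) 𝓤 (𝓝 (Y t).1))
    (hY : ∀ s ∈ Icc 0 T, Tendsto (fun n => ∫ s in (0 : ℝ)..s, P.aug (y n s) (u n s)) 𝓤
      (𝓝 (Y s - Y 0)))
    (ht : t ∈ Ioo 0 T) (hv : HasDerivAt Y v t) : v ∈ P.velocities (Y t).1 := by
  set Q := P.velocities (Y t).1 with hQ
  have hQc : IsClosed Q := hP.isClosed_velocities _
  have hQconv : Convex ℝ Q := h0 _
  obtain ⟨ω₀, hω₀⟩ := hP.nonempty
  have hQne : Q.Nonempty := ⟨P.aug (Y t).1 ω₀, ω₀, hω₀, rfl, le_rfl⟩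
  have hL := hP.L_nonneg
  have hN := hP.N_pos
  -- With the state frozen at `(Y t).1`, the mean velocity over `[t, t + h]` lies in the closed
  -- convex set `Q`, and freezing costs `L (‖y n t - (Y t).1‖ + N h)`. The first error vanishes
  -- along `𝓤`, the second as `h → 0`.
  have hn : ∀ h ∈ Ioo 0 (T - t), ∀ n,
      Metric.infDist (h⁻¹ • ((∫ s in (0 : ℝ)..(t + h), P.aug (y n s) (u n s))
        - ∫ s in (0 : ℝ)..t, P.aug (y n s) (u n s))) Q ≤ L * (‖y n t - (Y t).1‖ + N * h) := by
    intro h hh n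
    have hth : t ≤ t + h := by linarith [hh.1]
    have ht0 := ht.1.le
    have hth0 : 0 ≤ t + h := by linarith
    have hconst := hP.intervalIntegrable_aug (hu n) (y := fun _ => (Y t).1) continuousOn_const ht0 hth0
    have hb : (h⁻¹ • ∫ s in t..(t + h), P.aug (Y t).1 (u n s)) ∈ Q := by
      have := hQconv.set_average_mem (μ := volume) (t := uIoc t (t + h))
        (f := fun s => P.aug (Y t).1 (u n s)) hQc (by
          rw [uIoc_of_le hth]; simp [hh.1]) (by rw [uIoc_of_le hth]; simp)
        ((ae_restrict_mem measurableSet_uIoc).mono fun s hs => by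
          rw [uIoc_of_le hth] at hs
          exact ⟨u n s, (hu n).2 s (ht0.trans hs.1.le), rfl, le_rfl⟩) hconst.def'
      rwa [interval_average_eq, add_sub_cancel_left] at this
    refine (Metric.infDist_le_dist_of_mem hb).trans ?_
    rw [integral_interval_sub_left (hP.intervalIntegrable_aug (hu n) (hy n).1 le_rfl hth0)
      (hP.intervalIntegrable_aug (hu n) (hy n).1 le_rfl ht0), dist_eq_norm, ← smul_sub,
      ← integral_sub (hP.intervalIntegrable_aug (hu n) (hy n).1 ht0 hth0) hconst, norm_smul]
    have h1 := norm_integral_le_of_norm_le_const (a := t) (b := t + h)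
      (f := fun s => P.aug (y n s) (u n s) - P.aug (Y t).1 (u n s))
      (C := L * (‖y n t - (Y t).1‖ + N * h)) (fun s hs => by
        rw [uIoc_of_le hth] at hs
        have hs0 : 0 ≤ s := ht0.trans hs.1.le
        refine (hP.norm_aug_sub_le ((hu n).2 s hs0) _ _).trans ?_
        gcongr
        have h2 := hP.norm_trajectory_sub_le (hu n) (hy n) ht0 hs0
        have h3 : |s - t| ≤ h := by rw [abs_of_nonneg (by linarith [hs.1])]; linarith [hs.2]
        have h4 : y n s - (Y t).1 = (y n t - (Y t).1) + (y n s - y n t) := by abel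
        rw [h4]
        refine (norm_add_le _ _).trans ?_
        gcongr
        exact h2.trans (by gcongr))
    rw [add_sub_cancel_left, abs_of_pos hh.1] at h1
    rw [Real.norm_of_nonneg (inv_nonneg.2 hh.1.le), inv_mul_le_iff₀ hh.1]
    linarith
  have hlim : ∀ h ∈ Ioo 0 (T - t), Metric.infDist (h⁻¹ • (Y (t + h) - Y t)) Q ≤ L * (N * h) := by
    intro h hh
    have h1 := hY (t + h) ⟨by linarith [hh.1, ht.1], by linarith [hh.2]⟩
    have h2 := hY t ⟨ht.1.le, ht.2.le⟩
    have h3 := (h1.sub h2).const_smul h⁻¹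
    rw [sub_sub_sub_cancel_right] at h3
    have h4 := ((Metric.continuous_infDist_pt Q).tendsto _).comp h3
    have h5 : Tendsto (fun n => L * (‖y n t - (Y t).1‖ + N * h)) 𝓤 (𝓝 (L * (0 + N * h))) := by
      have := (tendsto_iff_norm_sub_tendsto_zero.1 hY1)
      exact (this.add_const _).const_mul L
    rw [zero_add] at h5
    exact le_of_tendsto_of_tendsto h4 h5 (Filter.Eventually.of_forall fun n => hn h hh n)
  have hslope := hv.tendsto_slope_zero_right
  have h1 := ((Metric.continuous_infDist_pt Q).tendsto _).comp hslope
  have h2 : Tendsto (fun h : ℝ => L * (N * h)) (𝓝[>] 0) (𝓝 (L * (N * 0))) :=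
    (Continuous.tendsto (by fun_prop) 0).mono_left nhdsWithin_le_nhds
  have h3 := le_of_tendsto_of_tendsto h1 h2 (by
    filter_upwards [Ioo_mem_nhdsGT (sub_pos.2 ht.2)] with h hh using hlim h hh)
  rw [mul_zero, mul_zero] at h3
  exact (hQc.mem_iff_infDist_zero hQne).2 (le_antisymm h3 Metric.infDist_nonneg)

theorem Regular.fst_integral_aug (hP : P.Regular N r₀ L) {u : ℝ → E m} {y : ℝ → E d}
    (hu : P.Admissible u) (hy : ContinuousOn y (Ici 0)) {t : ℝ} (ht : 0 ≤ t) :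
    (∫ s in (0 : ℝ)..t, P.aug (y s) (u s)).1 = ∫ s in (0 : ℝ)..t, P.f (y s) (u s) := by
  rw [integral_of_le ht, integral_of_le ht]
  exact fst_integral (hP.intervalIntegrable_aug hu hy le_rfl ht).1

theorem Regular.snd_integral_aug (hP : P.Regular N r₀ L) {u : ℝ → E m} {y : ℝ → E d}
    (hu : P.Admissible u) (hy : ContinuousOn y (Ici 0)) {t : ℝ} (ht : 0 ≤ t) :
    (∫ s in (0 : ℝ)..t, P.aug (y s) (u s)).2 = ∫ s in (0 : ℝ)..t, P.r (y s) (u s) := by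
  rw [integral_of_le ht, integral_of_le ht]
  exact snd_integral (hP.intervalIntegrable_aug hu hy le_rfl ht).1

/-- Compactness of trajectories, with lower semicontinuity of the running cost. -/
theorem Regular.exists_limit_trajectory (hP : P.Regular N r₀ L) (h0 : P.H0) (𝓤 : Ultrafilter ℕ)
    {x : E d} {u : ℕ → ℝ → E m} {y : ℕ → ℝ → E d} (hu : ∀ n, P.Admissible (u n))
    (hy : ∀ n, P.IsTrajectory x (u n) (y n)) {T : ℝ} (hT : 0 ≤ T) :
    ∃ v z, P.Admissible v ∧ P.IsTrajectory x v z ∧ ∀ t ∈ Icc 0 T,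
      Tendsto (fun n => y n t) 𝓤 (𝓝 (z t)) ∧
      ∃ ℓ, Tendsto (fun n => ∫ s in (0 : ℝ)..t, P.r (y n s) (u n s)) 𝓤 (𝓝 ℓ) ∧
        ∫ s in (0 : ℝ)..t, P.r (z s) (v s) ≤ ℓ := by
  obtain ⟨B, hB0, hB⟩ := hP.exists_r_bound x T
  have hN := hP.N_pos
  -- Clamping time to `[0, T]` makes the arcs bounded and Lipschitz on all of `ℝ`.
  set c : ℝ → ℝ := fun t => max 0 (min t T) with hc
  have hcmem : ∀ t, c t ∈ Icc 0 T := fun t => ⟨le_max_left _ _, max_le hT (min_le_right _ _)⟩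
  have hceq : ∀ t ∈ Icc 0 T, c t = t := fun t ht => by simp [hc, ht.1, ht.2]
  have hclip : ∀ s t, |c t - c s| ≤ |t - s| := fun s t => by
    have := ((LipschitzWith.id (α := ℝ)).min_const T).const_max 0
    simpa [Real.dist_eq] using this.dist_le_mul t s
  set Yn : ℕ → ℝ → E d × ℝ := fun n t => (x, 0) + ∫ s in (0 : ℝ)..(c t), P.aug (y n s) (u n s)
    with hYn
  have haug : ∀ n, ∀ s ∈ Icc 0 T, ‖P.aug (y n s) (u n s)‖ ≤ max N B := fun n s hs => by
    rw [aug, Prod.norm_mk]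
    exact max_le_max (hP.norm_f_le _ _ ((hu n).2 s hs.1)) (hB _ _ (hu n) (hy n) s hs)
  have hYlip : ∀ n s t, ‖Yn n t - Yn n s‖ ≤ max N B * |t - s| := fun n s t => by
    simp only [hYn]
    rw [add_sub_add_left_eq_sub]
    refine (norm_integral_sub_le (haug n) (hP.intervalIntegrable_aug (hu n) (hy n).1 le_rfl hT)
      (hcmem s) (hcmem t)).trans ?_
    exact mul_le_mul_of_nonneg_left (hclip s t) (by positivity)
  have hY0 : ∀ n, Yn n 0 = (x, 0) := fun n => by simp [hYn, hceq 0 ⟨le_rfl, hT⟩]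
  have hYb : ∀ n t, ‖Yn n t‖ ≤ ‖((x, 0) : E d × ℝ)‖ + max N B * T := fun n t => by
    have h1 := norm_integral_sub_le (haug n) (hP.intervalIntegrable_aug (hu n) (hy n).1 le_rfl hT)
      ⟨le_rfl, hT⟩ (hcmem t)
    rw [integral_same, sub_zero, sub_zero, abs_of_nonneg (hcmem t).1] at h1
    refine (norm_add_le _ _).trans ?_
    gcongr
    refine h1.trans ?_
    gcongr
    exact (hcmem t).2
  obtain ⟨Y, hYt, hYl⟩ := exists_ultrafilter_limit 𝓤 hYb hYlip
  have hYx : Y 0 = (x, 0) := by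
    refine tendsto_nhds_unique (hYt 0) ?_
    simp only [hY0]; exact tendsto_const_nhds
  have hYlipw : LipschitzWith ⟨max N B, by positivity⟩ Y := LipschitzWith.of_dist_le_mul
    fun t s => by rw [dist_eq_norm, Real.dist_eq]; exact hYl s t
  have hYc : Continuous Y := hYlipw.continuous
  have hfst : ∀ t ∈ Icc 0 T, ∀ n, (Yn n t).1 = y n t := fun t ht n => by
    rw [(hy n).2 t ht.1, ← hP.fst_integral_aug (hu n) (hy n).1 ht.1]
    simp [hYn, hceq t ht]
  have hsnd : ∀ t ∈ Icc 0 T, ∀ n, (Yn n t).2 = ∫ s in (0 : ℝ)..t, P.r (y n s) (u n s) :=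
    fun t ht n => by
      rw [← hP.snd_integral_aug (hu n) (hy n).1 ht.1]
      simp [hYn, hceq t ht]
  have hlim1 : ∀ t ∈ Icc 0 T, Tendsto (fun n => y n t) 𝓤 (𝓝 (Y t).1) := fun t ht => by
    have := (continuous_fst.tendsto _).comp (hYt t)
    exact this.congr fun n => hfst t ht n
  have hlim2 : ∀ t ∈ Icc 0 T, Tendsto (fun n => ∫ s in (0 : ℝ)..t, P.r (y n s) (u n s)) 𝓤
      (𝓝 (Y t).2) := fun t ht => by
    have := (continuous_snd.tendsto _).comp (hYt t)
    exact this.congr fun n => hsnd t ht n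
  have hlim3 : ∀ t ∈ Icc 0 T, Tendsto (fun n => ∫ s in (0 : ℝ)..t, P.aug (y n s) (u n s)) 𝓤
      (𝓝 (Y t - Y 0)) := fun t ht => by
    rw [hYx]
    refine ((hYt t).sub_const (x, 0)).congr fun n => ?_
    simp [hYn, hceq t ht]
  have hmem : ∀ᵐ t : ℝ, t ∈ Ioo 0 T → deriv Y t ∈ P.velocities (Y t).1 := by
    filter_upwards [hYlipw.ae_differentiableAt] with t hd ht
    exact hP.hasDerivAt_mem_velocities h0 𝓤 hu hy (hlim1 t ⟨ht.1.le, ht.2.le⟩) hlim3 ht hd.hasDerivAt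
  -- selection of the control
  set φ : ℝ → E m → ℝ := fun t ω =>
    ‖(deriv Y t).1 - P.f (Y t).1 ω‖ + max 0 (P.r (Y t).1 ω - (deriv Y t).2) with hφ
  have hφc : ∀ t, ContinuousOn (φ t) P.U := fun t => by
    have k1 := hP.continuousOn_f.comp (f := fun ω : E m => ((Y t).1, ω)) (s := P.U) (by fun_prop)
      fun ω hω => ⟨mem_univ _, hω⟩
    have k2 := hP.continuousOn_r.comp (f := fun ω : E m => ((Y t).1, ω)) (s := P.U) (by fun_prop)
      fun ω hω => ⟨mem_univ _, hω⟩
    exact (continuousOn_const.sub k1).norm.add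
      (continuousOn_const.sup (k2.sub continuousOn_const))
  have hφm : ∀ ω ∈ P.U, Measurable fun t => φ t ω := fun ω hω => by
    have k1 : Continuous fun t => P.f (Y t).1 ω :=
      hP.continuousOn_f.comp_continuous (f := fun t => ((Y t).1, ω)) (by fun_prop)
        fun t => ⟨mem_univ _, hω⟩
    have k2 : Continuous fun t => P.r (Y t).1 ω :=
      hP.continuousOn_r.comp_continuous (f := fun t => ((Y t).1, ω)) (by fun_prop)
        fun t => ⟨mem_univ _, hω⟩
    have k3 := measurable_deriv Y
    exact ((k3.fst.sub k1.measurable).norm).add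
      (measurable_const.max (k2.measurable.sub k3.snd))
  have hG : MeasurableSet {t | ∃ ω ∈ P.U, φ t ω ≤ 0} :=
    measurableSet_exists_mem_le_zero hP.isCompact hφc hφm
  -- The indicator makes the selection problem solvable at every `t`: where no control realises the
  -- velocity, every control value is accepted. Within `[0, T]` this happens only on a null set.
  obtain ⟨v, hvm, hv⟩ := exists_measurable_selection hP.isCompact
    (φ := fun t ω => {t | ∃ ω ∈ P.U, φ t ω ≤ 0}.indicator (fun t => φ t ω) t)
    (fun t => by
      by_cases ht : t ∈ {t | ∃ ω ∈ P.U, φ t ω ≤ 0}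
      · simpa only [indicator_of_mem ht] using hφc t
      · simpa only [indicator_of_notMem ht] using continuousOn_const)
    (fun ω hω => (hφm ω hω).indicator hG)
    (fun t => by
      by_cases ht : t ∈ {t | ∃ ω ∈ P.U, φ t ω ≤ 0}
      · simp only [indicator_of_mem ht]; exact ht
      · obtain ⟨ω₀, hω₀⟩ := hP.nonempty
        exact ⟨ω₀, hω₀, by simp only [indicator_of_notMem ht]; exact le_rfl⟩)
  have hvad : P.Admissible v := ⟨hvm, fun t _ => (hv t).1⟩
  have hne : ∀ c : ℝ, ∀ᵐ t : ℝ, t ≠ c := fun c => by simp [ae_iff, measure_singleton]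
  have hvel : ∀ᵐ t : ℝ, t ∈ Icc 0 T →
      (deriv Y t).1 = P.f (Y t).1 (v t) ∧ P.r (Y t).1 (v t) ≤ (deriv Y t).2 := by
    filter_upwards [hmem, hne 0, hne T] with t h1 h2 h3 ht
    obtain ⟨ω, hω, e1, e2⟩ := h1 ⟨lt_of_le_of_ne ht.1 (Ne.symm h2), lt_of_le_of_ne ht.2 h3⟩
    have hmemG : t ∈ {t | ∃ ω ∈ P.U, φ t ω ≤ 0} := ⟨ω, hω, by
      simp only [hφ]; rw [e1, sub_self, norm_zero, zero_add]; exact max_le le_rfl (by linarith)⟩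
    have h4 := (hv t).2
    rw [indicator_of_mem hmemG] at h4
    simp only [hφ] at h4
    have h5 := norm_nonneg ((deriv Y t).1 - P.f (Y t).1 (v t))
    have h6 := le_max_left 0 (P.r (Y t).1 (v t) - (deriv Y t).2)
    have h7 := le_max_right 0 (P.r (Y t).1 (v t) - (deriv Y t).2)
    exact ⟨sub_eq_zero.1 (norm_eq_zero.1 (by linarith)), by linarith⟩
  have hdi : ∀ a b, IntervalIntegrable (deriv Y) volume a b := fun a b => by
    refine (intervalIntegrable_const (c := max N B)).mono_fun
      (measurable_deriv Y).aestronglyMeasurable (ae_of_all _ fun t => ?_)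
    rw [Real.norm_of_nonneg (by positivity)]
    exact norm_deriv_le_of_lipschitz hYlipw
  have hftc := fun t => integral_deriv_eq_sub_of_lipschitz hYlipw 0 t
  have hY1 : ∀ t ∈ Icc 0 T, (Y t).1 = x + ∫ s in (0 : ℝ)..t, P.f (Y s).1 (v s) := fun t ht => by
    have h1 : ∫ s in (0 : ℝ)..t, P.f (Y s).1 (v s) = ∫ s in (0 : ℝ)..t, (deriv Y s).1 := by
      refine integral_congr_ae ?_
      filter_upwards [hvel] with s hs hs'
      rw [uIoc_of_le ht.1] at hs'
      exact (hs ⟨hs'.1.le, hs'.2.trans ht.2⟩).1.symm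
    have h2 : (∫ s in (0 : ℝ)..t, deriv Y s).1 = ∫ s in (0 : ℝ)..t, (deriv Y s).1 := by
      rw [integral_of_le ht.1, integral_of_le ht.1]; exact fst_integral (hdi 0 t).1
    rw [h1, ← h2, hftc, hYx]
    simp
  have hY2 : ∀ t ∈ Icc 0 T, (Y t).2 = ∫ s in (0 : ℝ)..t, (deriv Y s).2 := fun t ht => by
    have h2 : (∫ s in (0 : ℝ)..t, deriv Y s).2 = ∫ s in (0 : ℝ)..t, (deriv Y s).2 := by
      rw [integral_of_le ht.1, integral_of_le ht.1]; exact snd_integral (hdi 0 t).1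
    rw [← h2, hftc, hYx]
    simp
  -- The limit arc is constant after `T`, so it need not follow `v` there. The genuine trajectory of
  -- `v` on `[0, ∞)` coincides with it on `[0, T]` by Grönwall.
  obtain ⟨z, hz⟩ := hP.exists_trajectory x hvad
  have hY1c : ContinuousOn (fun t => (Y t).1) (Ici 0) := by fun_prop
  have hzY : ∀ t ∈ Icc 0 T, z t = (Y t).1 := fun t ht => by
    have h := norm_le_mul_exp_of_integral_eq (φ := fun t => z t - (Y t).1) (a := 0) (B := 0) (T := T)
      (h := fun s => P.f (z s) (v s) - P.f (Y s).1 (v s)) hP.L_nonneg le_rfl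
      ((hz.1.sub hY1c).mono Icc_subset_Ici_self)
      (fun s hs => by rw [zero_add]; exact hP.lipschitz_f _ _ _ (hvad.2 s hs.1))
      (fun s hs => by
        rw [hz.2 s hs.1, hY1 s hs, integral_sub (hP.intervalIntegrable_f hvad hz.1 le_rfl hs.1)
          (hP.intervalIntegrable_f hvad hY1c le_rfl hs.1)]
        abel) t ht
    rw [norm_zero, zero_mul, add_zero, zero_mul] at h
    exact sub_eq_zero.1 (norm_le_zero_iff.1 h)
  refine ⟨v, z, hvad, hz, fun t ht => ⟨by rw [hzY t ht]; exact hlim1 t ht, (Y t).2, hlim2 t ht, ?_⟩⟩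
  rw [hY2 t ht]
  refine integral_mono_ae_restrict ht.1 (hP.intervalIntegrable_r hvad hz.1 le_rfl ht.1)
    ⟨(hdi 0 t).1.snd, (hdi 0 t).2.snd⟩ ?_
  filter_upwards [ae_restrict_mem measurableSet_Icc, ae_restrict_of_ae hvel] with s hs hs'
  have hsT : s ∈ Icc 0 T := ⟨hs.1, hs.2.trans ht.2⟩
  rw [hzY s hsT]
  exact (hs' hsT).2

end Problem

end ExitTime

end

/-! ### Exit times, a priori bounds and attainment of the infimum -/

noncomputable section

namespace ExitTime

open MeasureTheory intervalIntegral

variable {d m : ℕ}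

namespace Problem

variable {P : Problem d m} {N r₀ L G τ : ℝ} {x : E d} {u : ℝ → E m} {y : ℝ → E d}

theorem Steers.nonneg (h : P.Steers x u y τ) : 0 ≤ τ := h.2.2.1.1

theorem Steers.mem (h : P.Steers x u y τ) : y τ ∈ P.S := h.2.2.1.2

theorem Steers.notMem (h : P.Steers x u y τ) {t : ℝ} (ht : 0 ≤ t) (htτ : t < τ) : y t ∉ P.S :=
  fun hm => absurd (h.2.2.2 ⟨ht, hm⟩) (not_le.2 htτ)

theorem Steers.pos (h : P.Steers x u y τ) (hx : x ∉ P.S) : 0 < τ := by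
  refine lt_of_le_of_ne h.nonneg fun h0 => hx ?_
  have := h.mem
  rwa [← h0, h.2.1.apply_zero] at this

theorem Steers.mem_frontier (h : P.Steers x u y τ) (hx : x ∉ P.S) : y τ ∈ frontier P.S := by
  rw [frontier_eq_closure_inter_closure]
  refine ⟨subset_closure h.mem, ?_⟩
  have hc : Tendsto y (𝓝[Ico 0 τ] τ) (𝓝 (y τ)) :=
    (h.2.1.1 τ h.nonneg).mono Ico_subset_Ici_self
  have : (𝓝[Ico 0 τ] τ).NeBot := by
    rw [← mem_closure_iff_nhdsWithin_neBot, closure_Ico (h.pos hx).ne]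
    exact ⟨h.nonneg, le_rfl⟩
  exact mem_closure_of_tendsto hc (eventually_nhdsWithin_of_forall fun t ht => h.notMem ht.1 ht.2)

theorem IsTrajectory.exists_steers (hS : IsClosed P.S) (hu : P.Admissible u)
    (hy : P.IsTrajectory x u y) {t : ℝ} (ht : 0 ≤ t) (hyt : y t ∈ P.S) :
    ∃ τ ≤ t, P.Steers x u y τ := by
  have hcl : IsClosed (Icc 0 t ∩ y ⁻¹' P.S) :=
    (hy.1.mono Icc_subset_Ici_self).preimage_isClosed_of_isClosed isClosed_Icc hS
  obtain ⟨τ, hτ⟩ := (isCompact_Icc.of_isClosed_subset hcl inter_subset_left).exists_isLeast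
    ⟨t, ⟨ht, le_rfl⟩, hyt⟩
  refine ⟨τ, hτ.1.1.2, hu, hy, ⟨hτ.1.1.1, hτ.1.2⟩, fun s hs => ?_⟩
  rcases le_total s t with h | h
  · exact hτ.2 ⟨⟨hs.1, h⟩, hs.2⟩
  · exact hτ.1.1.2.trans h

/-- The terminal cost is Lipschitz on the boundary of the target, with a constant compatible with
the running cost. -/
structure TerminalBound (P : Problem d m) (N r₀ G : ℝ) : Prop where
  nonneg : 0 ≤ G
  mul_lt : G * N < r₀
  le : ∀ x ∈ frontier P.S, ∀ y ∈ frontier P.S, |P.g y - P.g x| ≤ G * ‖y - x‖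

theorem Regular.mul_le_integral_r (hP : P.Regular N r₀ L) (hu : P.Admissible u)
    (hy : P.IsTrajectory x u y) {s t : ℝ} (hs : 0 ≤ s) (hst : s ≤ t) :
    r₀ * (t - s) ≤ ∫ v in s..t, P.r (y v) (u v) := by
  have h1 : ∫ _ in s..t, r₀ = r₀ * (t - s) := by
    rw [intervalIntegral.integral_const, smul_eq_mul, mul_comm]
  rw [← h1]
  refine integral_mono_on hst intervalIntegrable_const
    (hP.intervalIntegrable_r hu hy.1 hs (hs.trans hst)) fun v hv => ?_
  exact hP.r₀_le _ _ (hu.2 v (hs.trans hv.1))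

/-- A unit of time costs at least `r₀`, while moving for that time lowers the terminal cost by at
most `G N`; thus the cost controls the exit time. -/
theorem Regular.exit_time_le (hP : P.Regular N r₀ L) (hG : P.TerminalBound N r₀ G) (hx : x ∉ P.S)
    (h : P.Steers x u y τ) {z : E d} (hz : z ∈ frontier P.S) :
    (r₀ - G * N) * τ ≤ P.cost u y τ - P.g z + G * ‖x - z‖ := by
  have h1 := hP.mul_le_integral_r h.1 h.2.1 le_rfl h.nonneg
  have h2 := hG.le z hz _ (h.mem_frontier hx)
  have h3 := hP.norm_trajectory_sub_le h.1 h.2.1 le_rfl h.nonneg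
  rw [h.2.1.apply_zero, sub_zero, abs_of_nonneg h.nonneg] at h3
  have h4 : ‖y τ - z‖ ≤ N * τ + ‖x - z‖ := by
    have : y τ - z = (y τ - x) + (x - z) := by abel
    rw [this]; exact (norm_add_le _ _).trans (by linarith)
  have h5 := mul_le_mul_of_nonneg_left h4 hG.nonneg
  have h6 := (abs_le.1 h2).1
  rw [sub_zero] at h1
  unfold cost
  linarith

theorem Regular.bddBelow_costs (hP : P.Regular N r₀ L) (hG : P.TerminalBound N r₀ G)
    (hx : x ∉ P.S) : BddBelow {c | ∃ u y τ, P.Steers x u y τ ∧ c = P.cost u y τ} := by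
  by_cases hz : (frontier P.S).Nonempty
  · obtain ⟨z, hz⟩ := hz
    refine ⟨P.g z - G * ‖x - z‖, ?_⟩
    rintro c ⟨u, y, τ, h, rfl⟩
    have h1 := hP.exit_time_le hG hx h hz
    have h2 : 0 ≤ (r₀ - G * N) * τ := mul_nonneg (by linarith [hG.mul_lt]) h.nonneg
    linarith
  -- If the boundary is empty, no point outside `S` can be steered to it; the set of costs is empty
  -- and any bound works.
  · refine ⟨0, ?_⟩
    rintro c ⟨u, y, τ, h, rfl⟩
    exact absurd ⟨_, h.mem_frontier hx⟩ hz

theorem Regular.V_le_cost (hP : P.Regular N r₀ L) (hG : P.TerminalBound N r₀ G) (hx : x ∉ P.S)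
    (h : P.Steers x u y τ) : P.V x ≤ P.cost u y τ :=
  csInf_le (hP.bddBelow_costs hG hx) ⟨u, y, τ, h, rfl⟩

theorem Regular.exists_isOptimal (hP : P.Regular N r₀ L) (h0 : P.H0) (hS : IsClosed P.S)
    (hG : P.TerminalBound N r₀ G) (hx : x ∈ P.R \ P.S) : ∃ u y τ, P.IsOptimal x u y τ := by
  obtain ⟨⟨u₀, y₀, τ₀, hs₀⟩, hxS⟩ := hx
  have hN := hP.N_pos
  have hη : 0 < r₀ - G * N := by linarith [hG.mul_lt]
  obtain ⟨c, hcanti, hclim, hc⟩ := exists_seq_tendsto_sInf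
    (S := {c | ∃ u y τ, P.Steers x u y τ ∧ c = P.cost u y τ}) ⟨_, u₀, y₀, τ₀, hs₀, rfl⟩
    (hP.bddBelow_costs hG hxS)
  choose u y τ hs hcost using hc
  set z₀ := y₀ τ₀
  have hz₀ : z₀ ∈ frontier P.S := hs₀.mem_frontier hxS
  -- The minimising sequence is antitone, so `c 0` bounds all costs and `exit_time_le` gives a
  -- common horizon.
  set T := (c 0 - P.g z₀ + G * ‖x - z₀‖) / (r₀ - G * N) with hTdef
  have hτT : ∀ n, τ n ∈ Icc 0 T := fun n => by
    refine ⟨(hs n).nonneg, (le_div_iff₀ hη).2 ?_⟩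
    have h1 := hP.exit_time_le hG hxS (hs n) hz₀
    have h2 := hcanti (Nat.zero_le n)
    rw [← hcost n] at h1
    linarith
  have hT : 0 ≤ T := (hτT 0).1.trans (hτT 0).2
  set 𝓤 := Filter.hyperfilter ℕ
  have h𝓤 : (𝓤 : Filter ℕ) ≤ atTop := Nat.hyperfilter_le_atTop
  obtain ⟨σ, hσT, hσ⟩ := (isCompact_Icc (a := (0 : ℝ)) (b := T)).ultrafilter_le_nhds'
    (𝓤.map τ) (Ultrafilter.mem_map.2 (Filter.univ_mem' hτT))
  replace hσ : Tendsto τ 𝓤 (𝓝 σ) := hσ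
  obtain ⟨v, z, hv, hz, hlim⟩ := hP.exists_limit_trajectory h0 𝓤 (fun n => (hs n).1)
    (fun n => (hs n).2.1) hT
  obtain ⟨hlimσ, ℓ, hℓ, hℓle⟩ := hlim σ hσT
  have hσ0 : Tendsto (fun n => |τ n - σ|) 𝓤 (𝓝 0) := by
    simpa using (tendsto_iff_norm_sub_tendsto_zero.1 hσ)
  have hyτ : Tendsto (fun n => y n (τ n)) 𝓤 (𝓝 (z σ)) := by
    have h1 : Tendsto (fun n => y n (τ n) - y n σ) 𝓤 (𝓝 0) := by
      refine squeeze_zero_norm (a := fun n => N * |τ n - σ|) (fun n =>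
        hP.norm_trajectory_sub_le (hs n).1 (hs n).2.1 hσT.1 (hτT n).1) ?_
      simpa using hσ0.const_mul N
    simpa using h1.add hlimσ
  have hzfr : z σ ∈ frontier P.S := isClosed_frontier.mem_of_tendsto hyτ
    (Filter.Eventually.of_forall fun n => (hs n).mem_frontier hxS)
  have hzS : z σ ∈ P.S := hS.frontier_subset hzfr
  obtain ⟨τ', hτ'σ, hsz⟩ := hz.exists_steers hS hv hσT.1 hzS
  have hg : Tendsto (fun n => P.g (y n (τ n))) 𝓤 (𝓝 (P.g (z σ))) := by
    rw [tendsto_iff_norm_sub_tendsto_zero]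
    refine squeeze_zero (fun n => norm_nonneg _) (fun n => hG.le _ hzfr _ ((hs n).mem_frontier hxS)) ?_
    simpa using (tendsto_iff_norm_sub_tendsto_zero.1 hyτ).const_mul G
  obtain ⟨B, hB0, hB⟩ := hP.exists_r_bound x T
  have hr : Tendsto (fun n => ∫ s in (0 : ℝ)..(τ n), P.r (y n s) (u n s)) 𝓤 (𝓝 ℓ) := by
    have h1 : Tendsto (fun n => (∫ s in (0 : ℝ)..(τ n), P.r (y n s) (u n s))
        - ∫ s in (0 : ℝ)..σ, P.r (y n s) (u n s)) 𝓤 (𝓝 0) := by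
      refine squeeze_zero_norm (a := fun n => B * |τ n - σ|) (fun n =>
        norm_integral_sub_le (fun s hs' => hB _ _ (hs n).1 (hs n).2.1 s hs')
          (hP.intervalIntegrable_r (hs n).1 (hs n).2.1.1 le_rfl hT) hσT (hτT n)) ?_
      simpa using hσ0.const_mul B
    simpa using h1.add hℓ
  have hVlim : ℓ + P.g (z σ) = P.V x := by
    refine tendsto_nhds_unique (hr.add hg) ?_
    refine (hclim.mono_left h𝓤).congr fun n => ?_
    rw [hcost n]; rfl
  -- The limit trajectory may enter `S` at some `τ' < σ`. This does no harm: continuing to `σ` costs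
  -- at least `r₀ (σ - τ')`, and the terminal cost changes by at most `G N (σ - τ')`.
  refine ⟨v, z, τ', hsz, le_antisymm ?_ (hP.V_le_cost hG hxS hsz)⟩
  have h1 := hP.mul_le_integral_r hv hz hsz.nonneg hτ'σ
  have h2 := integral_add_adjacent_intervals
    (hP.intervalIntegrable_r hv hz.1 le_rfl hsz.nonneg)
    (hP.intervalIntegrable_r hv hz.1 hsz.nonneg hσT.1)
  have h3 := hG.le _ hzfr _ (hsz.mem_frontier hxS)
  have h4 := hP.norm_trajectory_sub_le hv hz hσT.1 hsz.nonneg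
  rw [abs_sub_comm, abs_of_nonneg (by linarith : 0 ≤ σ - τ')] at h4
  have h5 := mul_le_mul_of_nonneg_left h4 hG.nonneg
  have h6 : 0 ≤ (r₀ - G * N) * (σ - τ') := mul_nonneg hη.le (by linarith)
  have h7 := (abs_le.1 h3).2
  unfold cost
  rw [← hVlim]
  linarith

end Problem

end ExitTime

end

noncomputable section

namespace ExitTime

variable {d : ℕ} {g : E d → ℝ} {z : E d}

/-! ### Superdifferentials of semiconcave functions -/

theorem norm_convexComb_sq {F : Type*} [NormedAddCommGroup F] [InnerProductSpace ℝ F] (a b : F)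
    (l : ℝ) : (1 - l) * ‖a‖ ^ 2 + l * ‖b‖ ^ 2 - ‖(1 - l) • a + l • b‖ ^ 2
      = l * (1 - l) * ‖a - b‖ ^ 2 := by
  rw [norm_add_sq_real, norm_sub_sq_real, norm_smul, norm_smul, inner_smul_left, inner_smul_right,
    mul_pow, mul_pow, Real.norm_eq_abs, Real.norm_eq_abs, sq_abs, sq_abs]
  simp only [RCLike.conj_to_real]
  ring

/-- Subtracting `c ‖x - z‖²` makes `g` concave near `z`. A hyperplane separating `(z, g z)` from the
open strict hypograph is not vertical, and its slope is a supergradient because the subtracted term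
is `o(‖x - z‖)`. -/
theorem LocallySemiconcave.superdiff_nonempty (hg : LocallySemiconcave g) (z : E d) :
    (superdiff g z).Nonempty := by
  obtain ⟨δ, hδ, c, hc, h⟩ := hg z
  set k : E d → ℝ := fun x => g x - c * ‖x - z‖ ^ 2 with hk
  have hconc : ConcaveOn ℝ (Metric.ball z δ) k := by
    refine ⟨convex_ball z δ, fun x hx y hy a b ha hb hab => ?_⟩
    have ha' : a = 1 - b := by linarith
    subst ha'
    have h1 := h x hx y hy b ⟨hb, by linarith⟩
    have h2 := norm_convexComb_sq (x - z) (y - z) b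
    have h3 : (1 - b) • (x - z) + b • (y - z) = (1 - b) • x + b • y - z := by module
    rw [h3, sub_sub_sub_cancel_right] at h2
    simp only [hk, smul_eq_mul]
    have h4 : c * ((1 - b) * ‖x - z‖ ^ 2 + b * ‖y - z‖ ^ 2 - ‖(1 - b) • x + b • y - z‖ ^ 2)
      = c * (b * (1 - b)) * ‖x - y‖ ^ 2 := by rw [h2]; ring
    nlinarith
  have hcont : ContinuousOn k (Metric.ball z δ) := hconc.continuousOn Metric.isOpen_ball
  set A : Set (E d × ℝ) := {q | q.1 ∈ Metric.ball z δ ∧ q.2 < k q.1} with hA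
  have hAo : IsOpen A := by
    have h1 : ContinuousOn (fun q : E d × ℝ => k q.1 - q.2) (Metric.ball z δ ×ˢ univ) :=
      (hcont.comp continuousOn_fst fun q hq => hq.1).sub continuousOn_snd
    have h2 := h1.isOpen_inter_preimage (Metric.isOpen_ball.prod isOpen_univ) isOpen_Ioi (t := Ioi 0)
    convert h2 using 1
    ext q
    simp [hA]
  have hAc : Convex ℝ A := by
    intro p hp q hq a b ha hb hab
    refine ⟨hconc.1 hp.1 hq.1 ha hb hab, ?_⟩
    have h1 := hconc.2 hp.1 hq.1 ha hb hab
    have hp2 := hp.2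
    have hq2 := hq.2
    simp only [Prod.snd_add, Prod.smul_snd, Prod.fst_add, Prod.smul_fst, smul_eq_mul] at h1 ⊢
    refine lt_of_lt_of_le ?_ h1
    rcases ha.eq_or_lt with rfl | ha'
    · have : b = 1 := by linarith
      subst this; linarith
    · have := mul_lt_mul_of_pos_left hp2 ha'
      have := mul_le_mul_of_nonneg_left hq2.le hb
      linarith
  obtain ⟨F, hF⟩ := geometric_hahn_banach_open_point (x := (z, k z)) hAc hAo fun hmem =>
    lt_irrefl _ hmem.2
  set α : ℝ := F (0, 1) with hα
  have hsplit : ∀ x t, F (x, t) = F (x, 0) + α * t := fun x t => by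
    have : ((x, t) : E d × ℝ) = (x, 0) + t • (0, 1) := by ext <;> simp
    rw [this, map_add, map_smul, smul_eq_mul, mul_comm]
  have hαpos : 0 < α := by
    have := hF (z, k z - 1) ⟨Metric.mem_ball_self hδ, by simp⟩
    rw [hsplit, hsplit z (k z)] at this
    linarith
  set φ : E d →L[ℝ] ℝ := F.comp (ContinuousLinearMap.inl ℝ (E d) ℝ) with hφ
  have hφF : ∀ x, F (x, 0) = φ x := fun x => rfl
  set p : E d := (InnerProductSpace.toDual ℝ (E d)).symm φ with hp
  have hpφ : ∀ x, inner ℝ p x = φ x := fun x => by simp [hp]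
  have hkey : ∀ x ∈ Metric.ball z δ, g x - g z - inner ℝ (-(α⁻¹ • p)) (x - z) ≤ c * ‖x - z‖ ^ 2 := by
    intro x hx
    have h1 : φ x + α * k x ≤ φ z + α * k z := by
      refine le_of_forall_pos_le_add fun ε hε => ?_
      have := hF (x, k x - ε / α) ⟨hx, by simp; positivity⟩
      rw [hsplit, hsplit z, hφF, hφF, mul_sub, mul_div_cancel₀ _ hαpos.ne'] at this
      linarith
    rw [inner_neg_left, inner_smul_left, hpφ, map_sub]
    simp only [hk, sub_self, norm_zero] at h1
    have h2 : α * (g x - g z - c * ‖x - z‖ ^ 2) ≤ φ z - φ x := by nlinarith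
    rw [← le_div_iff₀' hαpos, div_eq_inv_mul] at h2
    simp only [RCLike.conj_to_real]
    nlinarith
  refine ⟨-(α⁻¹ • p), fun ε hε => ?_⟩
  have hmin : 0 < min δ (ε / c) := by positivity
  filter_upwards [Metric.ball_mem_nhds z hmin] with x hx
  rw [mem_ball_iff_norm] at hx
  refine (hkey x (by rw [mem_ball_iff_norm]; exact hx.trans_le (min_le_left _ _))).trans ?_
  have h1 : ‖x - z‖ * c ≤ ε := by
    rw [← le_div_iff₀ hc]; exact hx.le.trans (min_le_right _ _)
  rw [pow_two, ← mul_assoc, mul_comm c]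
  gcongr

/-- The defining limsup inequality along a segment. -/
theorem exists_segment_le_of_mem_superdiff {q : E d} (hq : q ∈ superdiff g z) (v : E d) {ε : ℝ}
    (hε : 0 < ε) {η : ℝ} (hη : 0 < η) :
    ∃ l ∈ Ioo 0 η, g (z + l • v) - g z ≤ l * inner ℝ q v + ε * (l * ‖v‖) := by
  have hc : Tendsto (fun l : ℝ => z + l • v) (𝓝[>] 0) (𝓝 z) := by
    have : Tendsto (fun l : ℝ => z + l • v) (𝓝 0) (𝓝 (z + (0 : ℝ) • v)) :=
      Continuous.tendsto (by fun_prop) 0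
    rw [zero_smul, add_zero] at this
    exact this.mono_left nhdsWithin_le_nhds
  obtain ⟨l, hl, hlη⟩ := ((hc.eventually (hq ε hε)).and (Ioo_mem_nhdsGT hη)).exists
  refine ⟨l, hlη, ?_⟩
  rw [add_sub_cancel_left, inner_smul_right, norm_smul, Real.norm_of_nonneg hlη.1.le] at hl
  linarith

/-- Along `-q` the supergradient forces a decrease of about `l ‖q‖²`, while the Lipschitz bound
allows at most `G l ‖q‖`. -/
theorem norm_le_of_mem_superdiff {𝒩 : Set (E d)} (h𝒩 : IsOpen 𝒩) {G : ℝ}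
    (hG0 : 0 ≤ G) (hG : ∀ x ∈ 𝒩, ∀ y ∈ 𝒩, |g y - g x| ≤ G * ‖y - x‖) (hz : z ∈ 𝒩) {q : E d}
    (hq : q ∈ superdiff g z) : ‖q‖ ≤ G := by
  obtain ⟨δ, hδ, hball⟩ := Metric.isOpen_iff.1 h𝒩 z hz
  refine le_of_forall_pos_le_add fun ε hε => ?_
  rcases eq_or_ne q 0 with rfl | hq0
  · rw [norm_zero]; linarith
  have hqp : 0 < ‖q‖ := norm_pos_iff.2 hq0
  obtain ⟨l, hl, hle⟩ := exists_segment_le_of_mem_superdiff hq (-q) hε (η := δ / ‖q‖) (by positivity)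
  have hlq : l * ‖q‖ < δ := (lt_div_iff₀ hqp).1 hl.2
  have h1 := hG z hz (z + l • -q) (hball (by
    rw [mem_ball_iff_norm, add_sub_cancel_left, norm_smul, norm_neg, Real.norm_of_nonneg hl.1.le]
    exact hlq))
  rw [add_sub_cancel_left, norm_smul, norm_neg, Real.norm_of_nonneg hl.1.le] at h1
  rw [inner_neg_right, real_inner_self_eq_norm_sq, norm_neg] at hle
  have h2 := (abs_le.1 h1).1
  have h3 : l * ‖q‖ * ‖q‖ ≤ l * ‖q‖ * (G + ε) := by nlinarith
  exact le_of_mul_le_mul_left h3 (by have := hl.1; positivity)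

/-- Semiconcavity bounds the increment over the whole segment by the rescaled increment over a short
initial piece, which the supergradient controls. -/
theorem le_of_mem_superdiff_of_semiconcave {B : Set (E d)} {c : ℝ}
    (hc : 0 ≤ c)
    (h : ∀ x₀ ∈ B, ∀ x₁ ∈ B, ∀ l ∈ Icc (0 : ℝ) 1,
      (1 - l) * g x₀ + l * g x₁ - g ((1 - l) • x₀ + l • x₁) ≤ c * (l * (1 - l)) * ‖x₀ - x₁‖ ^ 2)
    (hz : z ∈ B) {w : E d} (hw : w ∈ B) {q : E d} (hq : q ∈ superdiff g z) :
    g w - g z ≤ inner ℝ q (w - z) + c * ‖w - z‖ ^ 2 := by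
  refine le_of_forall_pos_le_add fun ε hε => ?_
  have hε' : 0 < ε / (‖w - z‖ + 1) := by positivity
  obtain ⟨l, hl, hle⟩ := exists_segment_le_of_mem_superdiff hq (w - z) hε' (η := 1) one_pos
  have h1 := h z hz w hw l ⟨hl.1.le, hl.2.le⟩
  have h2 : (1 - l) • z + l • w = z + l • (w - z) := by module
  rw [h2, norm_sub_rev] at h1
  have h3 : ε / (‖w - z‖ + 1) * ‖w - z‖ ≤ ε := by
    rw [div_mul_eq_mul_div, div_le_iff₀ (by positivity)]
    nlinarith
  have h4 : l * (g w - g z) ≤ l * (inner ℝ q (w - z) + c * ‖w - z‖ ^ 2 + ε) := by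
    have h5 : c * (l * (1 - l)) * ‖w - z‖ ^ 2 ≤ l * (c * ‖w - z‖ ^ 2) := by
      have h6 : 0 ≤ c * ‖w - z‖ ^ 2 * (l * l) := mul_nonneg (by positivity) (mul_self_nonneg l)
      linarith
    have h7 := mul_le_mul_of_nonneg_left h3 hl.1.le
    linarith
  exact le_of_mul_le_mul_left h4 hl.1

/-- A quadratic upper bound at all superdifferentials, uniform over bounded parts of a set on which
`g` is Lipschitz. -/
theorem LocallySemiconcave.exists_quadratic_bound (hg : LocallySemiconcave g) {Z : Set (E d)}
    {G : ℝ} (hG : ∀ x ∈ Z, ∀ y ∈ Z, |g y - g x| ≤ G * ‖y - x‖)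
    (hq : ∀ z ∈ Z, ∀ q ∈ superdiff g z, ‖q‖ ≤ G) (M : ℝ) :
    ∃ C, 0 ≤ C ∧ ∀ z ∈ Z, ‖z‖ ≤ M → ∀ w ∈ Z, ∀ q ∈ superdiff g z,
      g w - g z ≤ inner ℝ q (w - z) + C * ‖w - z‖ ^ 2 := by
  have key : ∃ C, 0 ≤ C ∧ ∀ z ∈ Z, z ∈ Metric.closedBall (0 : E d) M → ∀ w ∈ Z,
      ∀ q ∈ superdiff g z, g w - g z ≤ inner ℝ q (w - z) + C * ‖w - z‖ ^ 2 := by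
    refine (isCompact_closedBall (0 : E d) M).induction_on (p := fun s => ∃ C, 0 ≤ C ∧ ∀ z ∈ Z,
      z ∈ s → ∀ w ∈ Z, ∀ q ∈ superdiff g z, g w - g z ≤ inner ℝ q (w - z) + C * ‖w - z‖ ^ 2)
      ⟨0, le_rfl, by simp⟩ ?_ ?_ ?_
    · rintro s t hst ⟨C, hC, h⟩
      exact ⟨C, hC, fun z hz hzs => h z hz (hst hzs)⟩
    · rintro s t ⟨C, hC, h⟩ ⟨C', hC', h'⟩
      refine ⟨C + C', by positivity, fun z hz hzs w hw q hq => ?_⟩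
      have h0 : 0 ≤ C * ‖w - z‖ ^ 2 := by positivity
      have h1 : 0 ≤ C' * ‖w - z‖ ^ 2 := by positivity
      rcases hzs with hzs | hzs
      · have := h z hz hzs w hw q hq; linarith
      · have := h' z hz hzs w hw q hq; linarith
    · intro x _
      obtain ⟨δ, hδ, c, hc, h⟩ := hg x
      refine ⟨Metric.ball x (δ / 2), mem_nhdsWithin_of_mem_nhds (Metric.ball_mem_nhds x (by positivity)),
        c + 4 * |G| / δ, by positivity, fun z hz hzb w hw q hqz => ?_⟩
      have hzb' : z ∈ Metric.ball x δ := Metric.ball_subset_ball (by linarith) hzb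
      have e1 : 0 ≤ 4 * |G| / δ * ‖w - z‖ ^ 2 := by positivity
      have e2 : 0 ≤ c * ‖w - z‖ ^ 2 := by positivity
      rcases lt_or_ge ‖w - z‖ (δ / 2) with hlt | hge
      · have hwb : w ∈ Metric.ball x δ := by
          rw [mem_ball_iff_norm] at hzb ⊢
          have : w - x = (w - z) + (z - x) := by abel
          rw [this]
          exact (norm_add_le _ _).trans_lt (by linarith)
        have := le_of_mem_superdiff_of_semiconcave hc.le h hzb' hwb hqz
        linarith
      -- Far from `z` both sides are crudely linear in `‖w - z‖`, and `‖w - z‖ ≥ δ / 2` turns linear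
      -- into quadratic.
      · have h1 := (abs_le.1 (hG z hz w hw)).2
        have h2 := (abs_le.1 (abs_real_inner_le_norm q (w - z))).1
        have h3 := mul_le_mul_of_nonneg_right (hq z hz q hqz) (norm_nonneg (w - z))
        have h4 : G * ‖w - z‖ ≤ |G| * ‖w - z‖ :=
          mul_le_mul_of_nonneg_right (le_abs_self G) (norm_nonneg _)
        have h5 : 2 * |G| * ‖w - z‖ ≤ 4 * |G| / δ * ‖w - z‖ ^ 2 := by
          rw [div_mul_eq_mul_div, le_div_iff₀ hδ]
          have h6 : 0 ≤ |G| * ‖w - z‖ := by positivity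
          nlinarith
        linarith
  obtain ⟨C, hC, h⟩ := key
  exact ⟨C, hC, fun z hz hzM => h z hz (by simpa using hzM)⟩

namespace Problem

variable {m : ℕ} {P : Problem d m} {N r₀ : ℝ}

theorem H3.exists_terminalBound (h3 : P.H3 N r₀) (hN : 0 < N) : ∃ G, P.TerminalBound N r₀ G ∧
    ∀ z ∈ frontier P.S, ∀ q ∈ superdiff P.g z, ‖q‖ ≤ G := by
  obtain ⟨𝒩, h𝒩, hsub, G, hG0, hGlt, hG⟩ := h3
  exact ⟨G, ⟨hG0, (lt_div_iff₀ hN).1 hGlt, fun x hx y hy => hG x (hsub hx) y (hsub hy)⟩,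
    fun z hz q hq => norm_le_of_mem_superdiff h𝒩 hG0 hG (hsub hz) hq⟩

end Problem

end ExitTime

end

noncomputable section

namespace ExitTime

open MeasureTheory intervalIntegral

variable {d m : ℕ}

/-! ### The second order upper estimate for the value function -/

namespace Problem

variable {P : Problem d m} {N r₀ L G τ θ lam a : ℝ} {x x' z ξ q v : E d} {u u' : ℝ → E m}
  {y y' p : ℝ → E d} {ω : E m}

theorem Regular.hamiltonian_integrand_le (hP : P.Regular N r₀ L) (hω : ω ∈ P.U) (lam : ℝ)
    (v x z : E d) : lam * P.r x ω - inner ℝ v (P.f x ω)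
      ≤ lam * P.r z ω - inner ℝ v (P.f z ω) + (|lam| + ‖v‖) * L * ‖x - z‖ := by
  have h1 : lam * (P.r x ω - P.r z ω) ≤ |lam| * (L * ‖x - z‖) := by
    refine (le_abs_self _).trans ?_
    rw [abs_mul]
    exact mul_le_mul_of_nonneg_left (hP.lipschitz_r z x ω hω) (abs_nonneg _)
  have h2 : -inner ℝ v (P.f x ω - P.f z ω) ≤ ‖v‖ * (L * ‖x - z‖) := by
    refine (neg_le_abs _).trans ((abs_real_inner_le_norm _ _).trans ?_)
    exact mul_le_mul_of_nonneg_left (hP.lipschitz_f z x ω hω) (norm_nonneg _)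
  rw [inner_sub_right] at h2
  linarith

theorem Regular.integral_sub_inner_le (hP : P.Regular N r₀ L) (hu : P.Admissible u)
    (hy : P.IsTrajectory x u y) {s t c : ℝ} (hs : 0 ≤ s) (hst : s ≤ t)
    (h : ∀ σ ∈ Ioc s t, lam * P.r (y σ) (u σ) - inner ℝ v (P.f (y σ) (u σ)) ≤ c) :
    lam * (∫ σ in s..t, P.r (y σ) (u σ)) - inner ℝ v (y t - y s) ≤ c * (t - s) := by
  have ht := hs.trans hst
  have hf := hP.intervalIntegrable_f hu hy.1 hs ht
  have hr := (hP.intervalIntegrable_r hu hy.1 hs ht).const_mul lam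
  have hvf : IntervalIntegrable (fun σ => inner ℝ v (P.f (y σ) (u σ))) volume s t :=
    ⟨hf.1.const_inner v, hf.2.const_inner v⟩
  have h1 : inner ℝ v (y t - y s) = ∫ σ in s..t, inner ℝ v (P.f (y σ) (u σ)) := by
    rw [hP.trajectory_sub hu hy hs ht]
    exact ((innerSL ℝ v).intervalIntegral_comp_comm hf).symm
  rw [h1, ← intervalIntegral.integral_const_mul, ← integral_sub hr hvf]
  have h2 : ∫ _ in s..t, c = c * (t - s) := by
    rw [intervalIntegral.integral_const, smul_eq_mul, mul_comm]
  rw [← h2, integral_of_le hst, integral_of_le hst]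
  exact setIntegral_mono_on (hr.sub hvf).1 (intervalIntegrable_const (μ := volume) (a := s) (b := t)).1
    measurableSet_Ioc h

/-- The running cost between `τ` and a nearby time `θ`, under the maximum condition at `z`. -/
theorem Regular.integral_cost_le (hP : P.Regular N r₀ L) (hu' : P.Admissible u')
    (hy' : P.IsTrajectory x' u' y') (hτ : 0 ≤ τ) (hθ : 0 ≤ θ) (hlam : 0 ≤ lam)
    (hmax : ∀ ω ∈ P.U, inner ℝ v (P.f z ω) ≤ lam * P.r z ω)
    (hω : lam * P.r z ω ≤ inner ℝ v (P.f z ω)) (hu'ω : ∀ t, τ < t → u' t = ω)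
    (ha : ‖y' τ - z‖ ≤ a) :
    lam * (∫ s in τ..θ, P.r (y' s) (u' s)) - inner ℝ v (y' θ - y' τ)
      ≤ (lam + ‖v‖) * L * (a + N * |θ - τ|) * |θ - τ| := by
  have hN := hP.N_pos
  have hL := hP.L_nonneg
  have hdist : ∀ s, 0 ≤ s → |s - τ| ≤ |θ - τ| → ‖y' s - z‖ ≤ a + N * |θ - τ| := fun s hs hsθ => by
    have h1 := hP.norm_trajectory_sub_le hu' hy' hτ hs
    have h2 : y' s - z = (y' s - y' τ) + (y' τ - z) := by abel
    rw [h2]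
    refine (norm_add_le _ _).trans ?_
    have := mul_le_mul_of_nonneg_left hsθ hN.le
    linarith
  -- After `τ` the control is `ω`, which attains the maximum. When `θ < τ` the interval is traversed
  -- backwards, and the inequality valid for all control values has the required sign.
  rcases le_total τ θ with hle | hle
  · rw [abs_of_nonneg (sub_nonneg.2 hle)] at hdist ⊢
    refine hP.integral_sub_inner_le hu' hy' hτ hle fun s hs => ?_
    have hs0 := hτ.trans hs.1.le
    refine (hP.hamiltonian_integrand_le (hu'.2 s hs0) lam v _ z).trans ?_
    rw [hu'ω s hs.1, abs_of_nonneg hlam]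
    have h1 := hdist s hs0 (by rw [abs_of_nonneg (by linarith [hs.1])]; linarith [hs.2])
    have h2 := mul_le_mul_of_nonneg_left h1
      (by positivity : 0 ≤ (lam + ‖v‖) * L)
    linarith
  · rw [abs_sub_comm, abs_of_nonneg (sub_nonneg.2 hle)] at hdist ⊢
    have h := hP.integral_sub_inner_le (lam := -lam) (v := -v) hu' hy' hθ hle
      (c := (lam + ‖v‖) * L * (a + N * (τ - θ))) fun s hs => by
        have hs0 := hθ.trans hs.1.le
        refine (hP.hamiltonian_integrand_le (hu'.2 s hs0) (-lam) (-v) _ z).trans ?_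
        have h1 := hdist s hs0 (by rw [abs_sub_comm, abs_of_nonneg (by linarith [hs.2])]; linarith [hs.1])
        rw [abs_neg, abs_of_nonneg hlam, norm_neg, inner_neg_left]
        have h2 := mul_le_mul_of_nonneg_left h1
          (by positivity : 0 ≤ (lam + ‖v‖) * L)
        have := hmax _ (hu'.2 s hs0)
        linarith
    rw [inner_neg_left, ← neg_sub (y' θ), inner_neg_right, integral_symm] at h
    linarith

/-- The cost of the perturbed trajectory compared with the optimal one. -/
theorem Regular.cost_sub_V_eq (hP : P.Regular N r₀ L) (hopt : P.IsOptimal x u y τ)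
    (hs : P.Steers x' u' y' θ) (huu : ∀ t ∈ Icc 0 τ, u' t = u t) :
    P.cost u' y' θ - P.V x = (∫ s in (0 : ℝ)..τ, (P.r (y' s) (u s) - P.r (y s) (u s)))
      + (∫ s in τ..θ, P.r (y' s) (u' s)) + (P.g (y' θ) - P.g (y τ)) := by
  have hτ := hopt.1.nonneg
  have h1 : ∫ s in (0 : ℝ)..τ, P.r (y' s) (u s) = ∫ s in (0 : ℝ)..τ, P.r (y' s) (u' s) := by
    refine integral_congr fun s hs => ?_
    rw [uIcc_of_le hτ] at hs
    simp only [huu s hs]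
  rw [integral_sub (hP.intervalIntegrable_r hopt.1.1 hs.2.1.1 le_rfl hτ)
    (hP.intervalIntegrable_r hopt.1.1 hopt.1.2.1.1 le_rfl hτ), h1, ← hopt.2]
  have h2 := integral_add_adjacent_intervals
    (hP.intervalIntegrable_r hs.1 hs.2.1.1 le_rfl hτ)
    (hP.intervalIntegrable_r hs.1 hs.2.1.1 hτ hs.nonneg)
  unfold cost
  linarith

theorem Regular.abs_integral_r_sub_le (hP : P.Regular N r₀ L) (hu : P.Admissible u) (hτ : 0 ≤ τ)
    (ha : ∀ t ∈ Icc 0 τ, ‖y' t - y t‖ ≤ a) :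
    |∫ s in (0 : ℝ)..τ, (P.r (y' s) (u s) - P.r (y s) (u s))| ≤ L * a * τ := by
  have := norm_integral_le_of_norm_le_const (a := 0) (b := τ) (C := L * a)
    (f := fun s => P.r (y' s) (u s) - P.r (y s) (u s)) fun s hs => by
      rw [uIoc_of_le hτ] at hs
      refine (hP.lipschitz_r _ _ _ (hu.2 s hs.1.le)).trans ?_
      exact mul_le_mul_of_nonneg_left (ha s ⟨hs.1.le, hs.2⟩) hP.L_nonneg
  rwa [sub_zero, abs_of_nonneg hτ] at this

/-- The multipliers of an optimal trajectory ending at `z`, with normal `ξ`, terminal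
supergradient `q` and cost multiplier `lam`, all quantities bounded by `M`. -/
structure IsMultiplier (P : Problem d m) (M : ℝ) (z ξ q : E d) (lam : ℝ) : Prop where
  norm_le : ‖ξ‖ ≤ M
  nonneg : 0 ≤ lam
  le : lam ≤ M
  mem_superdiff : q ∈ superdiff P.g z
  normal : ∀ w ∈ closure P.Sᶜ, inner ℝ ξ (w - z) ≤ M * ‖w - z‖ ^ 2
  max_le : ∀ ω ∈ P.U, inner ℝ (ξ - lam • q) (P.f z ω) ≤ lam * P.r z ω
  exists_ge : ∃ ω ∈ P.U, lam * P.r z ω ≤ inner ℝ (ξ - lam • q) (P.f z ω)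

/-- The exit point lies on the boundary, so the normal inequality for `ξ` and the quadratic bound
for `g` both apply there. Together with duality up to `τ` and the maximum condition between `τ` and
`θ`, the first order terms combine through `h9` and only squares remain. -/
theorem Regular.supergradient_le_of_exit (hP : P.Regular N r₀ L) {M Cg B D : ℝ}
    (hCg : 0 ≤ Cg) (hD : 0 ≤ D) (hopt : P.IsOptimal x u y τ) (hs : P.Steers x' u' y' θ)
    (hx' : x' ∉ P.S) (huu : ∀ t ∈ Icc 0 τ, u' t = u t) (hu'ω : ∀ t, τ < t → u' t = ω)
    (hmul : P.IsMultiplier M (y τ) ξ q lam)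
    (hω : lam * P.r (y τ) ω ≤ inner ℝ (ξ - lam • q) (P.f (y τ) ω))
    (hg : P.g (y' θ) - P.g (y τ) ≤ inner ℝ q (y' θ - y τ) + Cg * ‖y' θ - y τ‖ ^ 2)
    (hB : ‖ξ - lam • q‖ ≤ B) (ha0 : 0 ≤ a) (ha : ‖y' τ - y τ‖ ≤ a)
    (hexp : -inner ℝ (p 0) (x' - x) ≤ inner ℝ (ξ - lam • q) (y' τ - y τ)
      - lam * (∫ s in (0 : ℝ)..τ, (P.r (y' s) (u s) - P.r (y s) (u s))) + D * a ^ 2)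
    {β : ℝ} (hβ : β ≤ P.cost u' y' θ) :
    -inner ℝ (p 0) (x' - x) + lam * (β - P.V x)
      ≤ (D + (M + B) * L + M * (1 + Cg)) * (a + (N + 1) * |θ - τ|) ^ 2 := by
  have hτ := hopt.1.nonneg
  have hN := hP.N_pos
  have hL := hP.L_nonneg
  have hM : 0 ≤ M := hmul.nonneg.trans hmul.le
  have hlam := hmul.nonneg
  have hB0 : 0 ≤ B := (norm_nonneg _).trans hB
  have h1 := hP.integral_cost_le hs.1 hs.2.1 hτ hs.nonneg hlam hmul.max_le hω hu'ω ha
  have h2 := hP.cost_sub_V_eq hopt hs huu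
  have hcl : y' θ ∈ closure P.Sᶜ := by
    have := hs.mem_frontier hx'
    rw [frontier_eq_closure_inter_closure] at this
    exact this.2
  have h3 := hmul.normal _ hcl
  set δ := |θ - τ| with hδ
  have hδ0 : 0 ≤ δ := abs_nonneg _
  set W := a + (N + 1) * δ with hW
  have hz1 : ‖y' θ - y τ‖ ≤ W := by
    have e1 := hP.norm_trajectory_sub_le hs.1 hs.2.1 hτ hs.nonneg
    have e2 : y' θ - y τ = (y' θ - y' τ) + (y' τ - y τ) := by abel
    rw [e2]
    refine (norm_add_le _ _).trans ?_
    rw [hW]; linarith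
  have hz2 : ‖y' θ - y τ‖ ^ 2 ≤ W ^ 2 := pow_le_pow_left₀ (norm_nonneg _) hz1 2
  have haW : a ^ 2 ≤ W ^ 2 := pow_le_pow_left₀ ha0 (by rw [hW]; nlinarith [mul_nonneg hN.le hδ0]) 2
  have h4 : (lam + ‖ξ - lam • q‖) * L * (a + N * δ) * δ ≤ (M + B) * L * W ^ 2 := by
    have e1 : (lam + ‖ξ - lam • q‖) * L ≤ (M + B) * L :=
      mul_le_mul_of_nonneg_right (add_le_add hmul.le hB) hL
    have e2 : (a + N * δ) * δ ≤ W ^ 2 := by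
      rw [pow_two]
      have : 0 ≤ N * δ := by positivity
      refine mul_le_mul (by rw [hW]; linarith) (by rw [hW]; linarith) hδ0 (by rw [hW]; positivity)
    rw [mul_assoc]
    exact mul_le_mul e1 e2 (by positivity) (by positivity)
  have h5 : lam * (β - P.V x) ≤ lam * (P.cost u' y' θ - P.V x) :=
    mul_le_mul_of_nonneg_left (by linarith) hlam
  have h6 : lam * (P.g (y' θ) - P.g (y τ))
      ≤ lam * inner ℝ q (y' θ - y τ) + M * (Cg * W ^ 2) := by
    have e1 := mul_le_mul_of_nonneg_left hg hlam
    have e2 : lam * (Cg * ‖y' θ - y τ‖ ^ 2) ≤ M * (Cg * W ^ 2) :=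
      mul_le_mul hmul.le (mul_le_mul_of_nonneg_left hz2 hCg) (by positivity) hM
    linarith
  have h7 : M * ‖y' θ - y τ‖ ^ 2 ≤ M * W ^ 2 := mul_le_mul_of_nonneg_left hz2 hM
  have h8 : D * a ^ 2 ≤ D * W ^ 2 := mul_le_mul_of_nonneg_left haW hD
  have h9 : inner ℝ (ξ - lam • q) (y' θ - y' τ) + inner ℝ (ξ - lam • q) (y' τ - y τ)
      + lam * inner ℝ q (y' θ - y τ) = inner ℝ ξ (y' θ - y τ) := by
    rw [← inner_add_right, sub_add_sub_cancel, inner_sub_left, inner_smul_left]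
    simp
  rw [h2] at h5
  linarith

/-- Exiting early saves at least `(r₀ - G N) (τ - θ)`, up to an error linear in `a`. The saving
cannot exceed `|β - V x|` plus that error, since `β ≤ V x'` is at most the cost. -/
theorem Regular.early_exit_time_le (hP : P.Regular N r₀ L) (hG : P.TerminalBound N r₀ G)
    {M : ℝ} (hopt : P.IsOptimal x u y τ) (hx : x ∉ P.S) (hs : P.Steers x' u' y' θ)
    (hx' : x' ∉ P.S) (huu : ∀ t ∈ Icc 0 τ, u' t = u t) (hθτ : θ ≤ τ) (hτM : τ ≤ M)
    (ha0 : 0 ≤ a) (ha : ∀ t ∈ Icc 0 τ, ‖y' t - y t‖ ≤ a) {β : ℝ} (hβ : β ≤ P.V x') :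
    (r₀ - G * N) * (τ - θ) ≤ (L * M + G) * a + |β - P.V x| := by
  have hτ := hopt.1.nonneg
  have h1 := hP.cost_sub_V_eq hopt hs huu
  have h2 := hβ.trans (hP.V_le_cost hG hx' hs)
  have h3 := hP.mul_le_integral_r hs.1 hs.2.1 hs.nonneg hθτ
  rw [integral_symm θ τ] at h1
  have h4 := (abs_le.1 (hG.le _ (hopt.1.mem_frontier hx) _ (hs.mem_frontier hx'))).2
  have h5 : ‖y' θ - y τ‖ ≤ a + N * (τ - θ) := by
    have e1 := hP.norm_trajectory_sub_le hs.1 hs.2.1 hτ hs.nonneg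
    rw [abs_sub_comm, abs_of_nonneg (sub_nonneg.2 hθτ)] at e1
    have e2 : y' θ - y τ = (y' θ - y' τ) + (y' τ - y τ) := by abel
    rw [e2]
    refine (norm_add_le _ _).trans ?_
    linarith [ha τ ⟨hτ, le_rfl⟩]
  have h6 := mul_le_mul_of_nonneg_left h5 hG.nonneg
  have h7 := (abs_le.1 (hP.abs_integral_r_sub_le (y := y) (y' := y') hopt.1.1 hτ ha)).2
  have h8 := mul_le_mul_of_nonneg_left hτM (mul_nonneg hP.L_nonneg ha0)
  have h9 := neg_abs_le (β - P.V x)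
  linarith

/-- For use when no exit has occurred: the terms carrying `lam` are estimated only to first order,
which suffices if `lam` is small or `ξ·(y' τ - y τ)` is negative enough. -/
theorem Regular.supergradient_le_of_expansion (hP : P.Regular N r₀ L) (hu : P.Admissible u)
    (hτ : 0 ≤ τ) {M D : ℝ} (hlam : 0 ≤ lam) (hG0 : 0 ≤ G) (hq : ‖q‖ ≤ G) (hτM : τ ≤ M)
    (ha0 : 0 ≤ a) (ha : ∀ t ∈ Icc 0 τ, ‖y' t - y t‖ ≤ a)
    (hexp : -inner ℝ (p 0) (x' - x) ≤ inner ℝ (ξ - lam • q) (y' τ - y τ)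
      - lam * (∫ s in (0 : ℝ)..τ, (P.r (y' s) (u s) - P.r (y s) (u s))) + D * a ^ 2) (Δ : ℝ) :
    -inner ℝ (p 0) (x' - x) + lam * Δ
      ≤ inner ℝ ξ (y' τ - y τ) + lam * ((L * M + G) * a + |Δ|) + D * a ^ 2 := by
  rw [inner_sub_left, inner_smul_left, RCLike.conj_to_real] at hexp
  have e1 := (abs_le.1 (abs_real_inner_le_norm q (y' τ - y τ))).1
  have e2 := mul_le_mul hq (ha τ ⟨hτ, le_rfl⟩) (norm_nonneg _) hG0
  have e3 := (abs_le.1 (hP.abs_integral_r_sub_le (y := y) (y' := y') hu hτ ha)).1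
  have h8 := mul_le_mul_of_nonneg_left hτM (mul_nonneg hP.L_nonneg ha0)
  have e4 : -inner ℝ q (y' τ - y τ)
      - (∫ s in (0 : ℝ)..τ, (P.r (y' s) (u s) - P.r (y s) (u s))) + Δ
      ≤ (L * M + G) * a + |Δ| := by
    have f1 := le_abs_self Δ
    linarith
  have e5 := mul_le_mul_of_nonneg_left e4 hlam
  linarith

/-- A control attaining the maximum condition drives nearby points into the target. -/
theorem Regular.mem_target_of_multiplier (hP : P.Regular N r₀ L) (hG0 : 0 ≤ G) (hq : ‖q‖ ≤ G)
    {M ρ h e : ℝ} (hmul : P.IsMultiplier M z ξ q lam) (hωU : ω ∈ P.U)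
    (hω : lam * P.r z ω ≤ inner ℝ (ξ - lam • q) (P.f z ω)) (hu' : P.Admissible u')
    (hy' : P.IsTrajectory x' u' y') (hτ : 0 ≤ τ) (hu'ω : ∀ t, τ < t → u' t = ω) (hh : 0 ≤ h)
    (hρ : ∀ s ∈ Icc τ (τ + h), ‖y' s - z‖ ≤ ρ) (he : -e < inner ℝ ξ (y' τ - z))
    (hlarge : M * ρ ^ 2 + M * L * ρ * h + e ≤ lam * (r₀ - G * N) * h) : y' (τ + h) ∈ P.S := by
  have hL := hP.L_nonneg
  have hM : 0 ≤ M := hmul.nonneg.trans hmul.le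
  have hτh : τ ≤ τ + h := by linarith
  -- Outside `S` the normal inequality caps `ξ·(y' - z)` at `M ρ²`. But starting above `-e`, this
  -- product grows at rate at least `lam (r₀ - G N) - M L ρ`, by `f3`.
  by_contra hnot
  have f1 := hmul.normal _ (subset_closure hnot)
  have f2 : M * ‖y' (τ + h) - z‖ ^ 2 ≤ M * ρ ^ 2 :=
    mul_le_mul_of_nonneg_left (pow_le_pow_left₀ (norm_nonneg _) (hρ _ ⟨hτh, le_rfl⟩) 2) hM
  have f3 : lam * (r₀ - G * N) ≤ inner ℝ ξ (P.f z ω) := by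
    rw [inner_sub_left, inner_smul_left, RCLike.conj_to_real] at hω
    have e1 := (abs_le.1 (abs_real_inner_le_norm q (P.f z ω))).1
    have e2 := mul_le_mul hq (hP.norm_f_le z ω hωU) (norm_nonneg _) hG0
    have e3 := hP.r₀_le z ω hωU
    have e4 : r₀ - G * N ≤ P.r z ω + inner ℝ q (P.f z ω) := by linarith
    have e5 := mul_le_mul_of_nonneg_left e4 hmul.nonneg
    linarith
  have f4 := hP.integral_sub_inner_le (lam := 0) (v := ξ) (t := τ + h)
    (c := -(lam * (r₀ - G * N)) + M * L * ρ) hu' hy' hτ hτh fun s hs => by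
      have e1 := hP.hamiltonian_integrand_le (hu'.2 s (hτ.trans hs.1.le)) 0 ξ (y' s) z
      rw [hu'ω s hs.1] at e1 ⊢
      have e2 : ‖ξ‖ * L * ‖y' s - z‖ ≤ M * L * ρ :=
        mul_le_mul (mul_le_mul_of_nonneg_right hmul.norm_le hL) (hρ s ⟨hs.1.le, hs.2⟩)
          (norm_nonneg _) (by positivity)
      rw [abs_zero, zero_add] at e1
      linarith
  have f5 : inner ℝ ξ (y' (τ + h) - y' τ) + inner ℝ ξ (y' τ - z) = inner ℝ ξ (y' (τ + h) - z) := by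
    rw [← inner_add_right, sub_add_sub_cancel]
  rw [add_sub_cancel_left] at f4
  linarith

/-- The core estimate, uniform over all multipliers bounded by `M`, including `lam = 0`. The term
`(β - V x)²` on the right makes any modulus of continuity for `V` unnecessary. -/
theorem Regular.exists_supergradient_bound (hP : P.Regular N r₀ L) (hS : IsClosed P.S)
    (hG : P.TerminalBound N r₀ G) (hqG : ∀ z ∈ frontier P.S, ∀ q ∈ superdiff P.g z, ‖q‖ ≤ G)
    (hg : LocallySemiconcave P.g) (M : ℝ) : ∃ C, 0 ≤ C ∧
      ∀ x ∈ P.R \ P.S, ∀ u y τ, P.IsOptimal x u y τ → τ ≤ M → ‖y τ‖ ≤ M →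
      ∀ ξ q lam p, P.IsMultiplier M (y τ) ξ q lam → P.IsAdjointArc u y lam τ (lam • q - ξ) p →
      ∀ x' ∈ P.R \ P.S, ∀ β ≤ P.V x',
        -inner ℝ (p 0) (x' - x) + lam * (β - P.V x) ≤ C * (‖x' - x‖ ^ 2 + (β - P.V x) ^ 2) := by
  rcases lt_or_ge M 0 with hMneg | hM
  · exact ⟨0, le_rfl, fun x _ u y τ hopt hτM => absurd (hopt.1.nonneg.trans hτM) (not_le.2 hMneg)⟩
  obtain ⟨Cg, hCg, hquad⟩ := hg.exists_quadratic_bound hG.le hqG M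
  have hN := hP.N_pos
  have hL := hP.L_nonneg
  have hG0 := hG.nonneg
  have hηpos : 0 < r₀ - G * N := by linarith [hG.mul_lt]
  -- `K` is the stability factor of trajectories, `B` bounds `‖ξ - lam • q‖`, `D` the second order
  -- remainder, and `C1 * W` the first order change of cost.
  obtain ⟨K, hK⟩ : ∃ K, K = Real.exp (L * M) := ⟨_, rfl⟩
  have hK0 : 0 < K := hK ▸ Real.exp_pos _
  obtain ⟨B, hB⟩ : ∃ B, B = M + M * G := ⟨_, rfl⟩
  have hB0 : 0 ≤ B := by rw [hB]; positivity
  obtain ⟨D, hD⟩ : ∃ D, D = ((B + M * L * M) * K + M) * L * M := ⟨_, rfl⟩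
  have hD0 : 0 ≤ D := by rw [hD]; positivity
  obtain ⟨C1, hC1⟩ : ∃ C1, C1 = (L * M + G) * K := ⟨_, rfl⟩
  have hC10 : 0 ≤ C1 := by rw [hC1]; positivity
  -- `K1 * W` is the admissible shift of the exit time. In `C1 + 2`, the part `C1 + 1` makes up the
  -- deficit `lam (C1 + 1) W` in `ξ·(y' τ - y τ)`; the last unit absorbs the quadratic errors `K2
  -- W²`, which are below `lam W` when this is used.
  obtain ⟨K1, hK1⟩ : ∃ K1, (r₀ - G * N) * K1 = C1 + 2 := ⟨(C1 + 2) / (r₀ - G * N), by field_simp⟩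
  have hK10 : 0 ≤ K1 := by
    have : 0 ≤ (r₀ - G * N) * K1 := by linarith
    exact nonneg_of_mul_nonneg_right this hηpos
  obtain ⟨K2, hK2⟩ : ∃ K2, K2 = M * (K + N * K1) ^ 2 + M * L * (K + N * K1) * K1 := ⟨_, rfl⟩
  have hK20 : 0 ≤ K2 := by rw [hK2]; positivity
  obtain ⟨C2, hC2⟩ : ∃ C2, C2 = D + (M + B) * L + M * (1 + Cg) := ⟨_, rfl⟩
  have hC20 : 0 ≤ C2 := by rw [hC2]; positivity
  -- The four contributions: an exit near `τ`, the normal inequality at `y' τ`, the adjoint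
  -- remainder, and the cost terms when `lam ≤ K2 W`.
  obtain ⟨A1, hA1⟩ : ∃ A1, A1 = C2 * (K + (N + 1) * K1) ^ 2 := ⟨_, rfl⟩
  obtain ⟨A2, hA2⟩ : ∃ A2, A2 = M * K ^ 2 := ⟨_, rfl⟩
  obtain ⟨A3, hA3⟩ : ∃ A3, A3 = D * K ^ 2 := ⟨_, rfl⟩
  obtain ⟨A4, hA4⟩ : ∃ A4, A4 = K2 * (C1 + 1) := ⟨_, rfl⟩
  have hA10 : 0 ≤ A1 := by rw [hA1]; positivity
  have hA20 : 0 ≤ A2 := by rw [hA2]; positivity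
  have hA30 : 0 ≤ A3 := by rw [hA3]; positivity
  have hA40 : 0 ≤ A4 := by rw [hA4]; positivity
  refine ⟨2 * (A1 + A2 + A3 + A4), by positivity, ?_⟩
  intro x hx u y τ hopt hτM hzM ξ q lam p hmul hp x' hx' β hβ
  have hτ := hopt.1.nonneg
  have hu := hopt.1.1
  have hy := hopt.1.2.1
  have hlam := hmul.nonneg
  have hzfr := hopt.1.mem_frontier hx.2
  have hqn : ‖q‖ ≤ G := hqG _ hzfr q hmul.mem_superdiff
  obtain ⟨w, hw⟩ : ∃ w, w = ‖x' - x‖ := ⟨_, rfl⟩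
  obtain ⟨W, hW⟩ : ∃ W, W = w + |β - P.V x| := ⟨_, rfl⟩
  have hw0 : 0 ≤ w := hw ▸ norm_nonneg _
  have hΔ0 := abs_nonneg (β - P.V x)
  have hW0 : 0 ≤ W := by linarith only [hW, hw0, hΔ0]
  have hwW : w ≤ W := by linarith only [hW, hΔ0]
  suffices hmain : -inner ℝ (p 0) (x' - x) + lam * (β - P.V x) ≤ (A1 + A2 + A3 + A4) * W ^ 2 by
    have h1 : W ^ 2 ≤ 2 * (w ^ 2 + (β - P.V x) ^ 2) := by
      rw [hW, ← sq_abs (β - P.V x)]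
      linarith only [sq_nonneg (w - |β - P.V x|)]
    have := mul_le_mul_of_nonneg_left h1 (by positivity : 0 ≤ A1 + A2 + A3 + A4)
    rw [← hw]
    linarith only [this, hmain]
  have hW2 : 0 ≤ W ^ 2 := sq_nonneg W
  have hA1W := mul_nonneg hA10 hW2
  have hA2W := mul_nonneg hA20 hW2
  have hA3W := mul_nonneg hA30 hW2
  have hA4W := mul_nonneg hA40 hW2
  obtain ⟨ω, hωU, hω⟩ := hmul.exists_ge
  obtain ⟨u', hu', huu, hu'ω⟩ : ∃ u', P.Admissible u' ∧ (∀ t ∈ Icc 0 τ, u' t = u t) ∧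
      ∀ t, τ < t → u' t = ω := by
    refine ⟨fun t => if t ≤ τ then u t else ω,
      ⟨Measurable.ite measurableSet_Iic hu.1 measurable_const, fun t ht => ?_⟩,
      fun t ht => if_pos ht.2, fun t ht => if_neg (not_le.2 ht)⟩
    beta_reduce
    split_ifs
    · exact hu.2 t ht
    · exact hωU
  obtain ⟨y', hy'⟩ := hP.exists_trajectory x' hu'
  obtain ⟨a, ha⟩ : ∃ a, a = K * w := ⟨_, rfl⟩
  have ha0 : 0 ≤ a := ha ▸ mul_nonneg hK0.le hw0
  have haW : a ≤ K * W := ha ▸ mul_le_mul_of_nonneg_left hwW hK0.le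
  have hC1a : (L * M + G) * a + |β - P.V x| ≤ (C1 + 1) * W := by
    have h1 : (L * M + G) * a ≤ (L * M + G) * (K * W) :=
      mul_le_mul_of_nonneg_left haW (by positivity)
    have h2 : (L * M + G) * (K * W) = C1 * W := by rw [hC1]; ring
    linarith only [h1, h2, hW, hw0]
  have hstab : ∀ t ∈ Icc 0 τ, ‖y' t - y t‖ ≤ a := fun t ht => by
    refine (hP.norm_trajectory_sub_trajectory_le hu hy hy' huu ht).trans ?_
    rw [ha, mul_comm, hK, hw]
    gcongr
  have haτ := hstab τ ⟨hτ, le_rfl⟩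
  have hBn : ‖ξ - lam • q‖ ≤ B := by
    refine (norm_sub_le _ _).trans ?_
    rw [norm_smul, Real.norm_of_nonneg hlam, hB]
    exact add_le_add hmul.norm_le (mul_le_mul hmul.le hqn (norm_nonneg _) hM)
  have hpB : ∀ t ∈ Icc 0 τ, ‖p t‖ ≤ (B + M * L * M) * K := fun t ht => by
    refine (hP.norm_adjointArc_le hu hlam hp ht).trans ?_
    rw [norm_sub_rev, hK]
    have h1 : lam * L * τ ≤ M * L * M := by
      refine mul_le_mul (mul_le_mul_of_nonneg_right hmul.le hL) hτM hτ (by positivity)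
    gcongr
  have hexp : -inner ℝ (p 0) (x' - x) ≤ inner ℝ (ξ - lam • q) (y' τ - y τ)
      - lam * (∫ s in (0 : ℝ)..τ, (P.r (y' s) (u s) - P.r (y s) (u s))) + D * a ^ 2 := by
    have h1 := hP.abs_adjoint_expansion_le hu hy hy' huu hlam hτ hp hpB hstab
    have h2 := (abs_le.1 h1).2
    rw [← neg_sub ξ, inner_neg_left] at h2
    have h3 : ((B + M * L * M) * K + lam) * L * a ^ 2 * τ ≤ D * a ^ 2 := by
      have h4 : ((B + M * L * M) * K + lam) * L * τ ≤ D := by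
        rw [hD]
        refine mul_le_mul (mul_le_mul_of_nonneg_right ?_ hL) hτM hτ (by positivity)
        linarith only [hmul.le]
      have := mul_le_mul_of_nonneg_right h4 (sq_nonneg a)
      linarith only [this]
    linarith only [h2, h3]
  have hexit : ∀ θ, P.Steers x' u' y' θ → |θ - τ| ≤ K1 * W →
      -inner ℝ (p 0) (x' - x) + lam * (β - P.V x) ≤ (A1 + A2 + A3 + A4) * W ^ 2 := by
    intro θ hs hθ
    have h1 := hP.supergradient_le_of_exit (p := p) hCg hD0 hopt hs hx'.2 huu hu'ω hmul hω
      (hquad _ hzfr hzM _ (hs.mem_frontier hx'.2) q hmul.mem_superdiff) hBn ha0 haτ hexp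
      (hβ.trans (hP.V_le_cost hG hx'.2 hs))
    rw [← hC2] at h1
    have h2 : a + (N + 1) * |θ - τ| ≤ (K + (N + 1) * K1) * W := by
      have e2 := mul_le_mul_of_nonneg_left hθ (by positivity : 0 ≤ N + 1)
      linarith only [haW, e2]
    have h3 : (a + (N + 1) * |θ - τ|) ^ 2 ≤ ((K + (N + 1) * K1) * W) ^ 2 :=
      pow_le_pow_left₀ (by positivity) h2 2
    have h4 := mul_le_mul_of_nonneg_left h3 hC20
    rw [mul_pow, ← mul_assoc, ← hA1] at h4
    linarith only [h1, h4, hA2W, hA3W, hA4W]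
  by_cases hhit : ∃ t ∈ Icc 0 τ, y' t ∈ P.S
  · obtain ⟨t, ht, hyt⟩ := hhit
    obtain ⟨θ, hθt, hs⟩ := hy'.exists_steers hS hu' ht.1 hyt
    have hθτ : θ ≤ τ := hθt.trans ht.2
    refine hexit θ hs ?_
    rw [abs_sub_comm, abs_of_nonneg (sub_nonneg.2 hθτ)]
    have h1 := hP.early_exit_time_le hG hopt hx.2 hs hx'.2 huu hθτ hτM ha0 hstab hβ
    refine le_of_mul_le_mul_left ?_ hηpos
    rw [← mul_assoc, hK1]
    linarith only [h1, hC1a, hW0]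
  · push Not at hhit
    have h1 := hmul.normal _ (subset_closure (hhit τ ⟨hτ, le_rfl⟩))
    have h2 : inner ℝ ξ (y' τ - y τ) ≤ A2 * W ^ 2 := by
      refine h1.trans ?_
      rw [hA2, mul_assoc, ← mul_pow]
      exact mul_le_mul_of_nonneg_left (pow_le_pow_left₀ (norm_nonneg _) (haτ.trans haW) 2) hM
    have hDW : D * a ^ 2 ≤ A3 * W ^ 2 := by
      rw [hA3, mul_assoc, ← mul_pow]
      exact mul_le_mul_of_nonneg_left (pow_le_pow_left₀ ha0 haW 2) hD0
    have h3 : -inner ℝ (p 0) (x' - x) + lam * (β - P.V x)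
        ≤ inner ℝ ξ (y' τ - y τ) + lam * ((C1 + 1) * W) + A3 * W ^ 2 := by
      have e1 := hP.supergradient_le_of_expansion hu hτ hlam hG0 hqn hτM ha0 hstab hexp (β - P.V x)
      have e2 := mul_le_mul_of_nonneg_left hC1a hlam
      linarith only [e1, e2, hDW]
    -- Either the negative normal component absorbs the cost terms, or `lam` is itself of order `W`,
    -- or neither holds and `ω` drives the trajectory into the target within time `K1 * W`.
    by_cases hA : inner ℝ ξ (y' τ - y τ) ≤ -(lam * ((C1 + 1) * W))
    · linarith only [h3, hA, hA1W, hA2W, hA4W]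
    push Not at hA
    by_cases hlamW : lam ≤ K2 * W
    · have e1 : lam * ((C1 + 1) * W) ≤ A4 * W ^ 2 := by
        have := mul_le_mul_of_nonneg_right hlamW (by positivity : 0 ≤ (C1 + 1) * W)
        rw [hA4]
        linarith only [this]
      linarith only [h3, h2, e1, hA1W]
    push Not at hlamW
    have hKW : 0 ≤ K1 * W := mul_nonneg hK10 hW0
    have hyS : y' (τ + K1 * W) ∈ P.S := by
      refine hP.mem_target_of_multiplier hG0 hqn hmul hωU hω hu' hy' hτ hu'ω hKW
        (ρ := (K + N * K1) * W) (fun s hs => ?_) hA ?_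
      · have e1 := hP.norm_trajectory_sub_le hu' hy' hτ (hτ.trans hs.1)
        rw [abs_of_nonneg (sub_nonneg.2 hs.1)] at e1
        have e2 : y' s - y τ = (y' s - y' τ) + (y' τ - y τ) := by abel
        rw [e2]
        refine (norm_add_le _ _).trans ?_
        have e3 : N * (s - τ) ≤ N * (K1 * W) :=
          mul_le_mul_of_nonneg_left (by linarith only [hs.2]) hN.le
        linarith only [e1, e3, haτ, haW]
      · have e1 := mul_le_mul_of_nonneg_right hlamW.le hW0
        have e2 : lam * (r₀ - G * N) * (K1 * W) = lam * (((r₀ - G * N) * K1) * W) := by ring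
        rw [e2, hK1]
        rw [hK2] at e1
        linarith only [e1]
    obtain ⟨θ, hθ, hs⟩ := hy'.exists_steers hS hu' (add_nonneg hτ hKW) hyS
    have hτθ : τ < θ := by
      by_contra hle
      exact hhit θ ⟨hs.nonneg, not_lt.1 hle⟩ hs.mem
    refine hexit θ hs ?_
    rw [abs_of_nonneg (sub_nonneg.2 hτθ.le)]
    linarith only [hθ]

end Problem

end ExitTime

end

noncomputable section

namespace ExitTime

open MeasureTheory intervalIntegral

variable {d m : ℕ}

/-! ### Proximal supergradients of the value function -/

theorem inner_pt_sub (p x x' : E d) (lam β β' : ℝ) :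
    inner ℝ (pt (-p) lam) (pt x' β' - pt x β) = -inner ℝ p (x' - x) + lam * (β' - β) := by
  rw [WithLp.prod_inner_apply]
  simp [pt, mul_comm]

theorem norm_pt_sub_sq (x x' : E d) (β β' : ℝ) :
    ‖pt x' β' - pt x β‖ ^ 2 = ‖x' - x‖ ^ 2 + (β' - β) ^ 2 := by
  rw [WithLp.prod_norm_sq_eq_of_L2]
  simp [pt]

section Cones

variable {F : Type*} [NormedAddCommGroup F] [InnerProductSpace ℝ F] {Q : Set F} {x v w : F}

theorem add_mem_proximalNormals (hv : v ∈ proximalNormals Q x) (hw : w ∈ proximalNormals Q x) :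
    v + w ∈ proximalNormals Q x := by
  obtain ⟨σ, hσ, h⟩ := hv
  obtain ⟨σ', hσ', h'⟩ := hw
  refine ⟨σ + σ', add_nonneg hσ hσ', fun y hy => ?_⟩
  rw [inner_add_left]
  linarith [h y hy, h' y hy]

theorem smul_mem_proximalNormals {a : ℝ} (ha : 0 ≤ a) (hv : v ∈ proximalNormals Q x) :
    a • v ∈ proximalNormals Q x := by
  obtain ⟨σ, hσ, h⟩ := hv
  refine ⟨a * σ, mul_nonneg ha hσ, fun y hy => ?_⟩
  rw [inner_smul_left, RCLike.conj_to_real, mul_assoc]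
  exact mul_le_mul_of_nonneg_left (h y hy) ha

theorem zero_mem_proximalNormals : (0 : F) ∈ proximalNormals Q x :=
  ⟨0, le_rfl, fun y _ => by simp⟩

end Cones

theorem pt_add (x x' : E d) (β β' : ℝ) : pt (x + x') (β + β') = pt x β + pt x' β' := rfl

theorem pt_smul (a : ℝ) (x : E d) (β : ℝ) : pt (a • x) (a * β) = a • pt x β := rfl

theorem convex_proximalSuperdiff (Ω : Set (E d)) (φ : E d → ℝ) (x : E d) :
    Convex ℝ (proximalSuperdiff Ω φ x) := by
  intro v hv w hw a b ha hb hab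
  have h := add_mem_proximalNormals (smul_mem_proximalNormals ha hv)
    (smul_mem_proximalNormals hb hw)
  rw [← pt_smul, ← pt_smul, ← pt_add, mul_one, mul_one, hab] at h
  change pt (-(a • v + b • w)) 1 ∈ proximalNormals _ _
  rwa [neg_add, ← smul_neg, ← smul_neg]

theorem convex_horizontalSuperdiff (Ω : Set (E d)) (φ : E d → ℝ) (x : E d) :
    Convex ℝ (horizontalSuperdiff Ω φ x) := by
  intro v hv w hw a b ha hb _
  have h := add_mem_proximalNormals (smul_mem_proximalNormals ha hv)
    (smul_mem_proximalNormals hb hw)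
  rw [← pt_smul, ← pt_smul, ← pt_add, mul_zero, mul_zero, add_zero] at h
  change pt (-(a • v + b • w)) 0 ∈ proximalNormals _ _
  rwa [neg_add, ← smul_neg, ← smul_neg]

theorem zero_mem_horizontalSuperdiff (Ω : Set (E d)) (φ : E d → ℝ) (x : E d) :
    (0 : E d) ∈ horizontalSuperdiff Ω φ x := by
  change pt (-(0 : E d)) 0 ∈ proximalNormals _ _
  rw [neg_zero]
  exact zero_mem_proximalNormals

theorem add_mem_proximalSuperdiff {Ω : Set (E d)} {φ : E d → ℝ} {x v w : E d}
    (hv : v ∈ horizontalSuperdiff Ω φ x) (hw : w ∈ proximalSuperdiff Ω φ x) :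
    v + w ∈ proximalSuperdiff Ω φ x := by
  have h := add_mem_proximalNormals hv hw
  rw [← pt_add, zero_add, ← neg_add] at h
  exact h

/-- Radii valid for level `M` form an interval, and one valid for `M + 1` works for all levels near
`M`. A partition of unity on the line of levels thus yields a continuous `k`, and `ρ = k ∘ s`;
compactness of `[0, M]` gives the lower bound. -/
theorem exists_continuous_radius {X : Type*} [TopologicalSpace X] {Ω : Set X} {s : X → ℝ}
    (hs : ContinuousOn s Ω) (hs0 : ∀ x ∈ Ω, 0 ≤ s x) {p : X → ℝ → Prop}
    (hp : ∀ x ρ ρ', 0 < ρ → ρ ≤ ρ' → p x ρ' → p x ρ)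
    (h : ∀ M, ∃ ρ > 0, ∀ x ∈ Ω, s x ≤ M → p x ρ) :
    ∃ ρ : X → ℝ, ContinuousOn ρ Ω ∧ (∀ x ∈ Ω, 0 < ρ x) ∧ (∀ x ∈ Ω, p x (ρ x)) ∧
      ∀ M, ∃ c > 0, ∀ x ∈ Ω, s x ≤ M → c ≤ ρ x := by
  obtain ⟨k, hk⟩ := exists_continuous_forall_mem_convex_of_local_const
    (t := fun M : ℝ => {ρ | 0 < ρ ∧ ∀ x ∈ Ω, s x ≤ M → p x ρ}) (fun M => by
      refine Set.OrdConnected.convex ⟨fun a ha b hb ρ hρ => ⟨ha.1.trans_le hρ.1, fun x hx hxM => ?_⟩⟩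
      exact hp x ρ b (ha.1.trans_le hρ.1) hρ.2 (hb.2 x hx hxM)) (fun M => by
      obtain ⟨ρ, hρ, hM⟩ := h (M + 1)
      refine ⟨ρ, ?_⟩
      filter_upwards [Iio_mem_nhds (lt_add_one M)] with M' hM'
      exact ⟨hρ, fun x hx hxM => hM x hx (hxM.trans (le_of_lt hM'))⟩)
  refine ⟨fun x => k (s x), k.continuous.comp_continuousOn hs, fun x _ => (hk _).1,
    fun x hx => (hk _).2 x hx le_rfl, fun M => ?_⟩
  rcases lt_or_ge M 0 with hM | hM
  · exact ⟨1, one_pos, fun x hx hxM => absurd ((hs0 x hx).trans hxM) (not_le.2 hM)⟩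
  · obtain ⟨t, _, ht⟩ := isCompact_Icc.exists_isMinOn (nonempty_Icc.2 hM) k.continuous.continuousOn
    exact ⟨k t, (hk t).1, fun x hx hxM => ht ⟨hs0 x hx, hxM⟩⟩

/-! ### Multipliers at the exit point and the normals they generate -/

namespace Problem

variable {P : Problem d m} {N r₀ L G τ lam : ℝ} {x z ξ q : E d} {u : ℝ → E m} {y p : ℝ → E d}

theorem Regular.continuousOn_f_right (hP : P.Regular N r₀ L) (z : E d) :
    ContinuousOn (P.f z) P.U :=
  hP.continuousOn_f.comp (f := fun ω => (z, ω)) (by fun_prop) fun ω hω => ⟨mem_univ _, hω⟩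

theorem Regular.continuousOn_r_right (hP : P.Regular N r₀ L) (z : E d) :
    ContinuousOn (P.r z) P.U :=
  hP.continuousOn_r.comp (f := fun ω => (z, ω)) (by fun_prop) fun ω hω => ⟨mem_univ _, hω⟩

/-- A trajectory reaching the target cannot do so against every velocity. -/
theorem Regular.exists_inner_f_gt (hP : P.Regular N r₀ L) (h : P.Steers x u y τ) (hx : x ∉ P.S)
    {σ : ℝ} (hσ : 0 ≤ σ)
    (hξ : ∀ w ∈ closure P.Sᶜ, inner ℝ ξ (w - y τ) ≤ σ * ‖w - y τ‖ ^ 2) {c : ℝ} (hc : 0 < c) :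
    ∃ ω ∈ P.U, -c < inner ℝ ξ (P.f (y τ) ω) := by
  by_contra! hneg
  have hN := hP.N_pos
  have hL := hP.L_nonneg
  have hτ := h.pos hx
  set A := ‖ξ‖ * L * N + σ * N ^ 2 with hA
  have hA0 : 0 ≤ A := by positivity
  -- `s` is so close to `τ` that the errors `A (τ - s)²` stay below `c (τ - s)`. Moving against `ξ`
  -- at speed `c` would then violate the normal inequality at `y s`, which is outside `S`.
  set s := τ - min τ (c / (2 * (A + 1))) with hs
  have hmin : 0 < min τ (c / (2 * (A + 1))) := by positivity
  have hs0 : 0 ≤ s := by rw [hs]; linarith [min_le_left τ (c / (2 * (A + 1)))]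
  have hsτ : s < τ := by rw [hs]; linarith
  have hsc : A * (τ - s) < c := by
    have h1 : τ - s ≤ c / (2 * (A + 1)) := by rw [hs, sub_sub_cancel]; exact min_le_right _ _
    rw [le_div_iff₀ (by positivity)] at h1
    nlinarith
  have hnear : ∀ t ∈ Icc s τ, ‖y t - y τ‖ ≤ N * (τ - s) := fun t ht => by
    have h1 := hP.norm_trajectory_sub_le h.1 h.2.1 hτ.le (hs0.trans ht.1)
    rw [abs_sub_comm, abs_of_nonneg (by linarith [ht.2])] at h1
    exact h1.trans (mul_le_mul_of_nonneg_left (by linarith [ht.1]) hN.le)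
  have h1 := hξ _ (subset_closure (h.notMem hs0 hsτ))
  have h2 : σ * ‖y s - y τ‖ ^ 2 ≤ σ * (N * (τ - s)) ^ 2 :=
    mul_le_mul_of_nonneg_left
      (pow_le_pow_left₀ (norm_nonneg _) (hnear s ⟨le_rfl, hsτ.le⟩) 2) hσ
  have h3 := hP.integral_sub_inner_le (lam := 0) (v := -ξ) (c := -c + ‖ξ‖ * L * (N * (τ - s)))
    h.1 h.2.1 hs0 hsτ.le fun t ht => by
      have ht0 := hs0.trans ht.1.le
      have e1 := hP.hamiltonian_integrand_le (h.1.2 t ht0) 0 (-ξ) (y t) (y τ)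
      have e2 := mul_le_mul_of_nonneg_left (hnear t ⟨ht.1.le, ht.2⟩)
        (by positivity : 0 ≤ ‖ξ‖ * L)
      have e3 := hneg _ (h.1.2 t ht0)
      rw [abs_zero, zero_add, norm_neg, inner_neg_left, inner_neg_left] at e1
      rw [inner_neg_left]
      linarith
  rw [inner_neg_left, ← neg_sub (y s), inner_neg_right, neg_neg, zero_mul, zero_sub] at h3
  have h4 : c * (τ - s) ≤ A * (τ - s) * (τ - s) := by rw [hA]; nlinarith
  have h5 := mul_lt_mul_of_pos_right hsc (sub_pos.2 hsτ)
  linarith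

/-- Existence of multipliers at the end point of a trajectory reaching the target. -/
theorem Regular.exists_multiplier (hP : P.Regular N r₀ L) (hG : P.TerminalBound N r₀ G)
    (hqG : ‖q‖ ≤ G) (h : P.Steers x u y τ) (hx : x ∉ P.S) {σ : ℝ}
    (hσ : 0 ≤ σ) (hξ1 : ‖ξ‖ = 1)
    (hξ : ∀ w ∈ closure P.Sᶜ, inner ℝ ξ (w - y τ) ≤ σ * ‖w - y τ‖ ^ 2) :
    ∃ lam, 0 ≤ lam ∧ lam ≤ N / (r₀ - G * N) ∧
      (∀ ω ∈ P.U, inner ℝ (ξ - lam • q) (P.f (y τ) ω) ≤ lam * P.r (y τ) ω) ∧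
      ∃ ω ∈ P.U, inner ℝ (ξ - lam • q) (P.f (y τ) ω) = lam * P.r (y τ) ω := by
  have hηpos : 0 < r₀ - G * N := by linarith [hG.mul_lt]
  have hden : ∀ ω ∈ P.U, r₀ - G * N ≤ P.r (y τ) ω + inner ℝ q (P.f (y τ) ω) := fun ω hω => by
    have e1 := (abs_le.1 (abs_real_inner_le_norm q (P.f (y τ) ω))).1
    have e2 := mul_le_mul hqG (hP.norm_f_le (y τ) ω hω) (norm_nonneg _) hG.nonneg
    have e3 := hP.r₀_le (y τ) ω hω
    linarith
  have hfc := hP.continuousOn_f_right (y τ)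
  have hc : ContinuousOn (fun ω => inner ℝ ξ (P.f (y τ) ω)
      / (P.r (y τ) ω + inner ℝ q (P.f (y τ) ω))) P.U :=
    (continuousOn_const.inner (𝕜 := ℝ) hfc).div
      ((hP.continuousOn_r_right _).add (continuousOn_const.inner (𝕜 := ℝ) hfc))
      fun ω hω => (hηpos.trans_le (hden ω hω)).ne'
  obtain ⟨ω, hωU, hmax⟩ := hP.isCompact.exists_isMaxOn hP.nonempty hc
  -- Since `r + q·f` is positive, the maximum in the multiplier condition vanishes precisely when
  -- `lam` is the largest of these ratios.
  obtain ⟨lam, hlam⟩ : ∃ lam, lam = inner ℝ ξ (P.f (y τ) ω)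
      / (P.r (y τ) ω + inner ℝ q (P.f (y τ) ω)) := ⟨_, rfl⟩
  have hexpand : ∀ ω', inner ℝ (ξ - lam • q) (P.f (y τ) ω')
      = inner ℝ ξ (P.f (y τ) ω') - lam * inner ℝ q (P.f (y τ) ω') := fun ω' => by
    rw [inner_sub_left, inner_smul_left, RCLike.conj_to_real]
  have hle : ∀ ω' ∈ P.U, inner ℝ ξ (P.f (y τ) ω')
      ≤ lam * (P.r (y τ) ω' + inner ℝ q (P.f (y τ) ω')) := fun ω' hω' => by
    rw [hlam, ← div_le_iff₀ (hηpos.trans_le (hden ω' hω'))]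
    exact hmax hω'
  refine ⟨lam, ?_, ?_, fun ω' hω' => ?_, ω, hωU, ?_⟩
  -- A negative `lam` would give `ξ·f ≤ lam (r₀ - G N) < 0` for all controls, impossible for a
  -- trajectory that reaches the target.
  · by_contra! hneg
    obtain ⟨ω', hω', hgt⟩ := hP.exists_inner_f_gt h hx hσ hξ
      (c := -lam * (r₀ - G * N)) (mul_pos (by linarith) hηpos)
    have h1 := hle ω' hω'
    have h2 := mul_le_mul_of_nonpos_left (hden ω' hω') hneg.le
    linarith
  · have h1 := (real_inner_le_norm ξ (P.f (y τ) ω)).trans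
      (mul_le_mul_of_nonneg_left (hP.norm_f_le (y τ) ω hωU) (norm_nonneg _))
    rw [hξ1, one_mul] at h1
    rw [hlam]
    exact div_le_div₀ hP.N_pos.le h1 hηpos (hden ω hωU)
  · rw [hexpand]
    linarith [hle ω' hω']
  · rw [hexpand]
    have : inner ℝ ξ (P.f (y τ) ω) = lam * (P.r (y τ) ω + inner ℝ q (P.f (y τ) ω)) := by
      rw [hlam, div_mul_cancel₀ _ (hηpos.trans_le (hden ω hωU)).ne']
    linarith

theorem isAdjointArc_one_iff {pT : E d} : P.IsAdjointArc u y 1 τ pT p ↔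
    IsBackwardSolution (fun t => ContinuousLinearMap.adjoint (P.Dxf (y t) (u t)))
      (fun t => P.Dxr (y t) (u t)) τ pT p := by
  simp only [IsAdjointArc, one_smul]

theorem isAdjointArc_zero_iff {pT : E d} : P.IsAdjointArc u y 0 τ pT p ↔
    IsBackwardSolution (fun t => ContinuousLinearMap.adjoint (P.Dxf (y t) (u t)))
      (fun _ => 0) τ pT p := by
  simp only [IsAdjointArc, zero_smul]

/-- A dichotomy on the multiplier: `lam = 0` says that `ξ·f` has maximum zero, and for `lam > 0`
division by `lam` turns the maximum condition into `H(z, q - ξ / lam) = 0`. -/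
theorem Regular.N1dag_union_N0dag_nonempty (hP : P.Regular N r₀ L) (hG : P.TerminalBound N r₀ G)
    (hq : q ∈ superdiff P.g (y τ)) (hqG : ‖q‖ ≤ G) (hopt : P.IsOptimal x u y τ) (hx : x ∉ P.S)
    {σ : ℝ} (hσ : 0 ≤ σ) (hξ1 : ‖ξ‖ = 1)
    (hξ : ∀ w ∈ closure P.Sᶜ, inner ℝ ξ (w - y τ) ≤ σ * ‖w - y τ‖ ^ 2) :
    (P.N1dag x ∪ P.N0dag x).Nonempty := by
  have hηpos : 0 < r₀ - G * N := by linarith [hG.mul_lt]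
  have hyc := hopt.1.2.1.1
  obtain ⟨lam, hlam, -, hle, ω, hω, heq⟩ := hP.exists_multiplier hG hqG hopt.1 hx hσ hξ1 hξ
  rcases hlam.eq_or_lt with rfl | hpos
  · obtain ⟨p, hp⟩ := hP.exists_adjointArc hopt.1.1 hyc τ le_rfl (-ξ)
    refine ⟨p 0, Or.inr ⟨u, y, τ, hopt, ξ, ⟨?_, ⟨σ, hσ, hξ⟩, ?_⟩, p, isAdjointArc_zero_iff.1 hp, rfl⟩⟩
    · rintro rfl; simp at hξ1
    · simp only [zero_smul, sub_zero, zero_mul] at hle heq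
      refine IsGreatest.csSup_eq ⟨⟨ω, hω, heq⟩, ?_⟩
      rintro _ ⟨ω', hω', rfl⟩
      exact hle ω' hω'
  · have hexpand : ∀ ω', -inner ℝ (q - lam⁻¹ • ξ) (P.f (y τ) ω') - P.r (y τ) ω'
        = lam⁻¹ * (inner ℝ (ξ - lam • q) (P.f (y τ) ω') - lam * P.r (y τ) ω') := fun ω' => by
      simp only [inner_sub_left, inner_smul_left, RCLike.conj_to_real]
      field_simp
      ring
    obtain ⟨p, hp⟩ := hP.exists_adjointArc hopt.1.1 hyc τ zero_le_one (q - lam⁻¹ • ξ)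
    refine ⟨p 0, Or.inl ⟨u, y, τ, hopt, lam⁻¹ • ξ, ⟨?_, ?_⟩, q, hq, ?_, p,
      isAdjointArc_one_iff.1 hp, rfl⟩⟩
    · exact smul_mem_proximalNormals (inv_nonneg.2 hlam) ⟨σ, hσ, hξ⟩
    · have h1 : 0 < inner ℝ (lam⁻¹ • ξ) (P.f (y τ) ω) := by
        rw [inner_sub_left, inner_smul_left, RCLike.conj_to_real] at heq
        rw [inner_smul_left, RCLike.conj_to_real]
        have e1 := (abs_le.1 (abs_real_inner_le_norm q (P.f (y τ) ω))).1
        have e2 := mul_le_mul hqG (hP.norm_f_le (y τ) ω hω) (norm_nonneg _) hG.nonneg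
        have e3 := hP.r₀_le (y τ) ω hω
        have e4 : 0 < P.r (y τ) ω + inner ℝ q (P.f (y τ) ω) := by linarith
        have e5 : inner ℝ ξ (P.f (y τ) ω) = lam * (P.r (y τ) ω + inner ℝ q (P.f (y τ) ω)) := by
          linarith
        rw [e5]
        positivity
      refine h1.trans_le (le_csSup ?_ ⟨ω, hω, rfl⟩)
      exact (hP.isCompact.image_of_continuousOn
        (continuousOn_const.inner (𝕜 := ℝ) (hP.continuousOn_f_right _))).bddAbove
    · refine IsGreatest.csSup_eq ⟨⟨ω, hω, ?_⟩, ?_⟩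
      · beta_reduce
        rw [hexpand, heq, sub_self, mul_zero]
      · rintro _ ⟨ω', hω', rfl⟩
        beta_reduce
        rw [hexpand]
        exact mul_nonpos_of_nonneg_of_nonpos (inv_nonneg.2 hlam) (sub_nonpos.2 (hle ω' hω'))

/-- The quadratic upper bound for the value function at each multiplier. -/
def SupergradientBound (P : Problem d m) : Prop :=
  ∀ M : ℝ, ∃ C, 0 ≤ C ∧
    ∀ x ∈ P.R \ P.S, ∀ u y τ, P.IsOptimal x u y τ → τ ≤ M → ‖y τ‖ ≤ M →
    ∀ ξ q lam p, P.IsMultiplier M (y τ) ξ q lam → P.IsAdjointArc u y lam τ (lam • q - ξ) p →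
    ∀ w ∈ hypo (P.R \ P.S) P.V,
      inner ℝ (pt (-p 0) lam) (w - pt x (P.V x)) ≤ C * ‖w - pt x (P.V x)‖ ^ 2

theorem Regular.supergradientBound (hP : P.Regular N r₀ L) (hS : IsClosed P.S)
    (hG : P.TerminalBound N r₀ G) (hqG : ∀ z ∈ frontier P.S, ∀ q ∈ superdiff P.g z, ‖q‖ ≤ G)
    (hg : LocallySemiconcave P.g) : P.SupergradientBound := by
  intro M
  obtain ⟨C, hC, h⟩ := hP.exists_supergradient_bound hS hG hqG hg M
  refine ⟨C, hC, ?_⟩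
  rintro x hx u y τ hopt hτ hz ξ q lam p hmul hp _ ⟨x', hx', β, hβ, rfl⟩
  rw [inner_pt_sub, norm_pt_sub_sq]
  exact h x hx u y τ hopt hτ hz ξ q lam p hmul hp x' hx' β hβ

theorem SupergradientBound.mem_proximalNormals (h : P.SupergradientBound) (hx : x ∈ P.R \ P.S)
    (hopt : P.IsOptimal x u y τ) {σ : ℝ}
    (hξ : ∀ w ∈ closure P.Sᶜ, inner ℝ ξ (w - y τ) ≤ σ * ‖w - y τ‖ ^ 2) (hlam : 0 ≤ lam)
    (hq : q ∈ superdiff P.g (y τ))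
    (hle : ∀ ω ∈ P.U, inner ℝ (ξ - lam • q) (P.f (y τ) ω) ≤ lam * P.r (y τ) ω)
    (hge : ∃ ω ∈ P.U, lam * P.r (y τ) ω ≤ inner ℝ (ξ - lam • q) (P.f (y τ) ω))
    (hp : P.IsAdjointArc u y lam τ (lam • q - ξ) p) :
    pt (-p 0) lam ∈ proximalNormals (hypo (P.R \ P.S) P.V) (pt x (P.V x)) := by
  -- Membership in the cone needs no uniformity, so `M` may depend on the multiplier.
  set M := |τ| + ‖y τ‖ + ‖ξ‖ + lam + |σ| with hM
  have n1 := abs_nonneg τ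
  have n2 := norm_nonneg (y τ)
  have n3 := norm_nonneg ξ
  have n4 := abs_nonneg σ
  obtain ⟨C, hC, hb⟩ := h M
  refine ⟨C, hC, hb x hx u y τ hopt ?_ ?_ ξ q lam p
    ⟨?_, hlam, ?_, hq, fun w hw => (hξ w hw).trans ?_, hle, hge⟩ hp⟩
  · linarith [le_abs_self τ]
  · linarith
  · linarith
  · linarith
  · refine mul_le_mul_of_nonneg_right ?_ (sq_nonneg _)
    linarith [le_abs_self σ]

theorem Regular.N1dag_subset (hP : P.Regular N r₀ L) (h : P.SupergradientBound)
    (hx : x ∈ P.R \ P.S) : P.N1dag x ⊆ proximalSuperdiff (P.R \ P.S) P.V x := by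
  rintro _ ⟨u, y, τ, hopt, ξ, ⟨⟨σ, -, hξ⟩, -⟩, q, hq, hH, p, hp, rfl⟩
  have hc : ContinuousOn (fun ω => -inner ℝ (q - ξ) (P.f (y τ) ω) - P.r (y τ) ω) P.U :=
    (continuousOn_const.inner (𝕜 := ℝ) (hP.continuousOn_f_right _)).neg.sub
      (hP.continuousOn_r_right _)
  refine h.mem_proximalNormals hx hopt hξ zero_le_one hq (fun ω hω => ?_) ?_ ?_
  · have h1 := le_csSup (hP.isCompact.image_of_continuousOn hc).bddAbove ⟨ω, hω, rfl⟩
    unfold hamiltonian at hH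
    rw [hH] at h1
    beta_reduce at h1
    rw [← neg_sub ξ, inner_neg_left] at h1
    rw [one_smul]
    linarith
  · obtain ⟨ω, hω, heq⟩ := hP.isCompact.exists_sSup_image_eq hP.nonempty hc
    unfold hamiltonian at hH
    rw [hH, ← neg_sub ξ, inner_neg_left] at heq
    refine ⟨ω, hω, ?_⟩
    rw [one_smul]
    linarith
  · rw [one_smul]
    exact isAdjointArc_one_iff.2 hp

theorem Regular.N0dag_subset (hP : P.Regular N r₀ L) (h : P.SupergradientBound)
    (hg : LocallySemiconcave P.g) (hx : x ∈ P.R \ P.S) :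
    P.N0dag x ⊆ horizontalSuperdiff (P.R \ P.S) P.V x := by
  rintro _ ⟨u, y, τ, hopt, ξ, ⟨-, ⟨σ, -, hξ⟩, hsup⟩, p, hp, rfl⟩
  -- For `lam = 0` the vector `q` drops out of the maximum condition and the adjoint arc, so any
  -- supergradient serves.
  obtain ⟨q, hq⟩ := hg.superdiff_nonempty (y τ)
  have hc : ContinuousOn (fun ω => inner ℝ ξ (P.f (y τ) ω)) P.U :=
    continuousOn_const.inner (𝕜 := ℝ) (hP.continuousOn_f_right _)
  refine h.mem_proximalNormals hx hopt hξ le_rfl hq (fun ω hω => ?_) ?_ ?_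
  · have h1 := le_csSup (hP.isCompact.image_of_continuousOn hc).bddAbove ⟨ω, hω, rfl⟩
    rw [hsup] at h1
    simpa using h1
  · obtain ⟨ω, hω, heq⟩ := hP.isCompact.exists_sSup_image_eq hP.nonempty hc
    rw [hsup] at heq
    exact ⟨ω, hω, by simp [← heq]⟩
  · rw [zero_smul, zero_sub]
    exact isAdjointArc_zero_iff.2 hp

/-- The unit vector `ξ` is recovered from `lam • q` and `p(τ)`, and `p(τ)` is bounded through `p(0)`
and `lam`. This lower bound on the normal is what converts the constant `C` into a radius. -/
theorem Regular.one_le_mul_norm_pt (hP : P.Regular N r₀ L) (hu : P.Admissible u)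
    (hy : ContinuousOn y (Ici 0)) (hτ : 0 ≤ τ) {M : ℝ} (hτM : τ ≤ M) (hlam : 0 ≤ lam)
    (hξ : ‖ξ‖ = 1) (hG0 : 0 ≤ G) (hq : ‖q‖ ≤ G) (hp : P.IsAdjointArc u y lam τ (lam • q - ξ) p) :
    1 ≤ 2 * (Real.exp (L * M) * (1 + L * M) + G) * ‖pt (-p 0) lam‖ := by
  have hL := hP.L_nonneg
  have hM : 0 ≤ M := hτ.trans hτM
  have h1 := hP.norm_adjointArc_end_le hu hy hlam hτ hp
  have h2 : ‖ξ‖ ≤ ‖lam • q - ξ‖ + lam * G := by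
    have e1 : ξ = lam • q - (lam • q - ξ) := by abel
    have e2 := norm_sub_le (lam • q) (lam • q - ξ)
    rw [← e1, norm_smul, Real.norm_of_nonneg hlam] at e2
    linarith [mul_le_mul_of_nonneg_left hq hlam]
  have hsq : ‖pt (-p 0) lam‖ ^ 2 = ‖p 0‖ ^ 2 + lam ^ 2 := by
    rw [WithLp.prod_norm_sq_eq_of_L2]
    simp [pt]
  have h3 : ‖p 0‖ ≤ ‖pt (-p 0) lam‖ :=
    le_of_sq_le_sq (by rw [hsq]; nlinarith [sq_nonneg lam]) (norm_nonneg _)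
  have h4 : lam ≤ ‖pt (-p 0) lam‖ :=
    le_of_sq_le_sq (by rw [hsq]; nlinarith [sq_nonneg ‖p 0‖]) (norm_nonneg _)
  have h5 : (‖p 0‖ + lam * L * τ) * Real.exp (L * τ)
      ≤ (‖p 0‖ + lam) * (1 + L * M) * Real.exp (L * M) := by
    have e1 : L * τ ≤ L * M := mul_le_mul_of_nonneg_left hτM hL
    refine mul_le_mul ?_ (Real.exp_le_exp.2 e1) (Real.exp_pos _).le (by positivity)
    have e2 := mul_le_mul_of_nonneg_left e1 hlam
    have e3 : 0 ≤ ‖p 0‖ * (L * M) := by positivity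
    nlinarith
  have h6 : (‖p 0‖ + lam) * (1 + L * M) * Real.exp (L * M) + lam * G
      ≤ (‖p 0‖ + lam) * (Real.exp (L * M) * (1 + L * M) + G) := by
    have : 0 ≤ ‖p 0‖ * G := by positivity
    linarith
  have h7 : (‖p 0‖ + lam) * (Real.exp (L * M) * (1 + L * M) + G)
      ≤ (2 * ‖pt (-p 0) lam‖) * (Real.exp (L * M) * (1 + L * M) + G) :=
    mul_le_mul_of_nonneg_right (by linarith) (by positivity)
  rw [hξ] at h2
  linarith

/-- A locally uniform exterior sphere condition. -/
theorem Regular.exists_uniform_radius (hP : P.Regular N r₀ L) (h0 : P.H0) (hS : IsClosed P.S)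
    (hG : P.TerminalBound N r₀ G) (hqG : ∀ z ∈ frontier P.S, ∀ q ∈ superdiff P.g z, ‖q‖ ≤ G)
    (hg : LocallySemiconcave P.g) {ρ₀ : ℝ} (h4 : P.H4 ρ₀) (M : ℝ) :
    ∃ ρ > 0, ∀ x ∈ P.R \ P.S, max ‖x‖ (P.V x) ≤ M → ∃ v ≠ 0,
      RealizedByBall (hypo (P.R \ P.S) P.V) (pt x (P.V x)) v ρ := by
  by_cases hne : (frontier P.S).Nonempty
  swap
  · refine ⟨1, one_pos, ?_⟩
    rintro x ⟨⟨u, y, τ, hs⟩, hxS⟩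
    exact absurd ⟨_, hs.mem_frontier hxS⟩ hne
  obtain ⟨z₀, hz₀⟩ := hne
  obtain ⟨hρ₀, h4⟩ := h4
  have hN := hP.N_pos
  have hL := hP.L_nonneg
  have hG0 := hG.nonneg
  have hηpos : 0 < r₀ - G * N := by linarith [hG.mul_lt]
  -- `T` bounds the optimal exit times by `exit_time_le`, and `M'` below collects bounds for `τ`,
  -- `‖y τ‖`, `‖ξ‖`, `lam` and the curvature `1 / (2ρ₀)` of the normal.
  obtain ⟨T, hT⟩ : ∃ T, T = |(M - P.g z₀ + G * (M + ‖z₀‖)) / (r₀ - G * N)| := ⟨_, rfl⟩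
  have hT0 : 0 ≤ T := hT ▸ abs_nonneg _
  obtain ⟨M', hM'⟩ : ∃ M', M' = |M| + T + N * T + 1 + N / (r₀ - G * N) + 1 / (2 * ρ₀) := ⟨_, rfl⟩
  have n1 := abs_nonneg M
  have n2 : 0 ≤ N * T := by positivity
  have n3 : 0 ≤ N / (r₀ - G * N) := by positivity
  have n4 : 0 ≤ 1 / (2 * ρ₀) := by positivity
  have hM'0 : 0 ≤ M' := by linarith
  obtain ⟨C, hC, hb⟩ := hP.supergradientBound hS hG hqG hg M'
  obtain ⟨K, hK⟩ : ∃ K, K = 2 * (Real.exp (L * M') * (1 + L * M') + G) := ⟨_, rfl⟩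
  have hKpos : 0 < K := by
    have := Real.exp_pos (L * M')
    rw [hK]; positivity
  -- With this radius `‖v‖ / (2ρ) = K ‖v‖ (C + 1)`, which is at least `C` because `K ‖v‖ ≥ 1`.
  refine ⟨1 / (2 * K * (C + 1)), by positivity, fun x hx hxM => ?_⟩
  obtain ⟨u, y, τ, hopt⟩ := hP.exists_isOptimal h0 hS hG hx
  have hxM1 : ‖x‖ ≤ M := (le_max_left _ _).trans hxM
  have hxM2 : P.V x ≤ M := (le_max_right _ _).trans hxM
  have hzfr := hopt.1.mem_frontier hx.2
  have hτT : τ ≤ T := by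
    have e1 := hP.exit_time_le hG hx.2 hopt.1 hz₀
    rw [hopt.2] at e1
    have e2 : G * ‖x - z₀‖ ≤ G * (M + ‖z₀‖) :=
      mul_le_mul_of_nonneg_left ((norm_sub_le _ _).trans (by linarith)) hG0
    rw [hT]
    refine le_trans ?_ (le_abs_self _)
    rw [le_div_iff₀ hηpos]
    linarith
  have hyτ : ‖y τ‖ ≤ |M| + N * T := by
    have e1 := hP.norm_trajectory_sub_le hopt.1.1 hopt.1.2.1 le_rfl hopt.1.nonneg
    rw [hopt.1.2.1.apply_zero, sub_zero, abs_of_nonneg hopt.1.nonneg] at e1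
    have e2 : y τ = (y τ - x) + x := by abel
    rw [e2]
    refine (norm_add_le _ _).trans ?_
    linarith [mul_le_mul_of_nonneg_left hτT hN.le, le_abs_self M]
  obtain ⟨ξ, -, hξ1, hξ⟩ := h4 _ hzfr
  obtain ⟨q, hq⟩ := hg.superdiff_nonempty (y τ)
  have hqn := hqG _ hzfr q hq
  obtain ⟨lam, hlam, hlamle, hle, ω, hω, heq⟩ :=
    hP.exists_multiplier hG hqn hopt.1 hx.2 n4 hξ1 hξ
  obtain ⟨p, hp⟩ := hP.exists_adjointArc hopt.1.1 hopt.1.2.1.1 τ hlam (lam • q - ξ)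
  have hnorm := hP.one_le_mul_norm_pt hopt.1.1 hopt.1.2.1.1 hopt.1.nonneg
    (by linarith : τ ≤ M') hlam hξ1 hG0 hqn hp
  rw [← hK] at hnorm
  refine ⟨pt (-p 0) lam, fun hv => ?_, fun w hw => ?_⟩
  · rw [hv, norm_zero, mul_zero] at hnorm
    linarith
  · refine (hb x hx u y τ hopt (by linarith) (by linarith) ξ q lam p
      ⟨by linarith, hlam, by linarith, hq, fun w hw => (hξ w hw).trans ?_, hle, ω, hω, heq.ge⟩
      hp w hw).trans ?_
    · exact mul_le_mul_of_nonneg_right (by linarith) (sq_nonneg _)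
    · refine mul_le_mul_of_nonneg_right ?_ (sq_nonneg _)
      have e1 : ‖pt (-p 0) lam‖ / (2 * (1 / (2 * K * (C + 1)))) = K * ‖pt (-p 0) lam‖ * (C + 1) := by
        field_simp
      rw [e1]
      nlinarith

end Problem

end ExitTime

end

/-! ### Proof of the theorem -/

theorem theorem3p1 {d m : ℕ} (P : ExitTime.Problem d m)
    (hU : IsCompact P.U) (hU_ne : P.U.Nonempty)
    (hS : IsClosed P.S) (hS_ne : P.S.Nonempty)
    (N r₀ ρ₀ : ℝ)
    (h0 : P.H0) (h1 : P.H1 N) (h2 : P.H2 r₀) (h3 : P.H3 N r₀) (h4 : P.H4 ρ₀)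
    (hg : ExitTime.LocallySemiconcave P.g)
    (hV : ContinuousOn P.V (P.R \ P.S)) :
    (∃ ρ : ExitTime.E d → ℝ, ExitTime.HypoExteriorSphere (P.R \ P.S) P.V ρ ∧
      ∀ M : ℝ, ∃ c > (0 : ℝ), ∀ x ∈ P.R \ P.S, ‖x‖ ≤ M → P.V x ≤ M → c ≤ ρ x) ∧
    (∀ x ∈ P.R \ P.S, (P.N1dag x ∪ P.N0dag x).Nonempty) ∧
    (∀ x ∈ P.R \ P.S,
      ExitTime.horizontalSuperdiff (P.R \ P.S) P.V x + convexHull ℝ (P.N1dag x)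
        ⊆ ExitTime.proximalSuperdiff (P.R \ P.S) P.V x ∧
      convexHull ℝ (P.N0dag x ∪ {0})
        ⊆ ExitTime.horizontalSuperdiff (P.R \ P.S) P.V x) := by
  obtain ⟨L, hP⟩ := ExitTime.Problem.exists_regular hU hU_ne h1 h2
  obtain ⟨G, hG, hqG⟩ := h3.exists_terminalBound hP.N_pos
  have hbound := hP.supergradientBound hS hG hqG hg
  refine ⟨?_, fun x hx => ?_, fun x hx => ⟨?_, ?_⟩⟩
  -- Continuity of `V` enters only here: the level function `max ‖x‖ (V x)` must be continuous for
  -- the radius to be.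
  · obtain ⟨ρ, hρc, hρpos, hρ, hρlow⟩ := ExitTime.exists_continuous_radius (Ω := P.R \ P.S)
      (s := fun x => max ‖x‖ (P.V x)) (continuousOn_id.norm.sup hV)
      (fun x _ => (norm_nonneg x).trans (le_max_left _ _))
      (p := fun x ρ => ∃ v ≠ 0, ExitTime.RealizedByBall (ExitTime.hypo (P.R \ P.S) P.V)
        (ExitTime.pt x (P.V x)) v ρ)
      (fun x ρ ρ' hρ hle ⟨v, hv, h⟩ => ⟨v, hv, fun w hw => (h w hw).trans (by gcongr)⟩)
      (fun M => hP.exists_uniform_radius h0 hS hG hqG hg h4 M)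
    refine ⟨ρ, ⟨hρc, hρpos, fun x hx => ?_⟩, fun M => ?_⟩
    · obtain ⟨v, hv, h⟩ := hρ x hx
      have := hρpos x hx
      exact ⟨v, ⟨‖v‖ / (2 * ρ x), by positivity, h⟩, hv, h⟩
    · obtain ⟨c, hc, h⟩ := hρlow M
      exact ⟨c, hc, fun x hx hxM hVM => h x hx (max_le hxM hVM)⟩
  · obtain ⟨u, y, τ, hopt⟩ := hP.exists_isOptimal h0 hS hG hx
    have hz := hopt.1.mem_frontier hx.2
    obtain ⟨q, hq⟩ := hg.superdiff_nonempty (y τ)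
    obtain ⟨hρ₀, h4⟩ := h4
    obtain ⟨ξ, -, hξ1, hξ⟩ := h4 _ hz
    exact hP.N1dag_union_N0dag_nonempty hG hq (hqG _ hz q hq) hopt hx.2 (by positivity) hξ1 hξ
  · rintro _ ⟨v, hv, w, hw, rfl⟩
    exact ExitTime.add_mem_proximalSuperdiff hv
      (convexHull_min (hP.N1dag_subset hbound hx) (ExitTime.convex_proximalSuperdiff _ _ _) hw)
  · exact convexHull_min (union_subset (hP.N0dag_subset hbound hg hx)
      (singleton_subset_iff.2 (ExitTime.zero_mem_horizontalSuperdiff _ _ _)))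
      (ExitTime.convex_horizontalSuperdiff _ _ _)
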